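/- **Notation.** An index is a finite tuple $\boldsymbol{k}=(k_1,\dots,k_r)$ of positive integers; it is admissible if it is empty or $k_r\ge 2$. $\{1\}^a$ denotes $1$ repeated $a$ times. *Case $\mathcal{A}$.* For $n\ge 1$ let $\mathcal{A}_n=\prod_p\mathbb{Z}/p^n\mathbb{Z}\big/\bigoplus_p\mathbb{Z}/p^n\mathbb{Z}$ ($p$ running over all primes), which is a $\mathbb{Q}$-algebra, and set $$\zeta_{\mathcal{A}_n}(\boldsymbol{k})=\Bigl(\sum_{0<n_1<\cdots<n_r<p}\frac{1}{n_1^{k_1}\cdots n_r^{k_r}}\bmod p^n\Bigr)_p,\qquad \zeta^\star_{\mathcal{A}_n}(\boldsymbol{k})=\Bigl(\sum_{1\le n_1\le\cdots\le n_r\le p-1}\frac{1}{n_1^{k_1}\cdots n_r^{k_r}}\bmod p^n\Bigr)_p,$$ $$\mathfrak{Z}_{\mathcal{A}_n}(k)=\Bigl(\frac{B_{p^{n-1}(p-1)-k+1}}{k-1+p^{n-1}}\bmod p^n\Bigr)_p\quad(k\ge 2),\qquad x_{\mathcal{A}_n}=(p\bmod p^n)_p,$$ where $B_j$ is the $j$-th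 Bernoulli number (finitely many primes may be disregarded). *Case $\mathcal{S}$.* For admissible $\boldsymbol{k}$ let $\zeta(\boldsymbol{k})=\sum_{0<n_1<\cdots<n_r}n_1^{-k_1}\cdots n_r^{-k_r}$, with $\zeta(\varnothing)=1$; let $\mathcal{Z}\subset\mathbb{R}$ be the $\mathbb{Q}$-subalgebra generated by all these values and $\overline{\mathcal{Z}}=\mathcal{Z}/\zeta(2)\mathcal{Z}$. In $\mathbb{Q}\langle e_0,e_1\rangle$ put $e_{\boldsymbol{k}}=e_1e_0^{k_1-1}\cdots e_1e_0^{k_r-1}$, $\mathfrak{H}^1=\mathbb{Q}+e_1\mathbb{Q}\langle e_0,e_1\rangle$ and $\mathfrak{H}^0=\mathbb{Q}+e_1\mathbb{Q}\langle e_0,e_1\rangle e_0$. Every $f\in\mathfrak{H}^1$ is uniquely a finite sum $f=\sum_{i\ge 0} f_i \mathbin{\sqcup\!\sqcup} e_1^{\sqcup\!\sqcup\, i}$ with $f_i\in\mathfrak{H}^0$, where $\mathbin{\sqcup\!\sqcup}$ is the shuffle product and $e_1^{\sqcup\!\sqcup\, i}$ the $i$-th shuffle power of $e_1$; put $\mathrm{reg}(f)=f_0$.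 The shuffle regularized value of any index $\boldsymbol{k}$ is $\zeta^{\rm sh}(\boldsymbol{k})=Z(\mathrm{reg}(e_{\boldsymbol{k}}))\in\mathcal{Z}$, where $Z\colon\mathfrak{H}^0\to\mathcal{Z}$ is the $\mathbb{Q}$-linear map with $Z(e_{\boldsymbol{l}})=\zeta(\boldsymbol{l})$ for admissible $\boldsymbol{l}$. Let $\zeta_{\widehat{\mathcal{S}}}(\boldsymbol{k})\in\overline{\mathcal{Z}}[[t]]$ be the coefficientwise reduction modulo $\zeta(2)$ of $$\sum_{i=0}^r(-1)^{k_{i+1}+\cdots+k_r}\zeta^{\rm sh}(k_1,\dots,k_i)\sum_{l_{i+1},\dots,l_r\ge 0}\Bigl[\prod_{j=i+1}^r\binom{k_j+l_j-1}{l_j}\Bigr]\zeta^{\rm sh}(k_r+l_r,\dots,k_{i+1}+l_{i+1})\,t^{l_{i+1}+\cdots+l_r},$$ and let $\zeta^\star_{\widehat{\mathcal{S}}}(\boldsymbol{k})=\sum\zeta_{\widehat{\mathcal{S}}}(k_1\,\square\cdots\square\,k_r)$, summed over all choices of each $\square$ as a comma or a plus sign. In $\overline{\mathcal{Z}}[[t]]/(t^n)$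 set $$\zeta_{\mathcal{S}_n}(\boldsymbol{k})=\zeta_{\widehat{\mathcal{S}}}(\boldsymbol{k})\bmod t^n,\quad \zeta^\star_{\mathcal{S}_n}(\boldsymbol{k})=\zeta^\star_{\widehat{\mathcal{S}}}(\boldsymbol{k})\bmod t^n,\quad \mathfrak{Z}_{\mathcal{S}_n}(k)=\zeta(k)\bmod\zeta(2)\ (k\ge 2),\quad x_{\mathcal{S}_n}=t\bmod t^n.$$ **Theorem.** Let $a$ and $b$ be non-negative integers with $a+b$ even. Then for both $\mathcal{F}=\mathcal{A}$ and $\mathcal{F}=\mathcal{S}$, $$\zeta_{\mathcal{F}_2}(\{1\}^a,2,\{1\}^b)=\frac12\left\{1+(-1)^a\binom{a+b+3}{b+2}\right\}\mathfrak{Z}_{\mathcal{F}_2}(a+b+3)\,x_{\mathcal{F}_2},$$ $$\zeta^\star_{\mathcal{F}_2}(\{1\}^a,2,\{1\}^b)=\frac12\left\{1+(-1)^a\binom{a+b+3}{a+2}\right\}\mathfrak{Z}_{\mathcal{F}_2}(a+b+3)\,x_{\mathcal{F}_2}.$$ -/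

import Mathlib

noncomputable section

namespace FMZV

/-! ## Indices -/

/-- An index: a finite tuple of positive integers. -/
abbrev Index := List ℕ+

/-- An index `(k₁, …, k_r)` is admissible if it is empty or `k_r ≥ 2`. -/
def Admissible (k : Index) : Prop := ∀ m ∈ k.getLast?, 2 ≤ m

/-- The weight `k₁ + ⋯ + k_r`. -/
def wt (k : Index) : ℕ := (k.map fun m => (m : ℕ)).sum

/-- The index `({1}^a, 2, {1}^b)`. -/
def oneTwoOne (a b : ℕ) : Index := List.replicate a 1 ++ [2] ++ List.replicate b 1

/-- All indices `(k₁ □ ⋯ □ k_r)` where each `□` is either a comma or a plus, listed once for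
each of the `2 ^ (r - 1)` choices of the squares. -/
def coarsenings : Index → List Index
  | [] => [[]]
  | k :: ks => (coarsenings ks).flatMap fun l =>
      match l with
      | [] => [[k]]
      | m :: ms => [k :: m :: ms, (k + m) :: ms]

/-! ## The ring `𝒜ₙ` and the `𝒜ₙ`-multiple zeta(-star) values -/

/-- The ideal `⨁_p ℤ/pⁿℤ` of `∏_p ℤ/pⁿℤ`. -/
def finiteSupportIdeal (n : ℕ) : Ideal (∀ p : Nat.Primes, ZMod ((p : ℕ) ^ n)) where
  carrier := {f | {p | f p ≠ 0}.Finite}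
  zero_mem' := by simp
  add_mem' := by
    intro f g hf hg
    refine (Set.Finite.union hf hg).subset ?_
    intro p hp
    by_contra h
    simp only [Set.mem_union, Set.mem_ofPred_eq, not_or, not_not] at h
    exact hp (by simp [h.1, h.2])
  smul_mem' := by
    intro c f hf
    refine Set.Finite.subset hf ?_
    intro p hp h
    exact hp (by simp [h])

/-- `𝒜ₙ = ∏_p ℤ/pⁿℤ / ⨁_p ℤ/pⁿℤ`, where `p` runs over all primes. -/
abbrev A (n : ℕ) : Type := (∀ p : Nat.Primes, ZMod ((p : ℕ) ^ n)) ⧸ finiteSupportIdeal n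

/-- The class `(f p)_p` in `𝒜ₙ`. -/
def A.mk (n : ℕ) (f : ∀ p : Nat.Primes, ZMod ((p : ℕ) ^ n)) : A n :=
  Ideal.Quotient.mk (finiteSupportIdeal n) f

theorem A.isUnit_intCast (n : ℕ) (m : ℤ) (hm : m ≠ 0) : IsUnit (Int.castRingHom (A n) m) := by
  refine IsUnit.of_mul_eq_one
    (Ideal.Quotient.mk (finiteSupportIdeal n) fun p => ((m : ZMod ((p : ℕ) ^ n)))⁻¹) ?_
  have h1 : Int.castRingHom (A n) m = Ideal.Quotient.mk (finiteSupportIdeal n)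
      (m : ∀ p : Nat.Primes, ZMod ((p : ℕ) ^ n)) := by simp
  rw [h1, ← map_mul, ← map_one (Ideal.Quotient.mk (finiteSupportIdeal n)), Ideal.Quotient.eq]
  have hfin : {p : Nat.Primes | (p : ℕ) ≤ m.natAbs}.Finite :=
    Set.Finite.preimage (Set.injOn_of_injective Subtype.val_injective) (Set.finite_Iic m.natAbs)
  refine hfin.subset ?_
  intro p hp
  by_contra hlt
  simp only [Set.mem_ofPred_eq, not_le] at hlt
  apply hp
  have hcop : Nat.Coprime m.natAbs ((p : ℕ) ^ n) := by
    apply Nat.Coprime.pow_right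
    apply Nat.Coprime.symm
    rw [Nat.Prime.coprime_iff_not_dvd p.2]
    intro hd
    exact absurd (Nat.le_of_dvd (Int.natAbs_pos.mpr hm) hd) (by omega)
  have hu : (m : ZMod ((p : ℕ) ^ n)) * ((m : ZMod ((p : ℕ) ^ n)))⁻¹ = 1 :=
    ZMod.mul_inv_of_unit _ ((ZMod.coe_int_isUnit_iff_isCoprime m _).2
      (Int.isCoprime_iff_gcd_eq_one.2 (by
        rw [Int.gcd_comm]; simpa [Int.gcd, Int.natAbs_pow] using hcop)))
  simp [hu]

/-- `𝒜ₙ` is a `ℚ`-algebra, since every nonzero integer is invertible in it. -/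
instance A.instAlgebraRat (n : ℕ) : Algebra ℚ (A n) :=
  (IsLocalization.lift (M := nonZeroDivisors ℤ) (S := ℚ) (g := Int.castRingHom (A n))
    fun m => A.isUnit_intCast n m (nonZeroDivisors.coe_ne_zero m)).toAlgebra

open Classical in
/-- `ζ_{𝒜ₙ}(k) = (∑_{0 < ν₁ < ⋯ < ν_r < p} ∏ᵢ νᵢ ^ (-kᵢ) mod pⁿ)_p`. -/
def zetaA (n : ℕ) (k : Index) : A n :=
  A.mk n fun p =>
    ∑ ν ∈ (Fintype.piFinset fun _ : Fin k.length => Finset.Ioo 0 (p : ℕ)).filter StrictMono,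
      ∏ i, ((ν i : ZMod ((p : ℕ) ^ n))⁻¹) ^ (k.get i : ℕ)

open Classical in
/-- `ζ^⋆_{𝒜ₙ}(k) = (∑_{1 ≤ ν₁ ≤ ⋯ ≤ ν_r ≤ p - 1} ∏ᵢ νᵢ ^ (-kᵢ) mod pⁿ)_p`. -/
def zetaStarA (n : ℕ) (k : Index) : A n :=
  A.mk n fun p =>
    ∑ ν ∈ (Fintype.piFinset fun _ : Fin k.length => Finset.Ioo 0 (p : ℕ)).filter Monotone,
      ∏ i, ((ν i : ZMod ((p : ℕ) ^ n))⁻¹) ^ (k.get i : ℕ)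

/-- The residue modulo `N` of a rational number whose denominator is prime to `N`. -/
def ratMod (N : ℕ) (q : ℚ) : ZMod N := (q.num : ZMod N) * (q.den : ZMod N)⁻¹

/-- `𝔷_{𝒜ₙ}(k) = (B_{p^(n-1)(p-1)-k+1} / (k - 1 + p^(n-1)) mod pⁿ)_p`. For `k ≥ 2` and all but
finitely many `p` the index of the Bernoulli number is nonnegative and the quotient is a `p`-adic
integer; the remaining `p` do not affect the class. -/
def frakZA (n : ℕ) (k : ℕ+) : A n :=
  A.mk n fun p => ratMod ((p : ℕ) ^ n)
    (bernoulli ((p : ℕ) ^ (n - 1) * ((p : ℕ) - 1) + 1 - (k : ℕ)) /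
      ((k : ℚ) - 1 + ((p : ℕ) : ℚ) ^ (n - 1)))

/-- `x_{𝒜ₙ} = (p mod pⁿ)_p`. -/
def xA (n : ℕ) : A n := A.mk n fun p => ((p : ℕ) : ZMod ((p : ℕ) ^ n))

/-! ## Multiple zeta values -/

/-- `ζ(k) = ∑_{0 < ν₁ < ⋯ < ν_r} ∏ᵢ νᵢ ^ (-kᵢ)`, a convergent series for admissible `k`. -/
def mzv (k : Index) : ℝ :=
  ∑' ν : {ν : Fin k.length → ℕ+ // StrictMono ν},
    ∏ i, 1 / ((ν.1 i : ℕ) : ℝ) ^ (k.get i : ℕ)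

/-- The `ℚ`-subalgebra `𝒵` of `ℝ` generated by all multiple zeta values. -/
def ZAlg : Subalgebra ℚ ℝ := Algebra.adjoin ℚ {x | ∃ k, Admissible k ∧ mzv k = x}

open Classical in
/-- `ζ(k)` as an element of `𝒵`, for admissible `k` (and `0` for the other indices). -/
def zeta (k : Index) : ZAlg :=
  if h : Admissible k then ⟨mzv k, Algebra.subset_adjoin ⟨k, h, rfl⟩⟩ else 0

/-- `𝒵̄ = 𝒵 / ζ(2)𝒵`. -/
abbrev ZBar : Type := ZAlg ⧸ Ideal.span {zeta [2]}

/-! ## Shuffle regularization -/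

/-- The letters `e₀` and `e₁`. -/
inductive Letter
  | e0
  | e1

/-- Words in `e₀` and `e₁`. -/
abbrev Word := List Letter

/-- The `ℚ`-vector space underlying `ℚ⟨e₀, e₁⟩`: finite formal combinations of words. -/
abbrev NCPoly := Word →₀ ℚ

/-- The word `e_k = e_{k₁} ⋯ e_{k_r}`, where `e_m = e₁ e₀^(m-1)`. -/
def indexWord (k : Index) : Word :=
  k.flatMap fun m => Letter.e1 :: List.replicate ((m : ℕ) - 1) Letter.e0

/-- Auxiliary to `wordIndex`: the number of `e₀`'s at the beginning of a word, and the index of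
the rest of the word. -/
def wordIndexAux : Word → ℕ × Index
  | [] => (0, [])
  | Letter.e0 :: w => ((wordIndexAux w).1 + 1, (wordIndexAux w).2)
  | Letter.e1 :: w => (0, (wordIndexAux w).1.succPNat :: (wordIndexAux w).2)

/-- The index `k` with `e_k = w`, for a word `w` not beginning with `e₀`. -/
def wordIndex (w : Word) : Index := (wordIndexAux w).2

theorem wordIndexAux_replicate (n : ℕ) (w : Word) :
    wordIndexAux (List.replicate n Letter.e0 ++ w) =
      (n + (wordIndexAux w).1, (wordIndexAux w).2) := by
  induction n with
  | zero => simp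
  | succ n ih =>
    simp only [List.replicate_succ, List.cons_append, wordIndexAux, ih]
    ext1 <;> simp; omega

theorem wordIndexAux_indexWord (k : Index) : wordIndexAux (indexWord k) = (0, k) := by
  induction k with
  | nil => rfl
  | cons m k ih =>
    have h : indexWord (m :: k) =
        Letter.e1 :: (List.replicate ((m : ℕ) - 1) Letter.e0 ++ indexWord k) := by
      simp [indexWord]
    rw [h, wordIndexAux, wordIndexAux_replicate, ih]
    have : ((m : ℕ) - 1).succPNat = m := by
      apply PNat.eq
      have := m.pos
      simp only [Nat.succPNat_coe]
      omega
    simp [this]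

theorem wordIndex_indexWord (k : Index) : wordIndex (indexWord k) = k := by
  rw [wordIndex, wordIndexAux_indexWord]

/-- The subspace `𝔥⁰ = ℚ + e₁ ℚ⟨e₀, e₁⟩ e₀`: the span of the empty word and the words that begin
with `e₁` and end with `e₀`. -/
def H0 : Submodule ℚ NCPoly :=
  Finsupp.supported ℚ ℚ
    {w | w = [] ∨ (w.head? = some Letter.e1 ∧ w.getLast? = some Letter.e0)}

/-- The `ℚ`-linear map `Z : 𝔥⁰ → 𝒵` with `Z(e_k) = ζ(k)` for every admissible index `k`. -/
def evalZ : H0 →ₗ[ℚ] ZAlg :=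
  (Finsupp.linearCombination ℚ fun w : Word => zeta (wordIndex w)).comp H0.subtype

/-- The shuffle product of two words. -/
def shuffleWord : Word → Word → NCPoly
  | [], v => Finsupp.single v 1
  | x :: u, [] => Finsupp.single (x :: u) 1
  | x :: u, y :: v =>
      (shuffleWord u (y :: v)).mapDomain (List.cons x) +
        (shuffleWord (x :: u) v).mapDomain (List.cons y)
termination_by u v => u.length + v.length

/-- The shuffle product on `ℚ⟨e₀, e₁⟩`, the bilinear extension of `shuffleWord`. -/
def shuffle (f g : NCPoly) : NCPoly :=
  f.sum fun u a => g.sum fun v b => (a * b) • shuffleWord u v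

/-- The `i`-fold shuffle power of `e₁`. -/
def e1ShufflePow : ℕ → NCPoly
  | 0 => Finsupp.single [] 1
  | i + 1 => shuffle (e1ShufflePow i) (Finsupp.single [Letter.e1] 1)

/-- `f = ∑ᵢ cᵢ ш e₁^{ш i}` for some finitely many `cᵢ ∈ 𝔥⁰` with `c₀ = f₀`. -/
def IsShuffleReg (f : NCPoly) (f₀ : H0) : Prop :=
  ∃ c : ℕ →₀ H0, c 0 = f₀ ∧ f = c.sum fun i ci => shuffle (ci : NCPoly) (e1ShufflePow i)

/-- The shuffle regularization `reg_ш(f)`: the constant term `c₀` of the unique expression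
`f = ∑ᵢ cᵢ ш e₁^{ш i}` with `cᵢ ∈ 𝔥⁰`, which exists for all `f` in `ℚ + e₁ ℚ⟨e₀, e₁⟩`. -/
def regSh (f : NCPoly) : H0 := Classical.epsilon (IsShuffleReg f)

/-- The shuffle regularized multiple zeta value `ζ^ш(k) = Z(reg_ш(e_k))`. -/
def zetaSh (k : Index) : ZAlg := evalZ (regSh (Finsupp.single (indexWord k) 1))

/-! ## `t`-adic symmetric and `𝒮ₙ`-multiple zeta(-star) values -/

/-- `(k_r + l_r, …, k₁ + l₁)`. -/
def addReverse (k : Index) (l : Fin k.length → ℕ) : Index :=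
  (List.ofFn fun j => (⟨(k.get j : ℕ) + l j, Nat.add_pos_left (k.get j).pos _⟩ : ℕ+)).reverse

/-- The power series
`∑_{l₁, …, l_r ≥ 0} [∏ⱼ (kⱼ + lⱼ - 1 choose lⱼ)] ζ^ш(k_r + l_r, …, k₁ + l₁) t^(l₁ + ⋯ + l_r)`. -/
def tailSeries (k : Index) : PowerSeries ZAlg :=
  PowerSeries.mk fun m => ∑ l ∈ Finset.Nat.antidiagonalTuple k.length m,
    ((∏ j, ((k.get j : ℕ) + l j - 1).choose (l j) : ℕ) : ZAlg) * zetaSh (addReverse k l)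

/-- `ζ^ш_Ŝ(k) = ∑_{i=0}^r (-1)^(k_{i+1} + ⋯ + k_r) ζ^ш(k₁, …, kᵢ) ∑_l ⋯` in `𝒵⟦t⟧`. -/
def zetaShatSh (k : Index) : PowerSeries ZAlg :=
  ∑ i ∈ Finset.range (k.length + 1),
    (-1) ^ wt (k.drop i) * PowerSeries.C (zetaSh (k.take i)) * tailSeries (k.drop i)

/-- The `t`-adic symmetric multiple zeta value `ζ_Ŝ(k) = ζ^ш_Ŝ(k) mod ζ(2)` in `𝒵̄⟦t⟧`. -/
def zetaShat (k : Index) : PowerSeries ZBar :=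
  PowerSeries.map (Ideal.Quotient.mk (Ideal.span {zeta [2]})) (zetaShatSh k)

/-- The `t`-adic symmetric multiple zeta-star value
`ζ^⋆_Ŝ(k) = ∑ ζ_Ŝ(k₁ □ ⋯ □ k_r)`, each `□` being a comma or a plus. -/
def zetaStarShat (k : Index) : PowerSeries ZBar := ((coarsenings k).map zetaShat).sum

/-- The ring `𝒵̄⟦t⟧ / (tⁿ)`. -/
abbrev S (n : ℕ) : Type :=
  PowerSeries ZBar ⧸ Ideal.span {(PowerSeries.X : PowerSeries ZBar) ^ n}

/-- The projection `πₙ : 𝒵̄⟦t⟧ → 𝒵̄⟦t⟧ / (tⁿ)`. -/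
def S.proj (n : ℕ) : PowerSeries ZBar →+* S n := Ideal.Quotient.mk _

/-- `ζ_{𝒮ₙ}(k) = πₙ(ζ_Ŝ(k))`. -/
def zetaS (n : ℕ) (k : Index) : S n := S.proj n (zetaShat k)

/-- `ζ^⋆_{𝒮ₙ}(k) = πₙ(ζ^⋆_Ŝ(k))`. -/
def zetaStarS (n : ℕ) (k : Index) : S n := S.proj n (zetaStarShat k)

/-- `𝔷_{𝒮ₙ}(k) = ζ(k) mod ζ(2)`, for `k ≥ 2`. -/
def frakZS (n : ℕ) (k : ℕ+) : S n :=
  S.proj n (PowerSeries.C (Ideal.Quotient.mk (Ideal.span {zeta [2]}) (zeta [k])))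

/-- `x_{𝒮ₙ} = t mod tⁿ`. -/
def xS (n : ℕ) : S n := S.proj n PowerSeries.X

end FMZV

end

/-! Write x for the class of p or of t, so that x² = 0 in both rings. Both cases use the antipode
relation between values and star values (`conv_zetaA`, `conv_zetaS`): the convolution of ζ(k) with
(-1)^length · ζ^⋆(reversed index) is the unit. The values at {1}^i with i > 0 are multiples of x and
vanish for odd i. Hence, for a + b even, every product in the relation at ({1}^a, 2, {1}^b) dies,
and ζ^⋆({1}^a, 2, {1}^b) = ζ({1}^b, 2, {1}^a) (`coarseSum_oneTwoOne`). So one kind of value has to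
be evaluated in each case: the star values for 𝒜, the non-star values for 𝒮.

Case 𝒜. A binomial transform rewrites the star sum as the sum over m of (-1)^(m-1) C(p-1, m)
m^(-b-1) ∑_{i ≤ m} i^(-a-1), and (-1)^m C(p-1, m) ≡ 1 - p H_m modulo p², where H_m is the harmonic
number. The reflection n ↦ p - n and the stuffle product reduce this to -1/2 ∑ n^(-a-b-2) plus p
times double sums of odd weight (`two_mul_nestedSumStar_oneTwoOne`). Modulo p, Faulhaber's formula
evaluates such a double sum, because a single Bernoulli number survives (`p_mul_doubleSum`). A
Kummer congruence relates that number to ∑ n^(-a-b-2), which modulo p² is (a+b+2) 𝔷(a+b+3) p.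

Case 𝒮. The constant coefficient of ζ_{𝒮₂}({1}^a, 2, {1}^b) consists of multiples of ζ(a+b+2), which
vanish modulo ζ(2). The coefficient of t is, modulo ζ(2), the derivative `indexDeriv` of the shuffle
regularized values at the reversed index. The regularization formula and duality turn it into double
zeta values of weight a+b+3. A product of two zeta values of odd total weight lies in ζ(2)𝒵, so the
stuffle product, the shuffle product and the sum formula become linear relations, and these
determine the combination as a multiple of ζ(a+b+3): the parity theorem in depth two
(`two_mul_map_indexDeriv_zetaSh`).

The antipode relation in 𝒮₂ is obtained analytically. For ε² = 0, the nested sums over the list 1/1,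
…, 1/(M-1), 1/(ε-(M-1)), …, 1/(ε-1) satisfy it exactly. Truncated multiple zeta values expand
asymptotically as regularized values times elementary symmetric functions of 1/1, …, 1/(M-1)
(`mzvTrunc_asymptotic`). In the two-sided sums these divergent factors combine into the elementary
symmetric functions of ±1/n, which converge into ζ(2)𝒵 in positive degree. So the sums converge in
𝒵[ε], with a limit that reduces to ζ_{𝒮₂}. -/

namespace FMZV

open Finset

/-! ### Deconcatenation convolution of functions of finite sequences. -/

section Conv

variable {α R : Type*} [CommRing R]

/-- The convolution `∑ᵢ f(k₁, …, kᵢ) g(kᵢ₊₁, …, k_r)` of functions of finite sequences. -/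
def conv : (List α → R) → (List α → R) → List α → R
  | f, g, [] => f [] * g []
  | f, g, k :: ks => f [] * g (k :: ks) + conv (fun l => f (k :: l)) g ks

theorem conv_eq_sum (f g : List α → R) (k : List α) :
    conv f g k = ∑ i ∈ range (k.length + 1), f (k.take i) * g (k.drop i) := by
  induction k generalizing f with
  | nil => simp [conv]
  | cons k ks ih =>
    rw [conv, ih, List.length_cons, sum_range_succ' _ (ks.length + 1), add_comm]
    simp only [List.take_succ_cons, List.drop_succ_cons, List.take_zero, List.drop_zero]

theorem conv_add_left (f f' g : List α → R) (k : List α) :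
    conv (fun l => f l + f' l) g k = conv f g k + conv f' g k := by
  simp only [conv_eq_sum, ← sum_add_distrib]
  exact sum_congr rfl fun i _ => by ring

theorem conv_mul_left (c : R) (f g : List α → R) (k : List α) :
    conv (fun l => c * f l) g k = c * conv f g k := by
  simp only [conv_eq_sum, mul_sum]
  exact sum_congr rfl fun i _ => by ring

theorem conv_assoc (f g h : List α → R) (k : List α) :
    conv (conv f g) h k = conv f (conv g h) k := by
  induction k generalizing f with
  | nil => simp [conv, mul_assoc]
  | cons k ks ih =>
    rw [conv, conv, conv]
    simp only [conv, conv_add_left, ih, conv_mul_left]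
    ring

/-- The unit of the convolution. -/
def convOne : List α → R
  | [] => 1
  | _ :: _ => 0

theorem conv_one_left (g : List α → R) (k : List α) : conv convOne g k = g k := by
  cases k with
  | nil => simp [conv, convOne]
  | cons k ks => rw [conv, conv_eq_sum]; simp [convOne]

theorem conv_one_right (f : List α → R) (k : List α) : conv f convOne k = f k := by
  induction k generalizing f with
  | nil => simp [conv, convOne]
  | cons k ks ih => rw [conv, ih]; simp [convOne]

theorem conv_reverse (f g : List α → R) (k : List α) :
    conv f g k.reverse = conv (fun l => g l.reverse) (fun l => f l.reverse) k := by
  rw [conv_eq_sum, conv_eq_sum, ← sum_range_reflect, List.length_reverse]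
  refine sum_congr rfl fun i hi => ?_
  have hi' : i ≤ k.length := by simpa [Nat.lt_succ_iff] using hi
  rw [List.take_reverse, List.drop_reverse, mul_comm]
  rw [show k.length + 1 - 1 - i = k.length - i by omega, Nat.sub_sub_self hi']

theorem conv_congr {f f' g g' : List α → R} (hf : ∀ k, f k = f' k) (hg : ∀ k, g k = g' k)
    (k : List α) : conv f g k = conv f' g' k := by
  rw [funext hf, funext hg]

theorem map_conv {R' : Type*} [CommRing R'] (φ : R →+* R') (f g : List α → R) (k : List α) :
    φ (conv f g k) = conv (fun l => φ (f l)) (fun l => φ (g l)) k := by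
  simp [conv_eq_sum]

/-- Multiplication by a multiplicative character is compatible with the convolution. -/
theorem conv_twist (χ : List α → R) (hχ : ∀ k l, χ (k ++ l) = χ k * χ l)
    (f g : List α → R) (k : List α) :
    conv (fun l => χ l * f l) (fun l => χ l * g l) k = χ k * conv f g k := by
  rw [conv_eq_sum, conv_eq_sum, mul_sum]
  refine sum_congr rfl fun i _ => ?_
  conv_rhs => rw [← List.take_append_drop i k, hχ]
  simp only [List.take_append_drop]
  ring

end Conv

/-! ### Nested sums over finite lists, coarsenings and the antipode relation. -/

section Nested

variable {R : Type*} [CommRing R]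

/-- `∑ y_{n₁}^{k₁} ⋯ y_{n_r}^{k_r}` over `n₁ < ⋯ < n_r`. -/
def nestedSum : List R → Index → R
  | _, [] => 1
  | [], _ :: _ => 0
  | y :: ys, k :: ks => nestedSum ys (k :: ks) + y ^ (k : ℕ) * nestedSum ys ks

/-- `∑ y_{n₁}^{k₁} ⋯ y_{n_r}^{k_r}` over `n₁ ≤ ⋯ ≤ n_r`. -/
def nestedSumStar : List R → Index → R
  | _, [] => 1
  | [], _ :: _ => 0
  | y :: ys, k :: ks => nestedSumStar ys (k :: ks) + y ^ (k : ℕ) * nestedSumStar (y :: ys) ks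
termination_by ys k => ys.length + k.length

@[simp] theorem nestedSum_nil_right (ys : List R) : nestedSum ys [] = 1 := by
  cases ys <;> rfl

@[simp] theorem nestedSumStar_nil_right (ys : List R) : nestedSumStar ys [] = 1 := by
  rw [nestedSumStar]

theorem nestedSum_nil (k : Index) : nestedSum ([] : List R) k = convOne k := by
  cases k <;> rfl

theorem nestedSumStar_nil (k : Index) : nestedSumStar ([] : List R) k = convOne k := by
  cases k <;> simp [nestedSumStar, convOne]

theorem nestedSum_cons (y : R) (ys : List R) (k : ℕ+) (ks : Index) :
    nestedSum (y :: ys) (k :: ks) = nestedSum ys (k :: ks) + y ^ (k : ℕ) * nestedSum ys ks := rfl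

theorem nestedSumStar_cons (y : R) (ys : List R) (k : ℕ+) (ks : Index) :
    nestedSumStar (y :: ys) (k :: ks) =
      nestedSumStar ys (k :: ks) + y ^ (k : ℕ) * nestedSumStar (y :: ys) ks := by
  rw [nestedSumStar]

theorem map_nestedSum {R' : Type*} [CommRing R'] (φ : R →+* R') (ys : List R) (k : Index) :
    φ (nestedSum ys k) = nestedSum (ys.map φ) k := by
  induction ys generalizing k with
  | nil => cases k <;> simp [nestedSum]
  | cons y ys ih => cases k <;> simp [nestedSum, ih]

theorem sum_map_coarsenings_cons (f : Index → R) (k : ℕ+) (ks : Index) :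
    ((coarsenings (k :: ks)).map f).sum =
      ((coarsenings ks).map fun l =>
        match l with
        | [] => f [k]
        | m :: ms => f (k :: m :: ms) + f ((k + m) :: ms)).sum := by
  rw [coarsenings]
  induction coarsenings ks with
  | nil => simp
  | cons l L ih =>
    rw [List.flatMap_cons, List.map_append, List.sum_append, ih, List.map_cons, List.sum_cons]
    cases l <;> simp

/-- Sort the weakly increasing sequences of positions by which neighbours coincide: a coincidence
merges two exponents into their sum, which is a plus sign. -/
theorem nestedSumStar_eq_sum_coarsenings (ys : List R) (k : Index) :
    nestedSumStar ys k = ((coarsenings k).map (nestedSum ys)).sum := by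
  induction k generalizing ys with
  | nil => simp [coarsenings]
  | cons k ks ihk =>
    induction ys with
    | nil =>
      rw [sum_map_coarsenings_cons, nestedSumStar_nil]
      symm
      apply List.sum_eq_zero
      intro x hx
      obtain ⟨l, -, rfl⟩ := List.mem_map.1 hx
      cases l <;> simp [nestedSum]
    | cons y ys ih =>
      rw [nestedSumStar_cons, ih, ihk, sum_map_coarsenings_cons, sum_map_coarsenings_cons,
        ← List.sum_map_mul_left, ← List.sum_map_add]
      congr 2
      funext l
      cases l with
      | nil => simp [nestedSum]
      | cons m ms =>
        simp only [nestedSum, PNat.add_coe]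
        ring

@[simp] theorem wt_nil : wt [] = 0 := rfl

@[simp] theorem wt_cons (k : ℕ+) (ks : Index) : wt (k :: ks) = k + wt ks := rfl

theorem wt_append (k l : Index) : wt (k ++ l) = wt k + wt l := by
  induction k with
  | nil => simp
  | cons k ks ih => simp [ih, add_assoc]

theorem wt_reverse (k : Index) : wt k.reverse = wt k := by
  induction k with
  | nil => rfl
  | cons k ks ih => simp [wt_append, ih, add_comm]

theorem nestedSum_cons_eq_conv (y : R) (ys : List R) (k : Index) :
    nestedSum (y :: ys) k = conv (nestedSum [y]) (nestedSum ys) k := by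
  cases k with
  | nil => simp [conv]
  | cons k ks =>
    rw [nestedSum_cons, conv]
    have h : ∀ l : Index, nestedSum [y] (k :: l) = y ^ (k : ℕ) * convOne l := fun l => by
      rw [nestedSum_cons, nestedSum_nil, nestedSum_nil]; simp [convOne]
    rw [funext h, conv_mul_left, conv_one_left]
    simp

/-- An increasing sequence of positions in a concatenated list is cut at the point where it leaves
the first list. -/
theorem nestedSum_append (ys zs : List R) (k : Index) :
    nestedSum (ys ++ zs) k = conv (nestedSum ys) (nestedSum zs) k := by
  induction ys generalizing k with
  | nil => rw [funext nestedSum_nil, conv_one_left]; rfl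
  | cons y ys ih =>
    rw [List.cons_append, nestedSum_cons_eq_conv, funext (nestedSum_cons_eq_conv y ys),
      conv_assoc, funext ih]

theorem nestedSum_reverse (ys : List R) (k : Index) :
    nestedSum ys.reverse k = nestedSum ys k.reverse := by
  induction ys generalizing k with
  | nil =>
    rw [List.reverse_nil, nestedSum_nil, nestedSum_nil]
    cases k with
    | nil => rfl
    | cons k ks => rw [List.reverse_cons]; cases h : ks.reverse ++ [k] <;> simp_all [convOne]
  | cons y ys ih =>
    rw [List.reverse_cons, nestedSum_append, nestedSum_cons_eq_conv, conv_reverse]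
    refine conv_congr ih (fun l => ?_) k
    rcases l with _ | ⟨a, _ | ⟨b, l⟩⟩
    · rfl
    · rfl
    · have h : ∀ m : Index, 2 ≤ m.length → nestedSum [y] m = 0 := by
        rintro (_ | ⟨a, _ | ⟨b, l⟩⟩) h <;> simp_all [nestedSum]
      rw [h _ (by simp), h _ (by simp)]

/-- In a weakly increasing sequence the first element `y` may be used any number of times; using it
for the initial block `l` contributes `y ^ wt l`. -/
theorem nestedSumStar_cons_eq_conv (y : R) (ys : List R) (k : Index) :
    nestedSumStar (y :: ys) k = conv (fun l => y ^ wt l) (nestedSumStar ys) k := by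
  induction k with
  | nil => simp [conv]
  | cons k ks ih =>
    rw [nestedSumStar_cons, conv, ih]
    have h : (fun l : Index => y ^ wt (k :: l)) = fun l => y ^ (k : ℕ) * y ^ wt l := by
      funext l; simp [pow_add]
    rw [h, conv_mul_left]
    simp

theorem conv_sign_left (f g : Index → R) (k : Index) :
    conv (fun l => (-1) ^ l.length * f l) (fun l => (-1) ^ l.length * g l) k =
      (-1) ^ k.length * conv f g k :=
  conv_twist _ (fun k l => by simp [pow_add]) f g k

theorem conv_nestedSum_singleton (y : R) (k : Index) :
    conv (nestedSum [y]) (fun l => (-1) ^ l.length * y ^ wt l) k = convOne k := by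
  rw [← nestedSum_nil (R := R)]
  cases k with
  | nil => simp [conv]
  | cons k ks =>
    rw [conv]
    have h : ∀ l : Index, nestedSum [y] (k :: l) = y ^ (k : ℕ) * convOne l := fun l => by
      rw [nestedSum_cons, nestedSum_nil, nestedSum_nil]; simp [convOne]
    rw [funext h, conv_mul_left, conv_one_left]
    simp only [nestedSum, List.length_cons, wt_cons, pow_succ, pow_add]
    ring

/-- The antipode relation between the two kinds of nested sums. -/
theorem conv_nestedSum_nestedSumStar (ys : List R) (k : Index) :
    conv (nestedSum ys) (fun l => (-1) ^ l.length * nestedSumStar ys l.reverse) k =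
      convOne k := by
  induction ys generalizing k with
  | nil =>
    cases k with
    | nil => simp [conv, convOne]
    | cons k ks =>
      rw [funext nestedSum_nil, conv_one_left, nestedSumStar_nil]
      simp only [List.reverse_cons, convOne]
      cases h : ks.reverse ++ [k] <;> simp_all
  | cons y ys ih =>
    have h : (fun l : Index => (-1 : R) ^ l.length * nestedSumStar (y :: ys) l.reverse) =
        conv (fun l => (-1) ^ l.length * nestedSumStar ys l.reverse)
          (fun l => (-1) ^ l.length * y ^ wt l) := by
      funext l
      rw [nestedSumStar_cons_eq_conv, conv_reverse, conv_sign_left]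
      simp only [wt_reverse]
    -- The antipode reverses the order of the factors, so the two factors belonging to `ys` become
    -- adjacent and cancel by induction. What is left is the case of a one-element list.
    rw [h, funext (nestedSum_cons_eq_conv y ys), conv_assoc,
      ← funext (conv_assoc (nestedSum ys) _ _), funext ih, funext (conv_one_left _)]
    exact conv_nestedSum_singleton y k

/-! ### Newton's identities -/

theorem nestedSum_cons_replicate_one (y : R) (ys : List R) (i : ℕ) :
    nestedSum (y :: ys) (List.replicate (i + 1) 1) =
      nestedSum ys (List.replicate (i + 1) 1) + y * nestedSum ys (List.replicate i 1) := by
  simp [List.replicate_succ, nestedSum_cons]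

/-- At `{1}^i` the nested sum is the i-th elementary symmetric function. The induction adjoins one
variable at a time. -/
theorem newton_nestedSum (ys : List R) (i : ℕ) :
    (i : R) * nestedSum ys (List.replicate i 1) =
      ∑ j ∈ range i, (-1) ^ j * nestedSum ys (List.replicate (i - 1 - j) 1) *
        (ys.map (· ^ (j + 1))).sum := by
  induction ys generalizing i with
  | nil => cases i <;> simp [List.replicate_succ, nestedSum]
  | cons y ys ih =>
    -- In generating functions: dividing the product of all factors (1 + y_n T) by the factor 1 + yT
    -- removes `y` from the list.
    have key : ∀ i : ℕ, ∑ j ∈ range (i + 1), (-1 : R) ^ j *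
        nestedSum (y :: ys) (List.replicate (i - j) 1) * y ^ (j + 1) =
          y * nestedSum ys (List.replicate i 1) := by
      intro i
      induction i with
      | zero => simp
      | succ i ihi =>
        rw [sum_range_succ']
        simp only [Nat.add_sub_add_right, Nat.sub_zero, pow_zero, one_mul, zero_add, pow_one]
        have : ∑ k ∈ range (i + 1), (-1 : R) ^ (k + 1) *
            nestedSum (y :: ys) (List.replicate (i - k) 1) * y ^ (k + 1 + 1) =
            -y * ∑ k ∈ range (i + 1), (-1 : R) ^ k *
            nestedSum (y :: ys) (List.replicate (i - k) 1) * y ^ (k + 1) := by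
          rw [mul_sum]; exact sum_congr rfl fun j _ => by ring
        rw [this, ihi, nestedSum_cons_replicate_one]
        ring
    cases i with
    | zero => simp
    | succ i =>
      simp only [List.map_cons, List.sum_cons, mul_add, sum_add_distrib, Nat.add_sub_cancel]
      rw [key i, sum_range_succ, Nat.sub_self]
      have h1 : ∀ j ∈ range i, (-1 : R) ^ j * nestedSum (y :: ys) (List.replicate (i - j) 1) *
          (ys.map (· ^ (j + 1))).sum = (-1) ^ j * nestedSum ys (List.replicate (i - j) 1) *
          (ys.map (· ^ (j + 1))).sum + y * ((-1) ^ j *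
          nestedSum ys (List.replicate (i - 1 - j) 1) * (ys.map (· ^ (j + 1))).sum) := by
        intro j hj
        have hj' := mem_range.1 hj
        obtain ⟨m, hm⟩ : ∃ m, i - j = m + 1 := ⟨i - j - 1, by omega⟩
        rw [hm, nestedSum_cons_replicate_one, show i - 1 - j = m by omega]
        ring
      have h2 := ih (i + 1)
      rw [Nat.add_sub_cancel, sum_range_succ, Nat.sub_self] at h2
      rw [sum_congr rfl h1, sum_add_distrib, ← mul_sum, ← ih i, nestedSum_cons_replicate_one]
      push_cast at h2 ⊢
      simp only [nestedSum_nil_right] at h2 ⊢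
      linear_combination h2

end Nested

/-! ### The derivation raising one exponent, and dual numbers. -/

section Deriv

variable {R : Type*} [CommRing R]

/-- `∑ⱼ kⱼ f(k₁, …, kⱼ + 1, …, k_r)`. -/
def indexDeriv : (Index → R) → Index → R
  | _, [] => 0
  | f, k :: ks => (k : ℕ) * f ((k + 1) :: ks) + indexDeriv (fun l => f (k :: l)) ks

theorem indexDeriv_add (f g : Index → R) (k : Index) :
    indexDeriv (fun l => f l + g l) k = indexDeriv f k + indexDeriv g k := by
  induction k generalizing f g with
  | nil => simp [indexDeriv]
  | cons k ks ih => simp only [indexDeriv, ih]; ring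

theorem indexDeriv_mul_left (c : R) (f : Index → R) (k : Index) :
    indexDeriv (fun l => c * f l) k = c * indexDeriv f k := by
  induction k generalizing f with
  | nil => simp [indexDeriv]
  | cons k ks ih => simp only [indexDeriv, ih]; ring

theorem indexDeriv_conv (f g : Index → R) (k : Index) :
    indexDeriv (conv f g) k = conv (indexDeriv f) g k + conv f (indexDeriv g) k := by
  induction k generalizing f with
  | nil => simp [indexDeriv, conv]
  | cons k ks ih =>
    simp only [indexDeriv, conv, indexDeriv_add, indexDeriv_mul_left, ih, conv_add_left,
      conv_mul_left]
    ring

theorem indexDeriv_append (f : Index → R) (k l : Index) :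
    indexDeriv f (k ++ l) =
      indexDeriv (fun m => f (m ++ l)) k + indexDeriv (fun m => f (k ++ m)) l := by
  induction k generalizing f with
  | nil => simp [indexDeriv]
  | cons k ks ih => simp only [indexDeriv, List.cons_append, ih]; ring

theorem indexDeriv_reverse (f : Index → R) (k : Index) :
    indexDeriv f k.reverse = indexDeriv (fun l => f l.reverse) k := by
  induction k generalizing f with
  | nil => simp [indexDeriv]
  | cons k ks ih =>
    rw [List.reverse_cons, indexDeriv_append, ih]
    simp only [indexDeriv, List.reverse_cons]
    ring

theorem map_indexDeriv {R' : Type*} [CommRing R'] (φ : R →+* R') (f : Index → R) (k : Index) :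
    φ (indexDeriv f k) = indexDeriv (fun l => φ (f l)) k := by
  induction k generalizing f with
  | nil => simp [indexDeriv]
  | cons k ks ih => simp [indexDeriv, ih]

open TrivSqZeroExt in
-- For y = 1/n the element y + εy² is 1/(n - ε). Its k-th power is y^k + εk y^(k+1), so the first
-- order term raises one exponent at a time; this is how the coefficient of t appears.
theorem nestedSum_dualNumber (ys : List R) (k : Index) :
    nestedSum (ys.map fun y => (inl y + inr (y ^ 2) : DualNumber R)) k =
      inl (nestedSum ys k) + inr (indexDeriv (nestedSum ys) k) := by
  have hpow : ∀ (y : R) (n : ℕ), (inl y + inr (y ^ 2) : DualNumber R) ^ n =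
      inl (y ^ n) + inr (n * y ^ (n + 1)) := by
    intro y n
    induction n with
    | zero => simp
    | succ n ih =>
      rw [pow_succ, ih]
      ext <;> simp <;> ring
  have hnil : ∀ k : Index, indexDeriv (nestedSum ([] : List R)) k = 0 := by
    have hz : ∀ k : Index, indexDeriv (fun _ => (0 : R)) k = 0 := fun k => by
      induction k with
      | nil => rfl
      | cons k ks ih => simp [indexDeriv, ih]
    intro k
    cases k with
    | nil => rfl
    | cons k ks => simp [indexDeriv, nestedSum, hz]
  induction ys generalizing k with
  | nil => rw [hnil]; cases k <;> simp [nestedSum]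
  | cons y ys ih =>
    cases k with
    | nil => simp [indexDeriv]
    | cons k ks =>
      rw [List.map_cons, nestedSum_cons, ih, ih, hpow]
      have h : indexDeriv (nestedSum (y :: ys)) (k :: ks) =
          indexDeriv (nestedSum ys) (k :: ks) + y ^ (k : ℕ) * indexDeriv (nestedSum ys) ks +
            (k : ℕ) * y ^ ((k : ℕ) + 1) * nestedSum ys ks := by
        simp only [indexDeriv, nestedSum_cons, indexDeriv_add, indexDeriv_mul_left, PNat.add_coe,
          PNat.one_coe]
        ring
      rw [h]
      ext <;> simp [nestedSum_cons]
      ring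

end Deriv

/-! ### The indices `({1}^a, 2, {1}^b)` -/

section OneTwoOne

variable {R : Type*} [CommRing R]

theorem reverse_oneTwoOne (a b : ℕ) : (oneTwoOne a b).reverse = oneTwoOne b a := by
  simp [oneTwoOne]

theorem oneTwoOne_succ (a b : ℕ) : oneTwoOne (a + 1) b = 1 :: oneTwoOne a b := by
  simp [oneTwoOne, List.replicate_succ]

theorem oneTwoOne_zero (b : ℕ) : oneTwoOne 0 b = 2 :: List.replicate b 1 := by
  simp [oneTwoOne]

theorem length_oneTwoOne (a b : ℕ) : (oneTwoOne a b).length = a + b + 1 := by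
  simp [oneTwoOne]; omega

theorem wt_replicate_one (a : ℕ) : wt (List.replicate a 1) = a := by
  induction a with
  | zero => rfl
  | succ a ih => simp [List.replicate_succ, ih, add_comm]

theorem wt_oneTwoOne (a b : ℕ) : wt (oneTwoOne a b) = a + b + 2 := by
  rw [oneTwoOne, wt_append, wt_append, wt_replicate_one, wt_replicate_one]
  simp; omega

theorem conv_replicate {α : Type*} (f g : List α → R) (x : α) (a : ℕ) :
    conv f g (List.replicate a x) =
      ∑ i ∈ range (a + 1), f (List.replicate i x) * g (List.replicate (a - i) x) := by
  rw [conv_eq_sum, List.length_replicate]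
  refine sum_congr rfl fun i hi => ?_
  have := mem_range_succ_iff.1 hi
  rw [List.take_replicate, List.drop_replicate, min_eq_left this]

/-- The first sum collects the cuts to the left of the entry 2, the second those to its right. -/
theorem conv_oneTwoOne (f g : Index → R) (a b : ℕ) :
    conv f g (oneTwoOne a b) =
      ∑ i ∈ range (a + 1), f (List.replicate i 1) * g (oneTwoOne (a - i) b) +
        ∑ i ∈ range (b + 1), f (oneTwoOne a i) * g (List.replicate (b - i) 1) := by
  induction a generalizing f with
  | zero => rw [oneTwoOne_zero, conv, conv_replicate]; simp [oneTwoOne_zero]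
  | succ a ih =>
    rw [oneTwoOne_succ, conv, ih, sum_range_succ' _ (a + 1)]
    simp only [← oneTwoOne_succ, ← List.replicate_succ, List.replicate_zero, Nat.sub_zero,
      Nat.add_sub_add_right]
    ring

/-- The sum over all coarsenings. -/
def coarseSum (f : Index → R) (k : Index) : R := ((coarsenings k).map f).sum

/-! ### Star values from values when x² = 0. -/

section StarRelation

variable {x : R} {f : Index → R}

/-- In the antipode relation at `{1}^(m+1)` every term except the two extreme ones is a product of
two multiples of `x`. -/
theorem coarseSum_replicate_one (hx : x ^ 2 = 0)
    (hf : ∀ k, conv f (fun l => (-1) ^ l.length * coarseSum f l.reverse) k = convOne k)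
    (h1 : ∀ i, x ∣ f (List.replicate (i + 1) 1)) (hnil : f [] = 1) (m : ℕ) :
    coarseSum f (List.replicate (m + 1) 1) = (-1) ^ m * f (List.replicate (m + 1) 1) := by
  have key : ∀ m, coarseSum f (List.replicate (m + 1) 1) =
      (-1) ^ m * f (List.replicate (m + 1) 1) + (-1) ^ m * ∑ i ∈ range m,
        f (List.replicate (i + 1) 1) *
          ((-1) ^ (m - i) * coarseSum f (List.replicate (m - i) 1)) := by
    intro m
    have h := hf (List.replicate (m + 1) 1)
    rw [conv_replicate, sum_range_succ, sum_range_succ', List.replicate_succ (a := (1 : ℕ+)),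
      convOne, ← List.replicate_succ] at h
    simp only [List.replicate_zero, Nat.sub_zero, Nat.add_sub_add_right, List.reverse_replicate,
      List.length_replicate, hnil, Nat.sub_self, List.length_nil, List.reverse_nil, pow_zero] at h
    have h0 : coarseSum f [] = 1 := by simp [coarseSum, coarsenings, hnil]
    rw [h0] at h
    have hs : ((-1 : R) ^ m) * (-1) ^ m = 1 := by rw [← mul_pow]; simp
    have h' := congrArg (fun z => (-1 : R) ^ m * z) h
    simp only [pow_succ] at h'
    linear_combination (-1 : R) * h' - coarseSum f (List.replicate (m + 1) 1) * hs
  have hdvd : ∀ m, x ∣ coarseSum f (List.replicate (m + 1) 1) := by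
    intro m
    rw [key]
    refine dvd_add (Dvd.dvd.mul_left (h1 m) _) (Dvd.dvd.mul_left (dvd_sum fun i _ => ?_) _)
    exact Dvd.dvd.mul_right (h1 i) _
  rw [key, sum_eq_zero, mul_zero, add_zero]
  intro i hi
  obtain ⟨c, hc⟩ := h1 i
  obtain ⟨d, hd⟩ := hdvd (m - i - 1)
  rw [show m - i - 1 + 1 = m - i by have := mem_range.1 hi; omega] at hd
  rw [hc, hd]
  linear_combination c * (-1) ^ (m - i) * d * hx

/-- If the value at `({1}^i)` is divisible by `x` for `i > 0` and vanishes for odd `i`, where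
`x² = 0`, then the star value at `({1}^a, 2, {1}^b)` is the value at `({1}^b, 2, {1}^a)`, as soon
as for even weights all the values of one of the two kinds are divisible by `x`. -/
theorem coarseSum_oneTwoOne (hx : x ^ 2 = 0)
    (hf : ∀ k, conv f (fun l => (-1) ^ l.length * coarseSum f l.reverse) k = convOne k)
    (h1 : ∀ i, x ∣ f (List.replicate (i + 1) 1)) (hnil : f [] = 1)
    (hodd : ∀ i, Odd i → f (List.replicate i 1) = 0)
    (h2 : ∀ a b, Even (a + b) →
      x ∣ f (oneTwoOne a b) ∨ x ∣ coarseSum f (oneTwoOne b a))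
    (a b : ℕ) (hab : Even (a + b)) :
    coarseSum f (oneTwoOne a b) = f (oneTwoOne b a) := by
  have h0 : coarseSum f [] = 1 := by simp [coarseSum, coarsenings, hnil]
  have hstar := coarseSum_replicate_one hx hf h1 hnil
  have key : ∀ a b, Even (a + b) → coarseSum f (oneTwoOne a b) = f (oneTwoOne b a) +
      (∑ i ∈ range b, f (List.replicate (i + 1) 1) *
        ((-1) ^ (b - (i + 1) + a + 1) * coarseSum f (oneTwoOne a (b - (i + 1)))) +
      ∑ i ∈ range a, f (oneTwoOne b i) *
        ((-1) ^ (a - i) * coarseSum f (List.replicate (a - i) 1))) := by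
    intro a b hab
    have h := hf (oneTwoOne b a)
    rw [conv_oneTwoOne, sum_range_succ', sum_range_succ] at h
    have h3 : convOne (oneTwoOne b a) = (0 : R) := by
      cases b with
      | zero => rw [oneTwoOne_zero]; rfl
      | succ b => rw [oneTwoOne_succ]; rfl
    rw [h3] at h
    simp only [length_oneTwoOne, reverse_oneTwoOne, List.reverse_replicate, List.length_replicate,
      List.replicate_zero, Nat.sub_self, hnil, Nat.sub_zero] at h
    have hs : (-1 : R) ^ (b + a + 1) = -1 := Odd.neg_one_pow (by
      rw [add_comm b a]; exact hab.add_one)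
    rw [hs] at h
    simp only [List.reverse_nil, List.length_nil, pow_zero, h0] at h
    linear_combination (-1 : R) * h
  -- Every remaining term of `key` contains a value at a nonempty string of ones, hence a factor
  -- `x`. So divisibility passes from either kind of value to the other.
  have hdvd : ∀ a b, Even (a + b) → x ∣ f (oneTwoOne b a) ∧ x ∣ coarseSum f (oneTwoOne a b) := by
    intro a b hab
    have hrest : x ∣ (∑ i ∈ range b, f (List.replicate (i + 1) 1) *
        ((-1) ^ (b - (i + 1) + a + 1) * coarseSum f (oneTwoOne a (b - (i + 1)))) +
      ∑ i ∈ range a, f (oneTwoOne b i) *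
        ((-1) ^ (a - i) * coarseSum f (List.replicate (a - i) 1))) := by
      refine dvd_add (dvd_sum fun i _ => Dvd.dvd.mul_right (h1 i) _) (dvd_sum fun i hi => ?_)
      obtain ⟨m, hm⟩ : ∃ m, a - i = m + 1 := ⟨a - i - 1, by have := mem_range.1 hi; omega⟩
      rw [hm, hstar]
      exact Dvd.dvd.mul_left (Dvd.dvd.mul_left (Dvd.dvd.mul_left (h1 m) _) _) _
    have h := key a b hab
    rcases h2 b a (by rwa [add_comm]) with h' | h'
    · exact ⟨h', h ▸ dvd_add h' hrest⟩
    · exact ⟨(dvd_add_left hrest).1 (h ▸ h'), h'⟩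
  have hprod : ∀ {y z : R}, x ∣ y → x ∣ z → y * z = 0 := by
    rintro _ _ ⟨c, rfl⟩ ⟨d, rfl⟩
    linear_combination c * d * hx
  rw [key a b hab, sum_eq_zero, sum_eq_zero, add_zero, add_zero]
  · intro i hi
    have hi' := mem_range.1 hi
    obtain ⟨m, hm⟩ : ∃ m, a - i = m + 1 := ⟨a - i - 1, by omega⟩
    -- For an even number of split-off ones the other factor again has even weight, and both factors
    -- are multiples of `x`. For an odd number the factor at the ones is zero.
    rcases Nat.even_or_odd (a - i) with he | ho
    · refine hprod (hdvd i b ?_).1 (Dvd.dvd.mul_left ?_ _)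
      · rw [Nat.even_sub (by omega)] at he
        rw [Nat.even_add] at hab ⊢
        tauto
      · rw [hm, hstar]
        exact Dvd.dvd.mul_left (h1 m) _
    · rw [hm, hstar, ← hm, hodd _ ho]
      simp
  · intro i hi
    have hi' := mem_range.1 hi
    rcases Nat.even_or_odd (i + 1) with he | ho
    · refine hprod (h1 i) (Dvd.dvd.mul_left (hdvd a _ ?_).2 _)
      rw [Nat.even_add, Nat.even_sub (by omega)]
      rw [Nat.even_add] at hab
      tauto
    · rw [hodd _ ho, zero_mul]

end StarRelation

end OneTwoOne

/-! ### Sums over monotone tuples as recursive nested sums. -/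

section FiniteSums

variable {R : Type*} [CommRing R]

theorem strictMono_cons_iff {r : ℕ} (a : ℕ) (ν : Fin r → ℕ) :
    StrictMono (Fin.cons a ν : Fin (r + 1) → ℕ) ↔ (∀ i, a < ν i) ∧ StrictMono ν := by
  simp only [StrictMono, Fin.forall_fin_succ, Fin.cons_zero, Fin.cons_succ, Fin.succ_lt_succ_iff]
  simp

theorem monotone_cons_iff {r : ℕ} (a : ℕ) (ν : Fin r → ℕ) :
    Monotone (Fin.cons a ν : Fin (r + 1) → ℕ) ↔ (∀ i, a ≤ ν i) ∧ Monotone ν := by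
  simp only [Monotone, Fin.forall_fin_succ, Fin.cons_zero, Fin.cons_succ, Fin.succ_le_succ_iff]
  simp

/-- Splits off the sequences with the least possible first term. -/
theorem sum_filter_piFinset_Ico {r a N : ℕ} (P : ∀ {s : ℕ}, (Fin s → ℕ) → Prop)
    [∀ s, DecidablePred (P (s := s))] (b : ℕ) (haN : a < N) (hab : a ≤ b)
    (hP : ∀ (x : ℕ) (ν : Fin r → ℕ), P (Fin.cons x ν : Fin (r + 1) → ℕ) →
      (∀ i, x ≤ ν i) ∧ (x = a → ∀ i, b ≤ ν i) ∧ P ν)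
    (hP' : ∀ ν : Fin r → ℕ, (∀ i, b ≤ ν i) → P ν → P (Fin.cons a ν : Fin (r + 1) → ℕ))
    (g : (Fin (r + 1) → ℕ) → R) :
    ∑ ν ∈ (Fintype.piFinset fun _ : Fin (r + 1) => Ico a N).filter P, g ν =
      ∑ ν ∈ (Fintype.piFinset fun _ : Fin (r + 1) => Ico (a + 1) N).filter P, g ν +
        ∑ ν ∈ (Fintype.piFinset fun _ : Fin r => Ico b N).filter P, g (Fin.cons a ν) := by
  classical
  rw [← sum_filter_not_add_sum_filter _ (fun ν => ν 0 = a)]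
  congr 1
  · refine sum_congr ?_ fun _ _ => rfl
    ext ν
    induction ν using Fin.consCases with
    | cons x ν =>
    simp only [mem_filter, Fintype.mem_piFinset, mem_Ico, Fin.forall_fin_succ, Fin.cons_zero,
      Fin.cons_succ]
    constructor
    · rintro ⟨⟨⟨h1, h2⟩, h3⟩, h4⟩
      have h5 := (hP x ν h3).1
      exact ⟨⟨⟨by omega, h1.2⟩, fun i => ⟨by have := h5 i; omega, (h2 i).2⟩⟩, h3⟩
    · rintro ⟨⟨h1, h2⟩, h3⟩
      exact ⟨⟨⟨⟨by omega, h1.2⟩, fun i => ⟨by have := h2 i; omega, (h2 i).2⟩⟩, h3⟩, by omega⟩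
  · symm
    refine sum_bij (fun ν _ => (Fin.cons a ν : Fin (r + 1) → ℕ)) ?_ ?_ ?_ (fun _ _ => rfl)
    · intro ν hν
      simp only [mem_filter, Fintype.mem_piFinset, mem_Ico, Fin.forall_fin_succ, Fin.cons_zero,
        Fin.cons_succ] at hν ⊢
      refine ⟨⟨⟨⟨le_rfl, haN⟩, fun i => ⟨?_, (hν.1 i).2⟩⟩, hP' ν (fun i => (hν.1 i).1) hν.2⟩, trivial⟩
      exact hab.trans (hν.1 i).1
    · intro ν _ ν' _ h
      exact Fin.cons_right_injective (α := fun _ => ℕ) _ h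
    · intro ν hν
      induction ν using Fin.consCases with
      | cons x ν =>
      simp only [mem_filter, Fintype.mem_piFinset, mem_Ico, Fin.forall_fin_succ, Fin.cons_zero,
        Fin.cons_succ] at hν
      obtain ⟨⟨⟨h1, h2⟩, h3⟩, rfl⟩ := hν
      have h4 := hP x ν h3
      refine ⟨ν, ?_, rfl⟩
      simp only [mem_filter, Fintype.mem_piFinset, mem_Ico]
      exact ⟨fun i => ⟨h4.2.1 rfl i, (h2 i).2⟩, h4.2.2⟩

open Classical in
theorem sum_strictMono_eq_nestedSum (y : ℕ → R) (N : ℕ) (k : Index) (m a : ℕ) (h : a + m = N) :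
    ∑ ν ∈ (Fintype.piFinset fun _ : Fin k.length => Ico a N).filter StrictMono,
      ∏ i, y (ν i) ^ (k.get i : ℕ) = nestedSum ((List.range' a m).map y) k := by
  induction m generalizing a k with
  | zero =>
    cases k with
    | nil =>
      rw [nestedSum_nil_right, filter_true_of_mem fun ν _ i => absurd i.2 (by simp)]
      simp
    | cons k ks =>
      rw [filter_eq_empty_iff.2]
      · simp [nestedSum]
      · intro ν hν
        have h0 := Fintype.mem_piFinset.1 hν ⟨0, by simp⟩
        simp only [mem_Ico] at h0
        omega
  | succ m ih =>
    cases k with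
    | nil =>
      rw [nestedSum_nil_right, filter_true_of_mem fun ν _ i => absurd i.2 (by simp)]
      simp
    | cons k ks =>
      rw [List.range'_succ, List.map_cons, nestedSum_cons, ← ih _ (a + 1) (by omega),
        ← ih _ (a + 1) (by omega), mul_sum]
      refine (sum_filter_piFinset_Ico (r := ks.length) (fun {s} ν => StrictMono ν) (a + 1)
        (by omega) (by omega) ?_ ?_ _).trans ?_
      · intro x ν hν
        rw [strictMono_cons_iff] at hν
        exact ⟨fun i => (hν.1 i).le, fun hx i => by have := hν.1 i; omega, hν.2⟩
      · intro ν h1 h2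
        rw [strictMono_cons_iff]
        exact ⟨h1, h2⟩
      · congr 1
        refine sum_congr rfl fun ν _ => ?_
        exact Fin.prod_univ_succ _

open Classical in
theorem sum_monotone_eq_nestedSumStar (y : ℕ → R) (N : ℕ) (k : Index) (m a : ℕ)
    (h : a + m = N) :
    ∑ ν ∈ (Fintype.piFinset fun _ : Fin k.length => Ico a N).filter Monotone,
      ∏ i, y (ν i) ^ (k.get i : ℕ) = nestedSumStar ((List.range' a m).map y) k := by
  induction m generalizing a k with
  | zero =>
    cases k with
    | nil =>
      rw [nestedSumStar_nil_right, filter_true_of_mem fun ν _ i => absurd i.2 (by simp)]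
      simp
    | cons k ks =>
      rw [filter_eq_empty_iff.2]
      · simp [nestedSumStar]
      · intro ν hν
        have h0 := Fintype.mem_piFinset.1 hν ⟨0, by simp⟩
        simp only [mem_Ico] at h0
        omega
  | succ m ih =>
    induction k with
    | nil =>
      rw [nestedSumStar_nil_right, filter_true_of_mem fun ν _ i => absurd i.2 (by simp)]
      simp
    | cons k ks ihk =>
      rw [List.range'_succ, List.map_cons] at ihk ⊢
      rw [nestedSumStar_cons, ← ih _ (a + 1) (by omega), ← ihk, mul_sum]
      -- Since later terms may again equal `a`, the tails range over the same interval. This is why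
      -- an induction on the index is nested inside the one on the length of the interval.
      refine (sum_filter_piFinset_Ico (r := ks.length) (fun {s} ν => Monotone ν) a
        (by omega) (by omega) ?_ ?_ _).trans ?_
      · intro x ν hν
        rw [monotone_cons_iff] at hν
        exact ⟨hν.1, fun hx i => hx ▸ hν.1 i, hν.2⟩
      · intro ν h1 h2
        rw [monotone_cons_iff]
        exact ⟨h1, h2⟩
      · congr 1
        refine sum_congr rfl fun ν _ => ?_
        exact Fin.prod_univ_succ _

end FiniteSums

/-- The list `y₁, …, y_{N-1}`. -/
def initialList {R : Type*} (y : ℕ → R) (N : ℕ) : List R := (List.range' 1 (N - 1)).map y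

/-! ### Nested sums over initial segments, with recursions in the largest summation variable. -/

section InitialList

variable {R : Type*}

theorem initialList_succ (y : ℕ → R) {N : ℕ} (hN : 1 ≤ N) :
    initialList y (N + 1) = initialList y N ++ [y N] := by
  obtain ⟨n, rfl⟩ : ∃ n, N = n + 1 := ⟨N - 1, by omega⟩
  simp [initialList, List.range'_1_concat, add_comm]

theorem sum_map_initialList {R' : Type*} [AddCommMonoid R'] (φ : R → R') (y : ℕ → R) (N : ℕ) :
    ((initialList y N).map φ).sum = ∑ n ∈ Ico 1 N, φ (y n) := by
  rcases N with _ | N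
  · simp [initialList]
  induction N with
  | zero => simp [initialList]
  | succ N ih =>
    rw [initialList_succ _ (by omega), List.map_append, List.sum_append, ih,
      sum_Ico_succ_top (Nat.le_add_left 1 N)]
    simp

variable [CommRing R]

theorem nestedSum_concat (ys : List R) (y : R) (k : ℕ+) (ks : Index) :
    nestedSum (ys ++ [y]) (ks ++ [k]) =
      nestedSum ys (ks ++ [k]) + nestedSum ys ks * y ^ (k : ℕ) := by
  have h := nestedSum_cons y ys.reverse k ks.reverse
  rw [← List.reverse_concat, ← List.reverse_concat, nestedSum_reverse, nestedSum_reverse,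
    nestedSum_reverse] at h
  simp only [List.reverse_reverse] at h
  rw [h]; ring

theorem nestedSum_initialList_concat (y : ℕ → R) (N : ℕ) (k : ℕ+) (ks : Index) :
    nestedSum (initialList y N) (ks ++ [k]) =
      ∑ n ∈ Ico 1 N, nestedSum (initialList y n) ks * y n ^ (k : ℕ) := by
  have h0 : nestedSum ([] : List R) (ks ++ [k]) = 0 := by
    rw [nestedSum_nil]; cases h : ks ++ [k] <;> simp_all [convOne]
  rcases N with _ | N
  · simpa [initialList] using h0
  induction N with
  | zero => simpa [initialList] using h0
  | succ N ih =>
    rw [initialList_succ _ (by omega), nestedSum_concat, ih, sum_Ico_succ_top (Nat.le_add_left 1 N)]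

theorem nestedSum_initialList_singleton (y : ℕ → R) (N : ℕ) (k : ℕ+) :
    nestedSum (initialList y N) [k] = ∑ n ∈ Ico 1 N, y n ^ (k : ℕ) := by
  simpa using nestedSum_initialList_concat y N k []

theorem nestedSumStar_eq_conv (ys : List R) (y : R) (k : Index) :
    nestedSumStar (ys ++ [y]) k = conv (nestedSumStar ys) (fun l => y ^ wt l) k := by
  induction ys generalizing k with
  | nil =>
    rw [List.nil_append, nestedSumStar_cons_eq_conv, funext nestedSumStar_nil, conv_one_left,
      conv_one_right]
  | cons x ys ih =>
    rw [List.cons_append, nestedSumStar_cons_eq_conv, funext ih, ← conv_assoc,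
      ← funext (nestedSumStar_cons_eq_conv x ys)]

theorem nestedSumStar_concat (ys : List R) (y : R) (k : ℕ+) (ks : Index) :
    nestedSumStar (ys ++ [y]) (ks ++ [k]) =
      nestedSumStar ys (ks ++ [k]) + nestedSumStar (ys ++ [y]) ks * y ^ (k : ℕ) := by
  rw [nestedSumStar_eq_conv, nestedSumStar_eq_conv, conv_eq_sum, conv_eq_sum, List.length_append,
    List.length_singleton, sum_range_succ, add_comm, sum_mul]
  congr 1
  · simp [List.take_of_length_le]
  · refine sum_congr rfl fun i hi => ?_
    have hi' := mem_range_succ_iff.1 hi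
    rw [List.take_append_of_le_length hi', List.drop_append_of_le_length hi', wt_append, pow_add]
    simp [mul_assoc]

theorem nestedSumStar_initialList_concat (y : ℕ → R) (N : ℕ) (k : ℕ+) (ks : Index) :
    nestedSumStar (initialList y N) (ks ++ [k]) =
      ∑ n ∈ Ico 1 N, nestedSumStar (initialList y (n + 1)) ks * y n ^ (k : ℕ) := by
  have h0 : nestedSumStar ([] : List R) (ks ++ [k]) = 0 := by
    rw [nestedSumStar_nil]; cases h : ks ++ [k] <;> simp_all [convOne]
  rcases N with _ | N
  · simpa [initialList] using h0
  induction N with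
  | zero => simpa [initialList] using h0
  | succ N ih =>
    rw [initialList_succ _ (by omega), nestedSumStar_concat, ih, sum_Ico_succ_top (Nat.le_add_left 1 N),
      initialList_succ y (Nat.le_add_left 1 N)]

open Classical in
theorem sum_strictMono_eq_nestedSum_initialList (y : ℕ → R) {N : ℕ} (hN : 1 ≤ N) (k : Index) :
    ∑ ν ∈ (Fintype.piFinset fun _ : Fin k.length => Ioo 0 N).filter StrictMono,
      ∏ i, y (ν i) ^ (k.get i : ℕ) = nestedSum (initialList y N) k := by
  rw [initialList, ← sum_strictMono_eq_nestedSum y N k (N - 1) 1 (by omega)]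
  rfl

open Classical in
theorem sum_monotone_eq_nestedSumStar_initialList (y : ℕ → R) {N : ℕ} (hN : 1 ≤ N) (k : Index) :
    ∑ ν ∈ (Fintype.piFinset fun _ : Fin k.length => Ioo 0 N).filter Monotone,
      ∏ i, y (ν i) ^ (k.get i : ℕ) = nestedSumStar (initialList y N) k := by
  rw [initialList, ← sum_monotone_eq_nestedSumStar y N k (N - 1) 1 (by omega)]
  rfl

end InitialList

/-! ### Harmonic sums modulo `p²`

Here `R` is a commutative ring in which `p² = 0`, and `y n` is an inverse of `n` for `0 < n < p`. -/

section Harmonic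

variable {R : Type*} [CommRing R] {p : ℕ} {y : ℕ → R}

/-- `∑ f(m) g(n)` over `1 ≤ n < m < N`. -/
def doubleSum (f g : ℕ → R) (N : ℕ) : R := ∑ m ∈ Ico 1 N, f m * ∑ n ∈ Ico 1 m, g n

theorem sum_Ico_reflect_self {M : Type*} [AddCommMonoid M] (f : ℕ → M) (p : ℕ) :
    ∑ n ∈ Ico 1 p, f (p - n) = ∑ n ∈ Ico 1 p, f n := by
  refine sum_nbij' (fun n => p - n) (fun n => p - n) ?_ ?_ ?_ ?_ ?_ <;>
    intro n hn <;> simp only [mem_Ico] at hn ⊢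
  all_goals omega

theorem doubleSum_reflect (f g : ℕ → R) (p : ℕ) :
    doubleSum f g p = doubleSum (fun n => g (p - n)) (fun n => f (p - n)) p := by
  simp only [doubleSum, mul_sum]
  rw [sum_sigma', sum_sigma']
  refine sum_nbij' (fun x => ⟨p - x.2, p - x.1⟩) (fun x => ⟨p - x.2, p - x.1⟩) ?_ ?_ ?_ ?_ ?_ <;>
    rintro ⟨m, n⟩ h <;> simp only [mem_sigma, mem_Ico] at h ⊢
  · omega
  · omega
  · simp only [Sigma.mk.injEq, heq_eq_eq]; omega
  · simp only [Sigma.mk.injEq, heq_eq_eq]; omega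
  · rw [show p - (p - m) = m by omega, show p - (p - n) = n by omega, mul_comm]

theorem doubleSum_stuffle (f g : ℕ → R) (N : ℕ) :
    (∑ n ∈ Ico 1 N, f n) * ∑ n ∈ Ico 1 N, g n =
      doubleSum f g N + doubleSum g f N + ∑ n ∈ Ico 1 N, f n * g n := by
  rcases N with _ | N
  · simp [doubleSum]
  induction N with
  | zero => simp [doubleSum]
  | succ N ih =>
    simp only [doubleSum] at ih ⊢
    simp only [sum_Ico_succ_top (Nat.le_add_left 1 N)]
    linear_combination ih

variable (hp : (p : R) ^ 2 = 0) (hy : ∀ n, 1 ≤ n → n < p → (n : R) * y n = 1)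

section
include hy

theorem isUnit_natCast {n : ℕ} (h1 : 1 ≤ n) (h2 : n < p) : IsUnit (n : R) :=
  IsUnit.of_mul_eq_one _ (hy n h1 h2)

theorem eq_inv_of_mul_eq_one {n : ℕ} (h1 : 1 ≤ n) (h2 : n < p) {z : R} (h : (n : R) * z = 1) :
    y n = z :=
  (isUnit_natCast hy h1 h2).mul_left_cancel (by rw [hy n h1 h2, h])

end

theorem one_add_pow_of_sq_zero {x : R} (hx : x ^ 2 = 0) (s : ℕ) : (1 + x) ^ s = 1 + s * x := by
  induction s with
  | zero => simp
  | succ s ih => rw [pow_succ, ih]; push_cast; linear_combination s * hx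

include hp hy

/-- Expand 1/(p - n) = -(1/n)(1 - p/n)⁻¹ to first order in p. -/
theorem inv_reflect {n : ℕ} (h1 : 1 ≤ n) (h2 : n < p) :
    y (p - n) = -y n * (1 + p * y n) := by
  refine eq_inv_of_mul_eq_one hy (by omega) (by omega) ?_
  have h := hy n h1 h2
  rw [Nat.cast_sub h2.le]
  linear_combination (1 + p * y n) * h - y n ^ 2 * hp

theorem inv_pow_reflect {n : ℕ} (h1 : 1 ≤ n) (h2 : n < p) (s : ℕ) :
    y (p - n) ^ s = (-1) ^ s * y n ^ s * (1 + s * (p * y n)) := by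
  rw [inv_reflect hp hy h1 h2, mul_pow, one_add_pow_of_sq_zero, neg_pow]
  linear_combination y n ^ 2 * hp

theorem p_mul_inv_pow_reflect {n : ℕ} (h1 : 1 ≤ n) (h2 : n < p) (s : ℕ) :
    (p : R) * y (p - n) ^ s = p * ((-1) ^ s * y n ^ s) := by
  rw [inv_pow_reflect hp hy h1 h2]
  linear_combination ((-1) ^ s * y n ^ s * s * y n) * hp

/-- Under n ↦ p - n the leading term changes sign because `s` is odd, and only the first order
correction is left. -/
theorem two_mul_sum_inv_pow_odd {s : ℕ} (hs : Odd s) :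
    2 * ∑ n ∈ Ico 1 p, y n ^ s = -(s * (p * ∑ n ∈ Ico 1 p, y n ^ (s + 1))) := by
  have h : ∑ n ∈ Ico 1 p, y n ^ s =
      -∑ n ∈ Ico 1 p, y n ^ s - (s * (p * ∑ n ∈ Ico 1 p, y n ^ (s + 1))) := by
    conv_lhs => rw [← sum_Ico_reflect_self]
    rw [mul_sum, mul_sum, ← sum_neg_distrib, ← sum_sub_distrib]
    refine sum_congr rfl fun n hn => ?_
    rw [mem_Ico] at hn
    rw [inv_pow_reflect hp hy hn.1 hn.2, hs.neg_one_pow]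
    ring
  linear_combination h

omit hp in
theorem inv_two_mul {n : ℕ} (h1 : 1 ≤ n) (h2 : 2 * n < p) : 2 * y (2 * n) = y n := by
  have h : ((2 * n : ℕ) : R) * y (2 * n) = 1 := hy _ (by omega) h2
  push_cast at h
  exact (eq_inv_of_mul_eq_one hy h1 (by omega) (by linear_combination h)).symm

omit hp hy in
/-- The residues `2n` and `2n - p` run through `1, …, p - 1`. -/
theorem sum_Ico_two_mul {M : Type*} [AddCommMonoid M] (f : ℕ → M) {p : ℕ} (hodd : Odd p) :
    ∑ n ∈ Ico 1 p, f n =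
      ∑ n ∈ Ico 1 ((p + 1) / 2), f (2 * n) + ∑ n ∈ Ico ((p + 1) / 2) p, f (2 * n - p) := by
  obtain ⟨r, rfl⟩ := hodd
  rw [show (2 * r + 1 + 1) / 2 = r + 1 by omega]
  have h1 : ∀ r : ℕ, ∑ n ∈ Ico 1 (2 * r + 1), f n =
      ∑ n ∈ Ico 1 (r + 1), f (2 * n) + ∑ n ∈ range r, f (2 * n + 1) := by
    intro r
    induction r with
    | zero => simp
    | succ r ih =>
      rw [show 2 * (r + 1) + 1 = 2 * r + 1 + 1 + 1 by ring, sum_Ico_succ_top (by omega),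
        sum_Ico_succ_top (by omega), ih, sum_Ico_succ_top (Nat.le_add_left 1 r), sum_range_succ]
      simp only [mul_add, mul_one]
      ac_rfl
  rw [h1, sum_Ico_eq_sum_range _ (r + 1)]
  congr 1
  refine sum_congr (by congr 1; omega) fun n _ => ?_
  congr 1
  omega

/-- The Kummer-type relation between `∑ n^{-s}` and a sum modulo `p`. -/
theorem two_pow_sub_one_mul_sum_inv_pow (hodd : Odd p) (s : ℕ) :
    2 * ((2 ^ s - 1) * ∑ n ∈ Ico 1 p, y n ^ s) =
      s * (p * ∑ n ∈ Ico ((p + 1) / 2) p, y n ^ (s + 1)) := by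
  have h : 2 * (2 ^ s * ∑ n ∈ Ico 1 p, y n ^ s) = 2 * ∑ n ∈ Ico 1 p, y n ^ s +
      s * (p * ∑ n ∈ Ico ((p + 1) / 2) p, y n ^ (s + 1)) := by
    conv_lhs => rw [sum_Ico_two_mul _ hodd]
    rw [← sum_Ico_consecutive (fun n => y n ^ s)
      (show 1 ≤ (p + 1) / 2 by have := hodd.pos; omega) (show (p + 1) / 2 ≤ p by
        have := hodd.pos; omega)]
    simp only [mul_add, mul_sum]
    rw [add_assoc, ← sum_add_distrib]
    congr 1
    · refine sum_congr rfl fun n hn => ?_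
      rw [mem_Ico] at hn
      rw [← mul_pow, inv_two_mul hy hn.1 (by obtain ⟨r, rfl⟩ := hodd; omega)]
    · refine sum_congr rfl fun n hn => ?_
      rw [mem_Ico] at hn
      obtain ⟨r, hr⟩ := hodd
      have h2 := isUnit_natCast hy (n := 2) (by omega) (by omega)
      have h1 := hy n (by omega) (by omega)
      obtain ⟨i, hi⟩ := h2.exists_right_inv
      have hi' : 2 * i = (1 : R) := by exact_mod_cast hi
      -- Here `i` is the inverse of 2, and this is the expansion of 1/(2n - p) to first order in p.
      have h3 : y (2 * n - p) = i * y n * (1 + p * (i * y n)) := by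
        refine eq_inv_of_mul_eq_one hy (by omega) (by omega) ?_
        rw [Nat.cast_sub (by omega)]
        push_cast
        linear_combination (2 * i + 2 * i ^ 2 * p * y n) * h1 + (1 + p * i * y n) * hi'
          - i ^ 2 * y n ^ 2 * hp
      rw [h3, mul_pow, one_add_pow_of_sq_zero (by linear_combination i ^ 2 * y n ^ 2 * hp),
        mul_pow]
      have hi2 : (2 : R) ^ s * i ^ s = 1 := by rw [← mul_pow, hi', one_pow]
      linear_combination 2 * y n ^ s * (1 + s * (p * (i * y n))) * hi2 +
        y n ^ s * s * p * y n * hi'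
  linear_combination h

/-- The same permutation of the residues as for inverse powers. When the exponents add up to p - 1,
the half-range sums on the right of the two statements agree modulo p by Fermat; this drives the
Kummer congruence `kummer_sum`. -/
theorem two_pow_sub_one_mul_sum_pow (hodd : Odd p) (s : ℕ) :
    2 * ((2 ^ (s + 1) - 1) * ∑ n ∈ Ico 1 p, (n : R) ^ (s + 1)) =
      (s + 1) * 2 ^ (s + 1) * (p * ∑ n ∈ Ico ((p + 1) / 2) p, (n : R) ^ s) := by
  have h : 2 * ∑ n ∈ Ico 1 p, (n : R) ^ (s + 1) = 2 * (2 ^ (s + 1) *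
      ∑ n ∈ Ico 1 p, (n : R) ^ (s + 1)) -
      (s + 1) * 2 ^ (s + 1) * (p * ∑ n ∈ Ico ((p + 1) / 2) p, (n : R) ^ s) := by
    conv_lhs => rw [sum_Ico_two_mul _ hodd]
    rw [← sum_Ico_consecutive (fun n => (n : R) ^ (s + 1))
      (show 1 ≤ (p + 1) / 2 by have := hodd.pos; omega) (show (p + 1) / 2 ≤ p by
        have := hodd.pos; omega)]
    simp only [mul_add, mul_sum]
    rw [add_sub_assoc, ← sum_sub_distrib]
    congr 1
    · refine sum_congr rfl fun n hn => ?_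
      push_cast
      ring
    · refine sum_congr rfl fun n hn => ?_
      rw [mem_Ico] at hn
      obtain ⟨r, hr⟩ := hodd
      have h1 := hy n (by omega) (by omega)
      have h2 := isUnit_natCast hy (n := 2) (by omega) (by omega)
      obtain ⟨i, hi⟩ := h2.exists_right_inv
      have hi' : 2 * i = (1 : R) := by exact_mod_cast hi
      have h3 : ((2 * n - p : ℕ) : R) = (2 * n) * (1 + -(p * (i * y n))) := by
        rw [Nat.cast_sub (by omega)]
        push_cast
        linear_combination (2 * p * i) * h1 + p * hi'
      rw [h3, mul_pow, one_add_pow_of_sq_zero (by linear_combination i ^ 2 * y n ^ 2 * hp)]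
      push_cast
      rw [mul_pow, pow_succ (n : R)]
      linear_combination (-2 * (s + 1) * 2 ^ (s + 1) * (n : R) ^ s * p * i) * h1 -
        (s + 1) * 2 ^ (s + 1) * (n : R) ^ s * p * hi'
  linear_combination -h

/-- For large `p`, the sums `∑ n^{-s}` are divisible by `p`. -/
theorem p_dvd_sum_inv_pow (hodd : Odd p) {s : ℕ} (hs : 0 < s) (hsp : 2 ^ s ≤ p) :
    (p : R) ∣ ∑ n ∈ Ico 1 p, y n ^ s := by
  have h := two_pow_sub_one_mul_sum_inv_pow hp hy hodd s
  have h2 : 2 ≤ 2 ^ s := by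
    calc 2 = 2 ^ 1 := rfl
      _ ≤ 2 ^ s := Nat.pow_le_pow_right (by omega) hs
  have h3 : 2 < p := by
    obtain ⟨r, rfl⟩ := hodd; omega
  have hu1 := isUnit_natCast hy (n := 2) (by omega) h3
  -- The bound `2 ^ s ≤ p` places `2 ^ s - 1` among 1, …, p - 1, so it can be cancelled.
  have hu2 := isUnit_natCast hy (n := 2 ^ s - 1) (by omega) (by omega)
  rw [Nat.cast_sub (by omega)] at hu2
  push_cast at hu1 hu2
  have h4 : (p : R) ∣ 2 * ((2 ^ s - 1) * ∑ n ∈ Ico 1 p, y n ^ s) := by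
    rw [h]; exact Dvd.intro_left _ (by ring : (s * ∑ n ∈ Ico ((p + 1) / 2) p, y n ^ (s + 1)) * (p : R) = _)
  rwa [hu1.dvd_mul_left, hu2.dvd_mul_left] at h4

theorem p_mul_sum_inv_pow (hodd : Odd p) {s : ℕ} (hs : 0 < s) (hsp : 2 ^ s ≤ p) :
    (p : R) * ∑ n ∈ Ico 1 p, y n ^ s = 0 := by
  obtain ⟨c, hc⟩ := p_dvd_sum_inv_pow hp hy hodd hs hsp
  rw [hc]; linear_combination c * hp

/-- By reflection twice the sum is a multiple of p ∑ n^(-s-1), and the latter sum is itself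
divisible by p. -/
theorem sum_inv_pow_odd (hodd : Odd p) {s : ℕ} (hs : Odd s) (hsp : 2 ^ (s + 1) ≤ p) :
    ∑ n ∈ Ico 1 p, y n ^ s = 0 := by
  have h := two_mul_sum_inv_pow_odd hp hy hs
  rw [p_mul_sum_inv_pow hp hy hodd (by omega) hsp, mul_zero, neg_zero] at h
  have h2 : 2 ≤ 2 ^ (s + 1) := by
    calc 2 = 2 ^ 1 := rfl
      _ ≤ 2 ^ (s + 1) := Nat.pow_le_pow_right (by omega) (by omega)
  have hu1 := isUnit_natCast hy (n := 2) (by omega) (by obtain ⟨r, rfl⟩ := hodd; omega)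
  push_cast at hu1
  exact (hu1.mul_right_eq_zero).1 h

/-! ### Elementary symmetric sums -/

omit hp hy in
theorem natCast_mul_nestedSum_one (i : ℕ) :
    (i : R) * nestedSum (initialList y p) (List.replicate i 1) =
      ∑ j ∈ range i, (-1) ^ j * nestedSum (initialList y p) (List.replicate (i - 1 - j) 1) *
        ∑ n ∈ Ico 1 p, y n ^ (j + 1) := by
  rw [newton_nestedSum]
  simp only [sum_map_initialList]

theorem p_dvd_nestedSum_one (hodd : Odd p) {i : ℕ} (hi : 0 < i) (hip : 2 ^ i ≤ p) :
    (p : R) ∣ nestedSum (initialList y p) (List.replicate i 1) := by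
  have hlt : i < p := lt_of_lt_of_le (Nat.lt_two_pow_self) hip
  rw [← (isUnit_natCast hy hi hlt).dvd_mul_left, natCast_mul_nestedSum_one]
  refine dvd_sum fun j hj => Dvd.dvd.mul_left (p_dvd_sum_inv_pow hp hy hodd (by omega) ?_) _
  have := mem_range.1 hj
  exact (Nat.pow_le_pow_right (by omega) (by omega)).trans hip

/-- In Newton's identity the degrees j + 1 and i - 1 - j add up to the odd number i. So one of them
is odd, and the corresponding factor vanishes. -/
theorem nestedSum_one_odd (hodd : Odd p) {i : ℕ} (hi : Odd i) (hip : 2 ^ (i + 1) ≤ p) :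
    nestedSum (initialList y p) (List.replicate i 1) = 0 := by
  induction i using Nat.strong_induction_on with
  | _ i ih =>
  have hlt : i < p := lt_of_lt_of_le (Nat.lt_two_pow_self)
    ((Nat.pow_le_pow_right (by omega) (by omega)).trans hip)
  refine ((isUnit_natCast hy hi.pos hlt).mul_right_eq_zero).1 ?_
  rw [natCast_mul_nestedSum_one]
  refine sum_eq_zero fun j hj => ?_
  have hj' := mem_range.1 hj
  rcases Nat.even_or_odd j with he | ho
  · rw [sum_inv_pow_odd hp hy hodd he.add_one, mul_zero]
    exact (Nat.pow_le_pow_right (by omega) (by omega)).trans hip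
  · rw [ih (i - 1 - j) (by omega), mul_zero, zero_mul]
    · rcases hi with ⟨u, hu⟩; rcases ho with ⟨v, hv⟩; exact ⟨u - v - 1, by omega⟩
    · exact (Nat.pow_le_pow_right (by omega) (by omega)).trans hip

end Harmonic

/-! ### The binomial transform and star sums. -/

section BinomialTransform

variable {R : Type*} [CommRing R] {p : ℕ} {y : ℕ → R}

/-- The binomial transform `∑_{j=1}^N (-1)^{j-1} (N choose j) g(j)`. -/
def binomialTransform (g : ℕ → R) (N : ℕ) : R :=
  ∑ j ∈ range N, (-1) ^ j * (N.choose (j + 1) : R) * g (j + 1)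

variable (hy : ∀ n, 1 ≤ n → n < p → (n : R) * y n = 1)

include hy in
theorem choose_mul_inv {N j : ℕ} (hj : j ≤ N) (hN : N + 1 < p) :
    (N.choose j : R) * y (j + 1) = ((N + 1).choose (j + 1) : R) * y (N + 1) := by
  have h1 := hy (j + 1) (by omega) (by omega)
  have h2 := hy (N + 1) (by omega) (by omega)
  have h3 : ((N + 1 : ℕ) : R) * N.choose j = (N + 1).choose (j + 1) * (j + 1 : ℕ) := by
    rw [← Nat.cast_mul, ← Nat.cast_mul, Nat.add_one_mul_choose_eq]
  linear_combination (y (j + 1) * y (N + 1)) * h3 + (N + 1).choose (j + 1) * y (N + 1) * h1 -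
    N.choose j * y (j + 1) * h2

include hy in
-- By Pascal's rule the increment from N to N + 1 has coefficients C(N, j)/(j + 1) = C(N+1, j+1)/(N
-- + 1). Thus dividing the argument by n appends an entry 1 to a star sum.
theorem binomialTransform_inv_mul (g : ℕ → R) {N : ℕ} (hN : N < p) :
    binomialTransform (fun n => y n * g n) N =
      ∑ n ∈ Ico 1 (N + 1), y n * binomialTransform g n := by
  induction N with
  | zero => simp [binomialTransform]
  | succ N ih =>
    rw [sum_Ico_succ_top (Nat.le_add_left 1 N), ← ih (by omega)]
    have h1 : binomialTransform (fun n => y n * g n) N =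
        ∑ j ∈ range (N + 1), (-1) ^ j * (N.choose (j + 1) : R) * (y (j + 1) * g (j + 1)) := by
      rw [sum_range_succ]; simp [binomialTransform]
    rw [h1]
    simp only [binomialTransform, mul_sum]
    rw [← sum_add_distrib]
    refine sum_congr rfl fun j hj => ?_
    have h2 := choose_mul_inv hy (mem_range_succ_iff.1 hj) hN
    rw [Nat.choose_succ_succ N j] at h2 ⊢
    push_cast at h2 ⊢
    linear_combination (-1) ^ j * g (j + 1) * h2

theorem binomialTransform_one {N : ℕ} (hN : 1 ≤ N) :
    binomialTransform (fun _ => (1 : R)) N = 1 := by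
  have h := Int.alternating_sum_range_choose_of_ne (n := N) (by omega)
  rw [sum_range_succ'] at h
  have h' := congrArg (Int.cast : ℤ → R) h
  push_cast at h'
  simp only [pow_succ, Nat.choose_zero_right] at h'
  simp only [binomialTransform, mul_one]
  have h2 : ∑ x ∈ range N, (-1 : R) ^ x * -1 * (N.choose (x + 1) : R) =
      -∑ x ∈ range N, (-1 : R) ^ x * (N.choose (x + 1) : R) := by
    rw [← sum_neg_distrib]; exact sum_congr rfl fun _ _ => by ring
  rw [h2] at h'
  linear_combination -h'

/-- Summation by parts: the alternating sum of C(N+1, j+1) over j ≥ i is (-1)^i C(N, i). The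
boundary term of the partial version `h` vanishes at M = N + 1. -/
theorem binomialTransform_sum (t : ℕ → R) (N : ℕ) :
    binomialTransform (fun n => ∑ i ∈ range n, t i) (N + 1) =
      ∑ i ∈ range (N + 1), (-1) ^ i * (N.choose i : R) * t i := by
  have h : ∀ M, ∑ j ∈ range M, (-1 : R) ^ j * ((N + 1).choose (j + 1) : R) *
      ∑ i ∈ range (j + 1), t i = ∑ i ∈ range M, (-1) ^ i * (N.choose i : R) * t i -
        (-1) ^ M * (N.choose M) * ∑ i ∈ range M, t i := by
    intro M
    induction M with
    | zero => simp
    | succ M ih =>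
      rw [sum_range_succ, ih, Nat.choose_succ_succ, sum_range_succ t, sum_range_succ]
      push_cast
      ring
  rw [binomialTransform, h]
  simp

include hy in
theorem binomialTransform_pow_eq_nestedSumStar (a : ℕ) {N : ℕ} (hN1 : 1 ≤ N) (hN : N < p) :
    binomialTransform (fun n => y n ^ a) N =
      nestedSumStar (initialList y (N + 1)) (List.replicate a 1) := by
  induction a generalizing N with
  | zero => simpa using binomialTransform_one hN1
  | succ a ih =>
    simp only [pow_succ']
    rw [binomialTransform_inv_mul hy _ hN, List.replicate_succ', nestedSumStar_initialList_concat]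
    refine sum_congr rfl fun n hn => ?_
    rw [mem_Ico] at hn
    rw [ih hn.1 (by omega), PNat.one_coe, pow_one, mul_comm]

include hy in
theorem binomialTransform_eq_nestedSumStar (a b : ℕ) {N : ℕ} (hN : N < p) :
    binomialTransform (fun n => y n ^ (b + 1) * ∑ i ∈ Ico 1 (n + 1), y i ^ (a + 1)) N =
      nestedSumStar (initialList y (N + 1)) (oneTwoOne a b) := by
  induction b generalizing N with
  | zero =>
    simp only [zero_add, pow_one]
    rw [binomialTransform_inv_mul hy _ hN, oneTwoOne, List.replicate_zero, List.append_nil,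
      nestedSumStar_initialList_concat]
    refine sum_congr rfl fun n hn => ?_
    rw [mem_Ico] at hn
    rw [← binomialTransform_pow_eq_nestedSumStar hy a hn.1 (by omega)]
    obtain ⟨m, rfl⟩ : ∃ m, n = m + 1 := ⟨n - 1, by omega⟩
    simp only [sum_Ico_eq_sum_range, Nat.add_sub_cancel]
    rw [binomialTransform_sum, binomialTransform, mul_sum, sum_mul]
    refine sum_congr rfl fun i hi => ?_
    -- Absorbing one factor 1/(i + 1) into the binomial coefficient produces a second factor 1/n,
    -- which is the entry 2 of the index.
    have h := choose_mul_inv hy (mem_range_succ_iff.1 hi) (N := m) (by omega)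
    rw [add_comm 1 i, pow_succ (y (i + 1))]
    simp only [PNat.val_ofNat]
    linear_combination (-1) ^ i * y (m + 1) * y (i + 1) ^ a * h
  | succ b ih =>
    simp only [pow_succ' _ (b + 1), mul_assoc]
    rw [binomialTransform_inv_mul hy _ hN]
    have h : oneTwoOne a (b + 1) = oneTwoOne a b ++ [1] := by
      simp [oneTwoOne, List.replicate_succ']
    rw [h, nestedSumStar_initialList_concat]
    refine sum_congr rfl fun n hn => ?_
    rw [mem_Ico] at hn
    rw [ih (by omega), PNat.one_coe, pow_one, mul_comm]

variable (hp : (p : R) ^ 2 = 0)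

include hy hp in
-- The left side is the product of the factors 1 - p/n for n ≤ j, here multiplied out modulo p².
theorem neg_one_pow_mul_choose_pred {j : ℕ} (hj : j < p) :
    (-1 : R) ^ j * ((p - 1).choose j : R) = 1 - p * ∑ n ∈ Ico 1 (j + 1), y n := by
  induction j with
  | zero => simp
  | succ j ih =>
    have h1 := hy (j + 1) (by omega) hj
    have h2 : ((p - 1).choose (j + 1) : R) * (j + 1 : ℕ) =
        (p - 1).choose j * (p - 1 - j : ℕ) := by
      rw [← Nat.cast_mul, ← Nat.cast_mul, Nat.choose_succ_right_eq]
    rw [show p - 1 - j = p - (j + 1) by omega, Nat.cast_sub hj.le] at h2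
    rw [sum_Ico_succ_top (Nat.le_add_left 1 j)]
    have h3 := ih (by omega)
    rw [pow_succ]
    linear_combination (-(-1) ^ j * y (j + 1)) * h2 +
      (-(-1) ^ j * (p - 1).choose (j + 1) * (-1) + (-1) ^ j * (p - 1).choose j) * h1 * 1
      + (1 - p * y (j + 1)) * h3 + (∑ n ∈ Ico 1 (j + 1), y n) * y (j + 1) * hp

include hy hp in
/-- The star sums for `({1}^a, 2, {1}^b)` in terms of shorter harmonic sums. -/
theorem nestedSumStar_oneTwoOne_eq (hp1 : 1 ≤ p) (a b : ℕ) :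
    nestedSumStar (initialList y p) (oneTwoOne a b) =
      -∑ m ∈ Ico 1 p, (1 - p * ∑ n ∈ Ico 1 (m + 1), y n) *
        (y m ^ (b + 1) * ∑ i ∈ Ico 1 (m + 1), y i ^ (a + 1)) := by
  have h := binomialTransform_eq_nestedSumStar hy a b (N := p - 1) (by omega)
  rw [Nat.sub_add_cancel hp1] at h
  rw [← h, binomialTransform, ← sum_neg_distrib, sum_Ico_eq_sum_range]
  refine sum_congr rfl fun j hj => ?_
  have hj' := mem_range.1 hj
  rw [add_comm 1 j, ← neg_one_pow_mul_choose_pred hy hp (by omega)]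
  ring

end BinomialTransform

/-! ### Reduction of the star sums to double sums modulo p. -/

section StarEvaluation

variable {R : Type*} [CommRing R] {p : ℕ} {y : ℕ → R}
  (hp : (p : R) ^ 2 = 0) (hy : ∀ n, 1 ≤ n → n < p → (n : R) * y n = 1) (hodd : Odd p)

include hp hy in
-- Reflection exchanges the two variables. The signs cancel because the weight is even, and each
-- variable contributes its first order correction.
theorem two_mul_doubleSum {k l : ℕ} (hkl : Even (k + l)) :
    doubleSum (fun n => y n ^ l) (fun n => y n ^ k) p =
      doubleSum (fun n => y n ^ k) (fun n => y n ^ l) p +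
        k * (p * doubleSum (fun n => y n ^ (k + 1)) (fun n => y n ^ l) p) +
        l * (p * doubleSum (fun n => y n ^ k) (fun n => y n ^ (l + 1)) p) := by
  rw [doubleSum_reflect]
  simp only [doubleSum, mul_sum]
  rw [← sum_add_distrib, ← sum_add_distrib]
  refine sum_congr rfl fun m hm => ?_
  rw [← sum_add_distrib, ← sum_add_distrib]
  refine sum_congr rfl fun n hn => ?_
  rw [mem_Ico] at hm hn
  rw [inv_pow_reflect hp hy hm.1 hm.2, inv_pow_reflect hp hy hn.1 (by omega)]
  have hs : (-1 : R) ^ k * (-1) ^ l = 1 := by rw [← pow_add, hkl.neg_one_pow]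
  linear_combination (y m ^ k * y n ^ l * (1 + k * (p * y m)) * (1 + l * (p * y n))) * hs +
    y m ^ k * y n ^ l * k * l * y m * y n * hp

include hp hy hodd in
-- Reflection maps the range to m, …, p - 1. Since the full power sum vanishes modulo p, this tail
-- is minus the sum over n < m.
theorem p_mul_sum_inv_pow_reflect {k m : ℕ} (hk : 0 < k) (hkp : 2 ^ k ≤ p) (hm1 : 1 ≤ m)
    (hm : m < p) :
    (p : R) * ∑ n ∈ Ico 1 (p - m + 1), y n ^ k =
      p * ((-1) ^ (k + 1) * (∑ n ∈ Ico 1 (m + 1), y n ^ k - y m ^ k)) := by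
  have h1 : ∑ n ∈ Ico 1 (p - m + 1), y n ^ k = ∑ n ∈ Ico m p, y (p - n) ^ k := by
    refine sum_nbij' (fun n => p - n) (fun n => p - n) ?_ ?_ ?_ ?_ ?_ <;>
      intro n hn <;> simp only [mem_Ico] at hn ⊢
    · omega
    · omega
    · omega
    · omega
    · rw [show p - (p - n) = n by omega]
  have h2 : (p : R) * ∑ n ∈ Ico m p, y (p - n) ^ k =
      p * ((-1) ^ k * ∑ n ∈ Ico m p, y n ^ k) := by
    simp only [mul_sum]
    refine sum_congr rfl fun n hn => ?_
    rw [mem_Ico] at hn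
    rw [p_mul_inv_pow_reflect hp hy (by omega) hn.2]
  have h3 := p_mul_sum_inv_pow hp hy hodd hk hkp
  rw [← sum_Ico_consecutive _ hm1 hm.le] at h3
  rw [h1, h2, sum_Ico_succ_top hm1, pow_succ]
  linear_combination (-1) ^ k * h3

include hp hy hodd in
/-- The contribution of the correction term, modulo `p`. -/
theorem two_mul_p_mul_tripleSum {k l : ℕ} (hk : 0 < k) (hl : 0 < l) (hkl : Even (k + l))
    (hkp : 2 ^ (k + l + 1) ≤ p) :
    2 * (p * ∑ m ∈ Ico 1 p, (∑ n ∈ Ico 1 (m + 1), y n) *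
        (y m ^ l * ∑ i ∈ Ico 1 (m + 1), y i ^ k)) =
      p * doubleSum (fun n => y n ^ (l + 1)) (fun n => y n ^ k) p +
        p * doubleSum (fun n => y n ^ (k + l)) (fun n => y n ^ 1) p := by
  have hle : ∀ {s}, s ≤ k + l + 1 → 2 ^ s ≤ p := fun h =>
    (Nat.pow_le_pow_right (by omega) h).trans hkp
  -- The substitution m ↦ p - m turns the sum with weak inequalities into minus the one with strict
  -- inequalities. Twice the sum therefore consists of diagonal terms only.
  have h1 : (p : R) * ∑ m ∈ Ico 1 p, (∑ n ∈ Ico 1 (m + 1), y n) *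
        (y m ^ l * ∑ i ∈ Ico 1 (m + 1), y i ^ k) = p * ∑ m ∈ Ico 1 p,
        -((∑ n ∈ Ico 1 (m + 1), y n - y m) * (y m ^ l * (∑ i ∈ Ico 1 (m + 1), y i ^ k -
          y m ^ k))) := by
    conv_lhs => rw [← sum_Ico_reflect_self]
    rw [mul_sum, mul_sum]
    refine sum_congr rfl fun m hm => ?_
    rw [mem_Ico] at hm
    have e1 := p_mul_sum_inv_pow_reflect hp hy hodd one_pos (hle (by omega)) hm.1 hm.2
    have e2 := p_mul_sum_inv_pow_reflect hp hy hodd hk (hle (by omega)) hm.1 hm.2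
    have e3 := p_mul_inv_pow_reflect hp hy hm.1 hm.2 l
    simp only [pow_one] at e1
    have hs : (-1 : R) ^ k * (-1) ^ l = 1 := by rw [← pow_add, hkl.neg_one_pow]
    rw [pow_succ] at e2
    generalize (∑ n ∈ Ico 1 (p - m + 1), y n) = A at *
    generalize (∑ n ∈ Ico 1 (p - m + 1), y n ^ k) = B at *
    generalize (∑ n ∈ Ico 1 (m + 1), y n) = A' at *
    generalize (∑ n ∈ Ico 1 (m + 1), y n ^ k) = B' at *
    linear_combination (y (p - m) ^ l * B) * e1 + ((A' - y m) * y (p - m) ^ l) * e2 +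
      ((A' - y m) * (-(-1) ^ k) * (B' - y m ^ k)) * e3 -
      p * (A' - y m) * (B' - y m ^ k) * y m ^ l * hs
  -- The term in which all three variables coincide vanishes modulo p.
  have h2 := p_mul_sum_inv_pow hp hy hodd (s := k + l + 1) (by omega) hkp
  have h3 : ∀ m ∈ Ico 1 p, -((∑ n ∈ Ico 1 (m + 1), y n - y m) * (y m ^ l *
      (∑ i ∈ Ico 1 (m + 1), y i ^ k - y m ^ k))) =
      -((∑ n ∈ Ico 1 (m + 1), y n) * (y m ^ l * ∑ i ∈ Ico 1 (m + 1), y i ^ k)) +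
      y m ^ (l + 1) * ∑ i ∈ Ico 1 m, y i ^ k + y m ^ (k + l) * ∑ i ∈ Ico 1 m, y i ^ 1 +
      y m ^ (k + l + 1) := by
    intro m hm
    rw [mem_Ico] at hm
    simp only [pow_one]
    rw [sum_Ico_succ_top hm.1, sum_Ico_succ_top hm.1]
    ring
  rw [sum_congr rfl h3] at h1
  simp only [sum_add_distrib, sum_neg_distrib] at h1
  simp only [doubleSum]
  linear_combination h1 + h2

include hp hy hodd in
/-- The star sum in terms of double sums modulo `p`. -/
theorem two_mul_nestedSumStar_oneTwoOne {a b : ℕ} (hab : Even (a + b))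
    (hlarge : 2 ^ (a + b + 3) ≤ p) :
    2 * nestedSumStar (initialList y p) (oneTwoOne a b) =
      -∑ n ∈ Ico 1 p, y n ^ (a + b + 2) -
        (a + 1) * (p * doubleSum (fun n => y n ^ (a + 2)) (fun n => y n ^ (b + 1)) p) -
        (b + 1) * (p * doubleSum (fun n => y n ^ (a + 1)) (fun n => y n ^ (b + 2)) p) +
        p * doubleSum (fun n => y n ^ (b + 2)) (fun n => y n ^ (a + 1)) p +
        p * doubleSum (fun n => y n ^ (a + b + 2)) (fun n => y n ^ 1) p := by
  have hle : ∀ {s}, s ≤ a + b + 3 → 2 ^ s ≤ p := fun h =>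
    (Nat.pow_le_pow_right (by omega) h).trans hlarge
  have hev : Even (a + 1 + (b + 1)) := by
    rw [show a + 1 + (b + 1) = a + b + 2 by ring]; exact hab.add even_two
  have h1 := two_mul_doubleSum hp hy hev
  have h2 := two_mul_p_mul_tripleSum hp hy hodd (k := a + 1) (l := b + 1) (by omega) (by omega)
    hev (hle (by omega))
  have h3 := doubleSum_stuffle (fun n => y n ^ (a + 1)) (fun n => y n ^ (b + 1)) p
  obtain ⟨c, hc⟩ := p_dvd_sum_inv_pow hp hy hodd (s := a + 1) (by omega) (hle (by omega))
  have h4 := p_mul_sum_inv_pow hp hy hodd (s := b + 1) (by omega) (hle (by omega))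
  have h5 : (∑ n ∈ Ico 1 p, y n ^ (a + 1)) * ∑ n ∈ Ico 1 p, y n ^ (b + 1) = 0 := by
    rw [hc]; linear_combination c * h4
  rw [h5] at h3
  simp only [← pow_add] at h3
  rw [show a + 1 + (b + 1) = a + b + 2 by ring] at h2 h3
  have h6 : ∑ m ∈ Ico 1 p, (1 - p * ∑ n ∈ Ico 1 (m + 1), y n) *
        (y m ^ (b + 1) * ∑ i ∈ Ico 1 (m + 1), y i ^ (a + 1)) =
      doubleSum (fun n => y n ^ (b + 1)) (fun n => y n ^ (a + 1)) p +
        ∑ n ∈ Ico 1 p, y n ^ (a + b + 2) - p * ∑ m ∈ Ico 1 p, (∑ n ∈ Ico 1 (m + 1), y n) *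
        (y m ^ (b + 1) * ∑ i ∈ Ico 1 (m + 1), y i ^ (a + 1)) := by
    rw [doubleSum, mul_sum, ← sum_add_distrib, ← sum_sub_distrib]
    refine sum_congr rfl fun m hm => ?_
    rw [mem_Ico] at hm
    rw [sum_Ico_succ_top hm.1 (fun i => y i ^ (a + 1))]
    ring
  rw [nestedSumStar_oneTwoOne_eq hy hp (by have := Nat.one_le_two_pow (n := a + b + 3); omega), h6]
  push_cast at h1 h2 h3 ⊢
  linear_combination (-1 : R) * h1 + h2 + h3

end StarEvaluation

/-! ### Rational numbers with denominator prime to `p`, and Bernoulli numbers -/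

section PIntegral

variable (p : ℕ) [hprime : Fact p.Prime]

/-- The rational numbers with denominator prime to `p`. -/
def pIntegers : Subring ℚ where
  carrier := {q | ¬ p ∣ q.den}
  mul_mem' := by
    intro a b ha hb h
    rcases (hprime.1.dvd_mul).1 (h.trans (Rat.mul_den_dvd a b)) with h | h
    · exact ha h
    · exact hb h
  one_mem' := by simpa using hprime.1.one_lt.ne'
  add_mem' := by
    intro a b ha hb h
    rcases (hprime.1.dvd_mul).1 (h.trans (Rat.add_den_dvd a b)) with h | h
    · exact ha h
    · exact hb h
  zero_mem' := by simpa using hprime.1.one_lt.ne'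
  neg_mem' := by intro a ha; simpa using ha

variable {p}

theorem mem_pIntegers_iff {q : ℚ} : q ∈ pIntegers p ↔ ¬ p ∣ q.den := Iff.rfl

theorem inv_natCast_mem_pIntegers {m : ℕ} (hm : ¬ p ∣ m) : ((m : ℚ))⁻¹ ∈ pIntegers p := by
  rw [mem_pIntegers_iff]
  have h0 : m ≠ 0 := by rintro rfl; simp at hm
  rwa [Rat.inv_natCast_den_of_pos (Nat.pos_of_ne_zero h0)]

theorem pow_div_mem_pIntegers {m e : ℕ} (hm : m ≠ 0) (h : m < p ^ (e + 1)) :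
    (p : ℚ) ^ e / m ∈ pIntegers p := by
  obtain ⟨v, m', hm', rfl⟩ := Nat.exists_eq_pow_mul_and_not_dvd hm p hprime.1.one_lt.ne'
  have hm0 : 0 < m' := Nat.pos_of_ne_zero fun h => by simp [h] at hm'
  have hv : v ≤ e := by
    by_contra hlt
    have : p ^ (e + 1) ≤ p ^ v := Nat.pow_le_pow_right hprime.1.pos (by omega)
    have : p ^ v ≤ p ^ v * m' := Nat.le_mul_of_pos_right _ hm0
    omega
  obtain ⟨d, rfl⟩ := Nat.exists_eq_add_of_le hv
  have hp0 : (p : ℚ) ≠ 0 := by exact_mod_cast hprime.1.ne_zero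
  have : (p : ℚ) ^ (v + d) / ((p ^ v * m' : ℕ) : ℚ) = p ^ d * (m' : ℚ)⁻¹ := by
    push_cast
    rw [pow_add]
    field_simp
  rw [this]
  exact (pIntegers p).mul_mem (pow_mem (natCast_mem _ _) _) (inv_natCast_mem_pIntegers hm')

theorem isUnit_natCast_zmod_pow (n : ℕ) {m : ℕ} (hm : ¬ p ∣ m) : IsUnit (m : ZMod (p ^ n)) := by
  rw [ZMod.isUnit_iff_coprime]
  exact (((Nat.Prime.coprime_iff_not_dvd hprime.1).2 hm).symm).pow_right n

theorem ratMod_mul_den (n : ℕ) {q : ℚ} (hq : q ∈ pIntegers p) :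
    ratMod (p ^ n) q * (q.den : ZMod (p ^ n)) = (q.num : ZMod (p ^ n)) := by
  rw [ratMod, mul_assoc, ZMod.inv_mul_of_unit _ (isUnit_natCast_zmod_pow n hq), mul_one]

theorem ratMod_mul_intCast (n : ℕ) {q : ℚ} (hq : q ∈ pIntegers p) {a b : ℤ}
    (h : q * b = a) : ratMod (p ^ n) q * (b : ZMod (p ^ n)) = a := by
  have h1 : q.num * b = a * q.den := by
    have hd : (q.den : ℚ) ≠ 0 := by exact_mod_cast q.den_nz
    have h2 : (q.num : ℚ) = q * q.den := (Rat.mul_den_eq_num q).symm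
    have h3 : (q.num * b : ℚ) = a * q.den := by rw [h2, ← h]; ring
    exact_mod_cast h3
  have h2 := congrArg (Int.cast : ℤ → ZMod (p ^ n)) h1
  push_cast at h2
  refine (isUnit_natCast_zmod_pow n hq).mul_left_cancel ?_
  linear_combination h2 + b * ratMod_mul_den n hq

theorem ratMod_eq_of_mul_eq (n : ℕ) {q : ℚ} (hq : q ∈ pIntegers p) {a : ℤ} {b : ℕ}
    (hb : ¬ p ∣ b) (h : q * b = a) {x : ZMod (p ^ n)} (hx : x * (b : ZMod (p ^ n)) = a) :
    ratMod (p ^ n) q = x := by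
  refine (isUnit_natCast_zmod_pow n hb).mul_right_cancel ?_
  rw [hx]
  have := ratMod_mul_intCast n hq (a := a) (b := b) (by exact_mod_cast h)
  exact_mod_cast this

variable (p) in
/-- The reduction of `p`-integral rational numbers modulo `p ^ n`. -/
def ratModHom (n : ℕ) : pIntegers p →+* ZMod (p ^ n) where
  toFun q := ratMod (p ^ n) q
  map_one' := by simp [ratMod]
  map_zero' := by simp [ratMod]
  map_mul' := by
    rintro ⟨q, hq⟩ ⟨r, hr⟩
    refine ratMod_eq_of_mul_eq n ((pIntegers p).mul_mem hq hr) (a := q.num * r.num)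
      (b := q.den * r.den) (fun h => ?_) ?_ ?_
    · rcases (hprime.1.dvd_mul).1 h with h | h
      · exact hq h
      · exact hr h
    · push_cast
      rw [← Rat.mul_den_eq_num q, ← Rat.mul_den_eq_num r]; ring
    · push_cast
      rw [← ratMod_mul_den n hq, ← ratMod_mul_den n hr]; ring
  map_add' := by
    rintro ⟨q, hq⟩ ⟨r, hr⟩
    refine ratMod_eq_of_mul_eq n ((pIntegers p).add_mem hq hr)
      (a := q.num * r.den + r.num * q.den) (b := q.den * r.den) (fun h => ?_) ?_ ?_
    · rcases (hprime.1.dvd_mul).1 h with h | h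
      · exact hq h
      · exact hr h
    · push_cast
      rw [← Rat.mul_den_eq_num q, ← Rat.mul_den_eq_num r]; ring
    · push_cast
      rw [← ratMod_mul_den n hq, ← ratMod_mul_den n hr]; ring

theorem ratModHom_apply (n : ℕ) (q : pIntegers p) : ratModHom p n q = ratMod (p ^ n) q := rfl

/-- Faulhaber's formula for the power sums up to `p`. -/
theorem sum_range_pow_eq_sum_div (N M : ℕ) :
    (∑ k ∈ range N, (k : ℚ) ^ M) = ∑ j ∈ range (M + 1),
      (M.choose j : ℚ) * bernoulli (M - j) * ((N : ℚ) ^ (j + 1) / ((j + 1 : ℕ) : ℚ)) := by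
  rw [sum_range_pow, ← sum_range_reflect]
  refine sum_congr rfl fun j hj => ?_
  have hj' := mem_range_succ_iff.1 hj
  rw [show M + 1 - 1 - j = M - j by omega, show M + 1 - (M - j) = j + 1 by omega]
  have h : ((M + 1).choose (M - j) : ℚ) * (j + 1 : ℕ) = (M + 1 : ℕ) * M.choose j := by
    have h1 := Nat.add_one_mul_choose_eq M j
    rw [← Nat.choose_symm_of_eq_add (show M + 1 = (M - j) + (j + 1) by omega)] at h1
    exact_mod_cast h1.symm
  have h1 : ((j + 1 : ℕ) : ℚ) ≠ 0 := by positivity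
  have h2 : ((M : ℚ) + 1) ≠ 0 := by positivity
  rw [mul_div_assoc', div_eq_div_iff h2 h1]
  push_cast at h ⊢
  linear_combination bernoulli (M - j) * (N : ℚ) ^ (j + 1) * h

/-- A weak von Staudt theorem: solve Faulhaber's formula at N = p for p B_M. The other terms contain
some p B_i with i < M and a factor p^(j+1)/(j+2), which is p-integral. -/
theorem p_mul_bernoulli_mem (M : ℕ) : (p : ℚ) * bernoulli M ∈ pIntegers p := by
  induction M using Nat.strong_induction_on with
  | _ M ih =>
  have h := sum_range_pow_eq_sum_div p M
  rw [sum_range_succ'] at h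
  have h2 : (p : ℚ) * bernoulli M = (∑ k ∈ range p, (k : ℚ) ^ M) - ∑ j ∈ range M,
      (M.choose (j + 1) : ℚ) * (p * bernoulli (M - (j + 1))) *
        ((p : ℚ) ^ (j + 1) / ((j + 2 : ℕ) : ℚ)) := by
    rw [h]
    have : ∀ j ∈ range M, (M.choose (j + 1) : ℚ) * bernoulli (M - (j + 1)) *
        ((p : ℚ) ^ (j + 1 + 1) / ((j + 1 + 1 : ℕ) : ℚ)) = (M.choose (j + 1) : ℚ) *
        (p * bernoulli (M - (j + 1))) * ((p : ℚ) ^ (j + 1) / ((j + 2 : ℕ) : ℚ)) :=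
      fun j _ => by rw [pow_succ _ (j + 1)]; ring
    rw [sum_congr rfl this]
    simp
    ring
  rw [h2]
  refine sub_mem (sum_mem fun k _ => pow_mem (natCast_mem _ _) _) (sum_mem fun j hj => ?_)
  refine mul_mem (mul_mem (natCast_mem _ _) (ih _ ?_)) (pow_div_mem_pIntegers (by omega) ?_)
  · have := mem_range.1 hj; omega
  · exact (Nat.lt_pow_self hprime.1.one_lt)

/-- For p ≥ 3 one more power of p can be taken out, since j + 2 < 3^(j+1) makes p^j/(j+2)
p-integral. -/
theorem sum_pow_eq_p_mul_bernoulli_add (hp3 : 3 ≤ p) (M : ℕ) :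
    ∃ q ∈ pIntegers p, (∑ k ∈ range p, (k : ℚ) ^ M) = p * bernoulli M + p * q := by
  refine ⟨∑ j ∈ range M, (M.choose (j + 1) : ℚ) * (p * bernoulli (M - (j + 1))) *
        ((p : ℚ) ^ j / ((j + 2 : ℕ) : ℚ)), sum_mem fun j _ =>
    mul_mem (mul_mem (natCast_mem _ _) (p_mul_bernoulli_mem _))
      (pow_div_mem_pIntegers (by omega) ?_), ?_⟩
  · have h3 : ∀ j : ℕ, j + 2 < 3 ^ (j + 1) := by
      intro j
      induction j with
      | zero => norm_num
      | succ j ih => rw [pow_succ]; omega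
    calc j + 2 < 3 ^ (j + 1) := h3 j
      _ ≤ p ^ (j + 1) := Nat.pow_le_pow_left hp3 _
  · rw [sum_range_pow_eq_sum_div, sum_range_succ', add_comm, mul_sum]
    congr 1
    · simp; ring
    · refine sum_congr rfl fun j _ => ?_
      rw [pow_succ _ (j + 1), pow_succ]; push_cast; ring

theorem p_dvd_sum_pow {M : ℕ} (hM : ¬ (p - 1) ∣ M) : p ∣ ∑ n ∈ Ico 1 p, n ^ M := by
  rw [← ZMod.natCast_eq_zero_iff]
  push_cast
  have hbij : (∑ v ∈ Ico 1 p, (v : ZMod p) ^ M) = ∑ u : (ZMod p)ˣ, (u : ZMod p) ^ M :=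
    Finset.sum_bij'
      (fun v hv ↦ Units.mk0 (v : ZMod p) (mt (ZMod.natCast_eq_zero_iff v p).mp (by
        rw [mem_Ico] at hv
        exact Nat.not_dvd_of_pos_of_lt (by omega) hv.2)))
      (fun u _ ↦ (u : ZMod p).val)
      (fun _ _ ↦ Finset.mem_univ _)
      (fun u _ ↦ by
        rw [mem_Ico]
        exact ⟨Nat.one_le_iff_ne_zero.2 ((ZMod.val_ne_zero _).2 u.ne_zero), ZMod.val_lt _⟩)
      (fun v hv ↦ by simp [ZMod.val_cast_of_lt (Finset.mem_Ico.mp hv).2])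
      (fun u _ ↦ Units.ext (ZMod.natCast_zmod_val _))
      (fun _ _ ↦ rfl)
  rw [hbij, FiniteField.sum_pow_units, ZMod.card, if_neg hM]

theorem sum_range_eq_sum_Ico_pow {K : Type*} [Semiring K] {M : ℕ} (hM : M ≠ 0) (N : ℕ) :
    ∑ k ∈ range N, (k : K) ^ M = ∑ k ∈ Ico 1 N, (k : K) ^ M := by
  rcases N with _ | N
  · simp
  · rw [range_eq_Ico, sum_eq_sum_Ico_succ_bot (Nat.succ_pos N)]; simp [hM]

/-- When p - 1 does not divide M, the power sum is divisible by p, so the preceding expansion can be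
divided by p. -/
theorem bernoulli_mem_pIntegers (hp3 : 3 ≤ p) {M : ℕ} (hM : M = 0 ∨ ¬ (p - 1) ∣ M) :
    bernoulli M ∈ pIntegers p := by
  rcases hM with rfl | hM
  · simp
  obtain ⟨q, hq, h⟩ := sum_pow_eq_p_mul_bernoulli_add hp3 M
  have hM0 : M ≠ 0 := by rintro rfl; simp at hM
  obtain ⟨c, hc⟩ := p_dvd_sum_pow hM
  have hp0 : (p : ℚ) ≠ 0 := by exact_mod_cast hprime.1.ne_zero
  have h1 : bernoulli M = c - q := by
    rw [sum_range_eq_sum_Ico_pow hM0] at h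
    have h2 : (∑ n ∈ Ico 1 p, (n : ℚ) ^ M) = p * c := by exact_mod_cast hc
    rw [h2] at h
    refine mul_left_cancel₀ hp0 ?_
    linear_combination -h
  rw [h1]
  exact sub_mem (natCast_mem _ _) hq

/-- For even M the term with B_{M-1} is harmless: this number is 0, or -1/2 when M = 2. All later
terms allow p² to be taken out once p ≥ 5, because j + 3 < 5^(j+1). -/
theorem sum_pow_eq_p_mul_bernoulli_add_sq (hp5 : 5 ≤ p) {M : ℕ} (hM : Even M) (hM2 : 2 ≤ M) :
    ∃ q ∈ pIntegers p, (∑ k ∈ range p, (k : ℚ) ^ M) = p * bernoulli M + p ^ 2 * q := by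
  obtain ⟨m, rfl⟩ : ∃ m, M = m + 1 := ⟨M - 1, by omega⟩
  have h1 : bernoulli m ∈ pIntegers p := by
    rcases Nat.lt_or_ge 1 m with h | h
    · rw [bernoulli_eq_zero_of_odd _ h]
      · exact zero_mem _
      · rcases Nat.even_or_odd m with h' | h'
        · exact absurd hM (Nat.not_even_iff_odd.2 h'.add_one)
        · exact h'
    · refine bernoulli_mem_pIntegers (by omega) (Or.inr fun hd => ?_)
      have := Nat.le_of_dvd (by omega) hd
      omega
  have h2 : (1 / 2 : ℚ) ∈ pIntegers p := by
    have := inv_natCast_mem_pIntegers (p := p) (m := 2) (fun h => by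
      have := Nat.le_of_dvd (by omega) h; omega)
    simpa using this
  refine ⟨(m + 1 : ℕ) * bernoulli m * (1 / 2) + ∑ j ∈ range m, ((m + 1).choose (j + 2) : ℚ) *
      (p * bernoulli (m + 1 - (j + 2))) * ((p : ℚ) ^ j / ((j + 3 : ℕ) : ℚ)),
    add_mem (mul_mem (mul_mem (natCast_mem _ _) h1) h2) (sum_mem fun j _ =>
    mul_mem (mul_mem (natCast_mem _ _) (p_mul_bernoulli_mem _))
      (pow_div_mem_pIntegers (by omega) ?_)), ?_⟩
  · have h5 : ∀ j : ℕ, j + 3 < 5 ^ (j + 1) := by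
      intro j
      induction j with
      | zero => norm_num
      | succ j ih => rw [pow_succ]; omega
    calc j + 3 < 5 ^ (j + 1) := h5 j
      _ ≤ p ^ (j + 1) := Nat.pow_le_pow_left hp5 _
  · rw [sum_range_pow_eq_sum_div, sum_range_succ', sum_range_succ', mul_add, mul_sum]
    have : ∀ j ∈ range m, ((m + 1).choose (j + 1 + 1) : ℚ) * bernoulli (m + 1 - (j + 1 + 1)) *
        ((p : ℚ) ^ (j + 1 + 1 + 1) / ((j + 1 + 1 + 1 : ℕ) : ℚ)) =
        p ^ 2 * (((m + 1).choose (j + 2) : ℚ) * (p * bernoulli (m + 1 - (j + 2))) *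
          ((p : ℚ) ^ j / ((j + 3 : ℕ) : ℚ))) := fun j _ => by
      rw [pow_succ _ (j + 1 + 1), pow_succ _ (j + 1), pow_succ]; push_cast; ring
    rw [sum_congr rfl this]
    simp
    ring

theorem p_mul_ratMod_bernoulli (hp5 : 5 ≤ p) {M : ℕ} (hM : Even M) (hM2 : 2 ≤ M)
    (hd : ¬ (p - 1) ∣ M) :
    (p : ZMod (p ^ 2)) * ratMod (p ^ 2) (bernoulli M) =
      ∑ n ∈ Ico 1 p, (n : ZMod (p ^ 2)) ^ M := by
  obtain ⟨q, hq, h⟩ := sum_pow_eq_p_mul_bernoulli_add_sq hp5 hM hM2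
  rw [sum_range_eq_sum_Ico_pow (by omega)] at h
  have hB := bernoulli_mem_pIntegers (p := p) (by omega) (Or.inr hd)
  have h2 : (∑ n ∈ Ico 1 p, (n : pIntegers p) ^ M) =
      p * (⟨bernoulli M, hB⟩ : pIntegers p) + p ^ 2 * (⟨q, hq⟩ : pIntegers p) := by
    apply Subtype.ext
    push_cast
    exact h
  have h3 := congrArg (ratModHom p 2) h2
  simp only [map_sum, map_pow, map_natCast, map_add, map_mul] at h3
  have hp2 : (p : ZMod (p ^ 2)) ^ 2 = 0 := by
    rw [← Nat.cast_pow, ZMod.natCast_self]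
  rw [hp2, zero_mul, add_zero] at h3
  rw [h3]
  rfl

/-- All Bernoulli numbers that occur have index below p - 1, hence are p-integral, and the rational
formula can be reduced modulo p². -/
theorem faulhaber_zmod (hp3 : 3 ≤ p) {s : ℕ} (hs : s < p - 1) (m : ℕ) :
    ((s + 1 : ℕ) : ZMod (p ^ 2)) * ∑ n ∈ range m, (n : ZMod (p ^ 2)) ^ s =
      ∑ i ∈ range (s + 1), ratMod (p ^ 2) (bernoulli i) * ((s + 1).choose i : ZMod (p ^ 2)) *
        (m : ZMod (p ^ 2)) ^ (s + 1 - i) := by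
  have hB : ∀ i, i < p - 1 → bernoulli i ∈ pIntegers p := fun i hi =>
    bernoulli_mem_pIntegers hp3 (by
      rcases Nat.eq_zero_or_pos i with h | h
      · exact Or.inl h
      · exact Or.inr fun hd => by have := Nat.le_of_dvd h hd; omega)
  -- The default value 0 is never met, because `s + 1 ≤ p - 1`.
  let B : ℕ → pIntegers p := fun i => if h : i < p - 1 then ⟨bernoulli i, hB i h⟩ else 0
  have hBi : ∀ i < s + 1, (B i : ℚ) = bernoulli i := fun i hi => by
    simp only [B]; rw [dif_pos (by omega)]
  have h2 : ((s + 1 : ℕ) : pIntegers p) * ∑ n ∈ range m, (n : pIntegers p) ^ s =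
      ∑ i ∈ range (s + 1), B i * ((s + 1).choose i : pIntegers p) *
        (m : pIntegers p) ^ (s + 1 - i) := by
    apply Subtype.ext
    push_cast
    rw [sum_range_pow, mul_sum]
    refine sum_congr rfl fun i hi => ?_
    rw [hBi i (mem_range.1 hi)]
    field_simp
  have h3 := congrArg (ratModHom p 2) h2
  simp only [map_sum, map_pow, map_natCast, map_mul] at h3
  rw [h3]
  refine sum_congr rfl fun i hi => ?_
  rw [ratModHom_apply, hBi i (mem_range.1 hi)]

end PIntegral

/-! ### Kummer congruence and double sums in `ZMod (p ^ 2)`. -/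

section ModPSquare

variable {p : ℕ} [hprime : Fact p.Prime]

omit hprime in
theorem natCast_prime_sq : (p : ZMod (p ^ 2)) ^ 2 = 0 := by
  rw [← Nat.cast_pow, ZMod.natCast_self]

theorem natCast_mul_inv_zmod (n : ℕ) (h1 : 1 ≤ n) (h2 : n < p) :
    (n : ZMod (p ^ 2)) * (n : ZMod (p ^ 2))⁻¹ = 1 :=
  ZMod.mul_inv_of_unit _ (isUnit_natCast_zmod_pow 2 (Nat.not_dvd_of_pos_of_lt h1 h2))

theorem p_mul_pow_pred {n : ℕ} (h1 : 1 ≤ n) (h2 : n < p) :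
    (p : ZMod (p ^ 2)) * (n : ZMod (p ^ 2)) ^ (p - 1) = p := by
  have h : (n : ZMod p) ^ (p - 1) = 1 := ZMod.pow_card_sub_one_eq_one (by
    rw [Ne, ZMod.natCast_eq_zero_iff]; exact Nat.not_dvd_of_pos_of_lt h1 h2)
  have h3 : ((n ^ (p - 1) : ℕ) : ZMod p) = ((1 : ℕ) : ZMod p) := by push_cast; exact h
  rw [ZMod.natCast_eq_natCast_iff] at h3
  have h4 : p * n ^ (p - 1) ≡ p * 1 [MOD p * p] := h3.mul_left' p
  rw [← sq, ← ZMod.natCast_eq_natCast_iff] at h4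
  push_cast at h4
  rw [h4, mul_one]

theorem p_mul_inv_pow {n k : ℕ} (h1 : 1 ≤ n) (h2 : n < p) (hk : k ≤ p - 1) :
    (p : ZMod (p ^ 2)) * ((n : ZMod (p ^ 2))⁻¹) ^ k = p * (n : ZMod (p ^ 2)) ^ (p - 1 - k) := by
  have h := p_mul_pow_pred h1 h2
  rw [show p - 1 = p - 1 - k + k by omega, pow_add] at h
  have h3 : (n : ZMod (p ^ 2)) ^ k * ((n : ZMod (p ^ 2))⁻¹) ^ k = 1 := by
    rw [← mul_pow, natCast_mul_inv_zmod n h1 h2, one_pow]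
  linear_combination (-(n : ZMod (p ^ 2))⁻¹ ^ k) * h +
    (p : ZMod (p ^ 2)) * (n : ZMod (p ^ 2)) ^ (p - 1 - k) * h3

theorem p_mul_sum_pow_eq_zero {d : ℕ} (hd : 0 < d) (hd2 : d < p - 1) :
    (p : ZMod (p ^ 2)) * ∑ n ∈ Ico 1 p, (n : ZMod (p ^ 2)) ^ d = 0 := by
  obtain ⟨c, hc⟩ := p_dvd_sum_pow (p := p) (M := d) (fun h => by
    have := Nat.le_of_dvd hd h; omega)
  have h : ∑ n ∈ Ico 1 p, (n : ZMod (p ^ 2)) ^ d = p * c := by exact_mod_cast congrArg _ hc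
  rw [h]
  linear_combination (c : ZMod (p ^ 2)) * natCast_prime_sq (p := p)

theorem sum_pow_eq_sum_inv_pow {w : ℕ} (hw : w ≤ p * (p - 1)) :
    ∑ n ∈ Ico 1 p, (n : ZMod (p ^ 2)) ^ (p * (p - 1) - w) =
      ∑ n ∈ Ico 1 p, ((n : ZMod (p ^ 2))⁻¹) ^ w := by
  refine sum_congr rfl fun n hn => ?_
  rw [mem_Ico] at hn
  have h1 := natCast_mul_inv_zmod n hn.1 hn.2
  have h2 : (n : ZMod (p ^ 2)) ^ (p * (p - 1)) = 1 := by
    have hu := isUnit_natCast_zmod_pow (p := p) 2 (Nat.not_dvd_of_pos_of_lt hn.1 hn.2)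
    have := ZMod.pow_totient hu.unit
    rw [Nat.totient_prime_pow hprime.1 two_pos] at this
    have h3 := congrArg Units.val this
    simpa using h3
  have h3 : (n : ZMod (p ^ 2)) ^ w * ((n : ZMod (p ^ 2))⁻¹) ^ w = 1 := by
    rw [← mul_pow, h1, one_pow]
  rw [show p * (p - 1) = p * (p - 1) - w + w by omega, pow_add] at h2
  linear_combination (-(n : ZMod (p ^ 2)) ^ (p * (p - 1) - w)) * h3 +
    ((n : ZMod (p ^ 2))⁻¹) ^ w * h2

/-- The Kummer congruence between `∑ n^{-w}` and `∑ n^{p-1-w}`. -/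
theorem kummer_sum {w : ℕ} (hw0 : 0 < w) (hlarge : 2 ^ (w + 3) ≤ p) :
    ((w + 1 : ℕ) : ZMod (p ^ 2)) * ∑ n ∈ Ico 1 p, ((n : ZMod (p ^ 2))⁻¹) ^ w =
      w * ∑ n ∈ Ico 1 p, (n : ZMod (p ^ 2)) ^ (p - 1 - w) := by
  have hw2 : w + 3 < p := lt_of_lt_of_le Nat.lt_two_pow_self hlarge
  have hodd : Odd p := hprime.1.odd_of_ne_two (by omega)
  have hp := natCast_prime_sq (p := p)
  have hy := natCast_mul_inv_zmod (p := p)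
  -- Both power sums are tied to half-range sums, and by Fermat `h3` identifies these modulo p.
  -- Eliminating the common half-range sum gives the congruence; the powers of 2 match through
  -- 2^(p-1) ≡ 1.
  have h1 := two_pow_sub_one_mul_sum_inv_pow hp hy hodd w
  have h2 := two_pow_sub_one_mul_sum_pow hp hy hodd (p - 1 - (w + 1))
  rw [show p - 1 - (w + 1) + 1 = p - 1 - w by omega] at h2
  have h3 : (p : ZMod (p ^ 2)) * ∑ n ∈ Ico ((p + 1) / 2) p, (n : ZMod (p ^ 2)) ^ (p - 1 - (w + 1)) =
      p * ∑ n ∈ Ico ((p + 1) / 2) p, ((n : ZMod (p ^ 2))⁻¹) ^ (w + 1) := by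
    rw [mul_sum, mul_sum]
    refine sum_congr rfl fun n hn => ?_
    rw [mem_Ico] at hn
    rw [p_mul_inv_pow (by omega) hn.2 (by omega)]
  rw [h3] at h2
  obtain ⟨c, hc⟩ := p_dvd_sum_pow (p := p) (M := p - 1 - w) (fun h => by
    have := Nat.le_of_dvd (by omega) h; omega)
  have h4 : ∑ n ∈ Ico 1 p, (n : ZMod (p ^ 2)) ^ (p - 1 - w) = p * c := by
    exact_mod_cast congrArg _ hc
  have h5 : (p : ZMod (p ^ 2)) * 2 ^ (p - 1 - w) * 2 ^ w = p := by
    rw [mul_assoc, ← pow_add, show p - 1 - w + w = p - 1 by omega]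
    exact_mod_cast p_mul_pow_pred (p := p) (n := 2) (by omega) (by omega)
  have h6 : ((p - 1 - (w + 1) : ℕ) : ZMod (p ^ 2)) = p - (w + 2 : ℕ) := by
    rw [Nat.sub_sub, Nat.cast_sub (by omega)]; push_cast; ring
  rw [h6] at h2
  have hle : 2 ^ w < p := lt_of_lt_of_le (Nat.pow_lt_pow_right (by omega) (by omega)) hlarge
  have hu : IsUnit ((2 : ZMod (p ^ 2)) * (2 ^ w - 1)) := by
    have h2w : 2 ≤ 2 ^ w := by
      calc 2 = 2 ^ 1 := rfl
        _ ≤ 2 ^ w := Nat.pow_le_pow_right (by omega) hw0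
    have hu1 := isUnit_natCast hy (n := 2) (by omega) (by omega)
    have hu2 := isUnit_natCast hy (n := 2 ^ w - 1) (by omega) (by omega)
    rw [Nat.cast_sub (by omega)] at hu2
    push_cast at hu1 hu2
    exact hu1.mul hu2
  refine hu.mul_left_cancel ?_
  rw [h4] at h2 ⊢
  push_cast at h2 ⊢
  generalize (2 : ZMod (p ^ 2)) ^ (p - 1 - w) = u at *
  generalize ∑ n ∈ Ico ((p + 1) / 2) p, ((n : ZMod (p ^ 2))⁻¹) ^ (w + 1) = T at *
  linear_combination ((w : ZMod (p ^ 2)) + 1) * h1 + (w : ZMod (p ^ 2)) * 2 ^ w * h2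
    - (w : ZMod (p ^ 2)) * (c * 2 + (w + 1) * T) * h5 +
      (w : ZMod (p ^ 2)) * 2 ^ w * u * T * hp

/-- Modulo p this is the formula for the binomial coefficient with upper entry -k. -/
theorem p_mul_choose_sub {k l : ℕ} (hk : 0 < k) (hkl : k + l < p) :
    (p : ZMod (p ^ 2)) * ((p - k).choose l : ZMod (p ^ 2)) =
      p * ((-1) ^ l * ((k + l - 1).choose l : ZMod (p ^ 2))) := by
  induction l with
  | zero => simp
  | succ l ih =>
    have h1 := Nat.choose_succ_right_eq (p - k) l
    have h2 := Nat.add_one_mul_choose_eq (k + l - 1) l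
    rw [show k + l - 1 + 1 = k + l by omega] at h2
    have h1' : ((p - k).choose (l + 1) : ZMod (p ^ 2)) * (l + 1 : ℕ) =
        (p - k).choose l * (p - (k + l : ℕ)) := by
      rw [← Nat.cast_sub (by omega), ← Nat.sub_sub]
      exact_mod_cast congrArg (Nat.cast : ℕ → ZMod (p ^ 2)) h1
    have h2' : ((k + l : ℕ) : ZMod (p ^ 2)) * (k + l - 1).choose l =
        (k + l).choose (l + 1) * (l + 1 : ℕ) := by
      exact_mod_cast congrArg (Nat.cast : ℕ → ZMod (p ^ 2)) h2
    refine (isUnit_natCast natCast_mul_inv_zmod (show 1 ≤ l + 1 by omega)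
      (show l + 1 < p by omega)).mul_left_cancel ?_
    rw [show k + (l + 1) - 1 = k + l by omega, pow_succ (-1 : ZMod (p ^ 2))]
    linear_combination (p : ZMod (p ^ 2)) * h1' + (-((k + l : ℕ) : ZMod (p ^ 2))) * ih (by omega) +
      (-(p : ZMod (p ^ 2)) * (-1) ^ l) * h2' + ((p - k).choose l : ZMod (p ^ 2)) *
        natCast_prime_sq (p := p)

/-- Evaluation of the double sums of odd weight modulo `p`. -/
theorem p_mul_doubleSum {w k l : ℕ} (hw : Even w) (hw0 : 0 < w) (hk : 0 < k) (hl : 0 < l)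
    (hkl : k + l = w + 1) (hlarge : 2 ^ (w + 3) ≤ p) :
    (w : ZMod (p ^ 2)) * (p * doubleSum (fun n => ((n : ZMod (p ^ 2))⁻¹) ^ l)
        (fun n => ((n : ZMod (p ^ 2))⁻¹) ^ k) p) =
      (-1) ^ l * ((w + 1).choose k : ZMod (p ^ 2)) *
        ∑ n ∈ Ico 1 p, ((n : ZMod (p ^ 2))⁻¹) ^ w := by
  have hw2 : w + 3 < p := lt_of_lt_of_le Nat.lt_two_pow_self hlarge
  have hw3 : 2 * (w + 3) ≤ p := by
    refine le_trans ?_ hlarge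
    rw [show w + 3 = (w + 2) + 1 by ring, pow_succ]
    have : w + 2 + 1 ≤ 2 ^ (w + 2) := Nat.lt_two_pow_self
    omega
  have hodd : Odd p := hprime.1.odd_of_ne_two (by omega)
  have hp := natCast_prime_sq (p := p)
  have hy := natCast_mul_inv_zmod (p := p)
  set B := ratMod (p ^ 2) (bernoulli (p - 1 - w)) with hB
  have hpB : (p : ZMod (p ^ 2)) * B = ∑ n ∈ Ico 1 p, (n : ZMod (p ^ 2)) ^ (p - 1 - w) := by
    refine p_mul_ratMod_bernoulli (by omega) ?_ (by omega) (fun h => ?_)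
    · rw [Nat.even_sub (by omega), Nat.even_sub (by omega)]
      simp [Nat.not_even_iff_odd.2 hodd, hw]
    · have := Nat.le_of_dvd (by omega) h; omega
  -- Orthogonality modulo p: the exponent e - l stays strictly between -(p-1) and p-1, so the sum of
  -- m^(e-l) vanishes unless e = l, where it is -1.
  have hmoment : ∀ e, 1 ≤ e → e ≤ p - k → (p : ZMod (p ^ 2)) * ∑ m ∈ Ico 1 p,
      (m : ZMod (p ^ 2)) ^ e * ((m : ZMod (p ^ 2))⁻¹) ^ l = if e = l then -(p : ZMod (p ^ 2)) else 0 := by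
    intro e he1 he2
    split_ifs with hel
    · subst hel
      rw [sum_congr rfl (g := fun _ => (1 : ZMod (p ^ 2))) fun m hm => by
        rw [mem_Ico] at hm
        rw [← mul_pow, natCast_mul_inv_zmod m hm.1 hm.2, one_pow]]
      simp only [sum_const, Nat.card_Ico, nsmul_eq_mul, mul_one]
      rw [Nat.cast_sub (by omega)]
      push_cast
      linear_combination hp
    · rcases Nat.lt_or_gt_of_ne hel with h | h
      · rw [sum_congr rfl (g := fun m : ℕ => ((m : ZMod (p ^ 2))⁻¹) ^ (l - e)) fun m hm => by
          rw [mem_Ico] at hm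
          conv_lhs => rw [show l = e + (l - e) by omega, pow_add, ← mul_assoc, ← mul_pow,
            natCast_mul_inv_zmod m hm.1 hm.2, one_pow, one_mul]]
        exact p_mul_sum_inv_pow hp hy hodd (by omega)
          ((Nat.pow_le_pow_right (by omega) (by omega)).trans hlarge)
      · rw [sum_congr rfl (g := fun m : ℕ => (m : ZMod (p ^ 2)) ^ (e - l)) fun m hm => by
          rw [mem_Ico] at hm
          conv_lhs => rw [show e = (e - l) + l by omega, pow_add, mul_assoc, ← mul_pow,
            natCast_mul_inv_zmod m hm.1 hm.2, one_pow, mul_one]]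
        exact p_mul_sum_pow_eq_zero (by omega) (by omega)
  -- Replace n^(-k) by n^(p-1-k) modulo p and apply Faulhaber's formula to the inner sum. By
  -- `hmoment` only the power m^l survives, and its coefficient contains B_{p-1-w}.
  have hfaul : ((p - k : ℕ) : ZMod (p ^ 2)) * (p * doubleSum (fun n => ((n : ZMod (p ^ 2))⁻¹) ^ l)
        (fun n => ((n : ZMod (p ^ 2))⁻¹) ^ k) p) =
      -(p * (B * ((p - k).choose l : ZMod (p ^ 2)))) := by
    have h1 : (p : ZMod (p ^ 2)) * doubleSum (fun n => ((n : ZMod (p ^ 2))⁻¹) ^ l)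
        (fun n => ((n : ZMod (p ^ 2))⁻¹) ^ k) p = p * ∑ m ∈ Ico 1 p, ((m : ZMod (p ^ 2))⁻¹) ^ l *
          ∑ n ∈ range m, (n : ZMod (p ^ 2)) ^ (p - 1 - k) := by
      rw [doubleSum, mul_sum, mul_sum]
      refine sum_congr rfl fun m hm => ?_
      rw [mem_Ico] at hm
      rw [mul_left_comm, mul_left_comm (p : ZMod (p ^ 2)), sum_range_eq_sum_Ico_pow (by omega)]
      congr 1
      rw [mul_sum, mul_sum]
      refine sum_congr rfl fun n hn => ?_
      rw [mem_Ico] at hn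
      exact p_mul_inv_pow hn.1 (by omega) (by omega)
    have h2 : ((p - k : ℕ) : ZMod (p ^ 2)) * ∑ m ∈ Ico 1 p, ((m : ZMod (p ^ 2))⁻¹) ^ l *
          ∑ n ∈ range m, (n : ZMod (p ^ 2)) ^ (p - 1 - k) =
        ∑ i ∈ range (p - k), ratMod (p ^ 2) (bernoulli i) *
          ((p - k).choose i : ZMod (p ^ 2)) * ∑ m ∈ Ico 1 p,
            (m : ZMod (p ^ 2)) ^ (p - k - i) * ((m : ZMod (p ^ 2))⁻¹) ^ l := by
      simp only [mul_sum]
      rw [sum_comm]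
      refine sum_congr rfl fun m _ => ?_
      have h3 := faulhaber_zmod (p := p) (by omega) (s := p - 1 - k) (by omega) m
      rw [show p - 1 - k + 1 = p - k by omega] at h3
      rw [← mul_sum, ← mul_sum, mul_left_comm, h3, mul_sum]
      exact sum_congr rfl fun i _ => by ring
    rw [h1, mul_left_comm, h2, mul_sum]
    rw [sum_eq_single (p - 1 - w)]
    · have h4 := hmoment l (by omega) (by omega)
      rw [if_pos rfl] at h4
      rw [show p - k - (p - 1 - w) = l by omega, ← hB,
        show p - 1 - w = p - k - l by omega, Nat.choose_symm (by omega)]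
      linear_combination B * ((p - k).choose l : ZMod (p ^ 2)) * h4
    · intro i hi hne
      have hi' := mem_range.1 hi
      have h4 := hmoment (p - k - i) (by omega) (by omega)
      rw [if_neg (by omega)] at h4
      linear_combination ratMod (p ^ 2) (bernoulli i) * ((p - k).choose i : ZMod (p ^ 2)) * h4
    · intro h; exact absurd (mem_range.2 (by omega)) h
  have hch := p_mul_choose_sub (p := p) hk (l := l) (by omega)
  have hkum := kummer_sum (p := p) hw0 hlarge
  rw [← hpB] at hkum
  rw [show k + l - 1 = w by omega] at hch
  have hbin : ((w + 1 : ℕ) : ZMod (p ^ 2)) * w.choose l = (w + 1).choose k * k := by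
    have h1 := Nat.add_one_mul_choose_eq w (k - 1)
    rw [Nat.choose_symm_of_eq_add (show w = (k - 1) + l by omega),
      show k - 1 + 1 = k by omega] at h1
    exact_mod_cast congrArg (Nat.cast : ℕ → ZMod (p ^ 2)) h1
  rw [Nat.cast_sub (by omega)] at hfaul
  refine (isUnit_natCast hy (show 1 ≤ k from hk) (show k < p by omega)).mul_left_cancel ?_
  push_cast at *
  generalize doubleSum (fun n => ((n : ZMod (p ^ 2))⁻¹) ^ l)
    (fun n => ((n : ZMod (p ^ 2))⁻¹) ^ k) p = D at *
  linear_combination (-(w : ZMod (p ^ 2))) * hfaul + (w : ZMod (p ^ 2)) * B * hch +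
    (w : ZMod (p ^ 2)) * D * hp - (-1) ^ l * (w.choose l : ZMod (p ^ 2)) * hkum +
    (-1) ^ l * (∑ n ∈ Ico 1 p, ((n : ZMod (p ^ 2))⁻¹) ^ w) * hbin

/-- The value of `𝔷(w + 1) p` modulo `p²`. -/
theorem natCast_mul_ratMod_bernoulli_div {w : ℕ} (hw : Even w) (hw0 : 0 < w)
    (hlarge : 2 ^ (w + 3) ≤ p) :
    (w : ZMod (p ^ 2)) * (ratMod (p ^ 2) (bernoulli (p * (p - 1) - w) / ((w : ℚ) + p)) *
        (p : ZMod (p ^ 2))) =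
      ∑ n ∈ Ico 1 p, ((n : ZMod (p ^ 2))⁻¹) ^ w := by
  have hw2 : w + 3 < p := lt_of_lt_of_le Nat.lt_two_pow_self hlarge
  have hodd : Odd p := hprime.1.odd_of_ne_two (by omega)
  have hp := natCast_prime_sq (p := p)
  have hbig : p - 1 ≤ p * (p - 1) := Nat.le_mul_of_pos_left _ hprime.1.pos
  have hbig2 : 2 * (p - 1) ≤ p * (p - 1) := Nat.mul_le_mul_right _ (by omega)
  have hnd : ¬ (p - 1) ∣ p * (p - 1) - w := fun h => by
    have h2 := (Nat.dvd_sub_iff_right (by omega) (Dvd.intro_left p rfl)).1 h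
    have := Nat.le_of_dvd hw0 h2
    omega
  rw [← sum_pow_eq_sum_inv_pow (p := p) (w := w) (by omega),
    ← p_mul_ratMod_bernoulli (p := p) (by omega) ?_ (by omega) hnd]
  · have hB := bernoulli_mem_pIntegers (p := p) (by omega) (Or.inr hnd)
    have hwp : ¬ p ∣ w + p := fun h => by
      have := Nat.le_of_dvd hw0 ((Nat.dvd_add_left dvd_rfl).1 h); omega
    have hq : bernoulli (p * (p - 1) - w) / ((w : ℚ) + p) ∈ pIntegers p := by
      rw [div_eq_mul_inv]
      exact_mod_cast mul_mem hB (inv_natCast_mem_pIntegers hwp)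
    have h1 : ((w + p : ℕ) : pIntegers p) * ⟨_, hq⟩ = ⟨_, hB⟩ := by
      apply Subtype.ext
      have : ((w : ℚ) + p) ≠ 0 := by positivity
      push_cast
      field_simp
    have h2 := congrArg (ratModHom p 2) h1
    rw [map_mul, map_natCast, ratModHom_apply, ratModHom_apply] at h2
    push_cast at h2
    rw [← h2]
    -- After multiplication by p, the denominator w + p may be replaced by w.
    linear_combination (-ratMod (p ^ 2) (bernoulli (p * (p - 1) - w) / ((w : ℚ) + p))) * hp
  · rw [Nat.even_sub (by omega)]
    have : Even (p * (p - 1)) := by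
      apply Even.mul_left
      rw [Nat.even_sub (by omega)]
      simp [Nat.not_even_iff_odd.2 hodd]
    simp [this, hw]

/-- Multiply by the unit a + b + 2 and insert the four double sums. Their neighbouring binomial
coefficients satisfy (b+2) C(a+b+3, b+2) = (a+2) C(a+b+3, b+1), which leaves exactly one copy of
C(a+b+3, b+1) = C(a+b+3, a+2). -/
theorem two_mul_nestedSumStar_oneTwoOne_zmod {a b : ℕ} (hab : Even (a + b))
    (hlarge : 2 ^ (a + b + 5) ≤ p) :
    2 * nestedSumStar (initialList (fun n => (n : ZMod (p ^ 2))⁻¹) p) (oneTwoOne a b) =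
      ((1 + (-1) ^ a * ((a + b + 3).choose (a + 2) : ℤ) : ℤ) : ZMod (p ^ 2)) *
        (ratMod (p ^ 2) (bernoulli (p * (p - 1) - (a + b + 2)) / (((a + b + 2 : ℕ) : ℚ) + p)) *
          (p : ZMod (p ^ 2))) := by
  have hw2 : a + b + 5 < p := lt_of_lt_of_le Nat.lt_two_pow_self hlarge
  have hodd : Odd p := hprime.1.odd_of_ne_two (by omega)
  have hp := natCast_prime_sq (p := p)
  have hy := natCast_mul_inv_zmod (p := p)
  have hw : Even (a + b + 2) := hab.add even_two
  have h1 := two_mul_nestedSumStar_oneTwoOne hp hy hodd hab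
    ((Nat.pow_le_pow_right (by omega) (by omega)).trans hlarge)
  have d1 := p_mul_doubleSum (p := p) hw (by omega) (k := b + 1) (l := a + 2) (by omega)
    (by omega) (by ring) hlarge
  have d2 := p_mul_doubleSum (p := p) hw (by omega) (k := b + 2) (l := a + 1) (by omega)
    (by omega) (by ring) hlarge
  have d3 := p_mul_doubleSum (p := p) hw (by omega) (k := a + 1) (l := b + 2) (by omega)
    (by omega) (by ring) hlarge
  have d4 := p_mul_doubleSum (p := p) hw (by omega) (k := 1) (l := a + b + 2) (by omega)
    (by omega) (by ring) hlarge
  have hz := natCast_mul_ratMod_bernoulli_div (p := p) hw (by omega) hlarge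
  refine (isUnit_natCast hy (show 1 ≤ a + b + 2 by omega) (by omega)).mul_left_cancel ?_
  have hsign : (-1 : ZMod (p ^ 2)) ^ b = (-1) ^ a := by
    have h3 : (-1 : ZMod (p ^ 2)) ^ a * (-1) ^ b = 1 := by rw [← pow_add, hab.neg_one_pow]
    have h4 : (-1 : ZMod (p ^ 2)) ^ a * (-1) ^ a = 1 := by rw [← mul_pow]; simp
    linear_combination (-1 : ZMod (p ^ 2)) ^ a * h3 - (-1 : ZMod (p ^ 2)) ^ b * h4
  rw [hw.neg_one_pow, Nat.choose_one_right] at d4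
  rw [pow_succ (-1 : ZMod (p ^ 2)), pow_succ (-1 : ZMod (p ^ 2))] at d1 d3
  rw [pow_succ (-1 : ZMod (p ^ 2))] at d2
  rw [hsign, Nat.choose_symm_of_eq_add (show a + b + 2 + 1 = a + 1 + (b + 2) by ring)] at d3
  have e1 : (a + b + 3).choose (a + 2) = (a + b + 2 + 1).choose (b + 1) :=
    Nat.choose_symm_of_eq_add (by ring)
  have e2 : ((a + b + 2 + 1).choose (b + 2) : ZMod (p ^ 2)) * (b + 2) =
      (a + b + 2 + 1).choose (b + 1) * (a + 2) := by
    have := Nat.choose_succ_right_eq (a + b + 2 + 1) (b + 1)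
    rw [show a + b + 2 + 1 - (b + 1) = a + 2 by omega] at this
    exact_mod_cast congrArg (Nat.cast : ℕ → ZMod (p ^ 2)) this
  rw [mul_left_comm _ ((_ : ℤ) : ZMod (p ^ 2)), hz, h1, e1]
  push_cast at *
  linear_combination (-((a : ZMod (p ^ 2)) + 1)) * d1 - ((b : ZMod (p ^ 2)) + 1) * d2 + d3 + d4 +
    (-1) ^ a * (∑ n ∈ Ico 1 p, ((n : ZMod (p ^ 2))⁻¹) ^ (a + b + 2)) * e2

end ModPSquare

/-! ### The case 𝒜. -/

section CaseA

theorem A.mk_eq_mk {n : ℕ} {f g : ∀ p : Nat.Primes, ZMod ((p : ℕ) ^ n)} (N : ℕ)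
    (h : ∀ p : Nat.Primes, N ≤ (p : ℕ) → f p = g p) : A.mk n f = A.mk n g := by
  rw [A.mk, A.mk, Ideal.Quotient.eq]
  refine (Set.Finite.preimage (Set.injOn_of_injective Subtype.val_injective)
    (Set.finite_Iio N)).subset fun p hp => ?_
  by_contra hlt
  exact hp (sub_eq_zero.2 (h p (not_lt.1 hlt)))

theorem A.dvd_mk {n : ℕ} {f g : ∀ p : Nat.Primes, ZMod ((p : ℕ) ^ n)} (N : ℕ)
    (h : ∀ p : Nat.Primes, N ≤ (p : ℕ) → f p ∣ g p) : A.mk n f ∣ A.mk n g := by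
  classical
  choose c hc using h
  refine ⟨A.mk n fun p => if hp : N ≤ (p : ℕ) then c p hp else 0, ?_⟩
  rw [A.mk, A.mk, A.mk, ← map_mul]
  refine A.mk_eq_mk (n := n) N fun p hp => ?_
  simp only [Pi.mul_apply, dif_pos hp]
  exact hc p hp

/-- The nested sum modulo `pⁿ`. -/
def sumModP (n : ℕ) (k : Index) (p : Nat.Primes) : ZMod ((p : ℕ) ^ n) :=
  nestedSum (initialList (fun m => (m : ZMod ((p : ℕ) ^ n))⁻¹) p) k

theorem zetaA_eq (n : ℕ) (k : Index) : zetaA n k = A.mk n (sumModP n k) := by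
  rw [zetaA]
  congr 1
  funext p
  exact sum_strictMono_eq_nestedSum_initialList (fun m => (m : ZMod ((p : ℕ) ^ n))⁻¹)
    p.2.one_lt.le k

theorem zetaStarA_eq (n : ℕ) (k : Index) : zetaStarA n k =
    A.mk n fun p => nestedSumStar (initialList (fun m => (m : ZMod ((p : ℕ) ^ n))⁻¹) p) k := by
  rw [zetaStarA]
  congr 1
  funext p
  exact sum_monotone_eq_nestedSumStar_initialList (fun m => (m : ZMod ((p : ℕ) ^ n))⁻¹)
    p.2.one_lt.le k

theorem coarseSum_zetaA (n : ℕ) (k : Index) : coarseSum (zetaA n) k = zetaStarA n k := by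
  rw [zetaStarA_eq, coarseSum, funext (zetaA_eq n)]
  have h : ∀ L : List Index, (L.map fun k => A.mk n (sumModP n k)).sum =
      A.mk n fun p => (L.map fun k => sumModP n k p).sum := by
    intro L
    induction L with
    | nil => simp only [List.map_nil, List.sum_nil]; exact (map_zero _).symm
    | cons l L ih =>
      simp only [List.map_cons, List.sum_cons, ih]
      exact (map_add _ _ _).symm
  rw [h]
  congr 1
  funext p
  rw [nestedSumStar_eq_sum_coarsenings]
  rfl

/-- The antipode relation holds for the finite sums at each prime separately, hence in the product
ring and in its quotient. -/
theorem conv_zetaA (n : ℕ) (k : Index) :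
    conv (zetaA n) (fun l => (-1) ^ l.length * coarseSum (zetaA n) l.reverse) k = convOne k := by
  have h1 : (fun l : Index => (-1) ^ l.length * coarseSum (zetaA n) l.reverse) = fun l : Index =>
      Ideal.Quotient.mk (finiteSupportIdeal n) fun p => (-1) ^ l.length *
        nestedSumStar (initialList (fun m => (m : ZMod ((p : ℕ) ^ n))⁻¹) p) l.reverse := by
    funext l
    rw [coarseSum_zetaA, zetaStarA_eq, A.mk]
    rw [show (-1 : A n) ^ l.length = Ideal.Quotient.mk (finiteSupportIdeal n) ((-1) ^ l.length) by
      simp, ← map_mul]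
    rfl
  rw [h1, funext (zetaA_eq n)]
  unfold A.mk
  rw [← map_conv]
  have h2 : (conv (sumModP n) (fun l p => (-1) ^ l.length *
      nestedSumStar (initialList (fun m => (m : ZMod ((p : ℕ) ^ n))⁻¹) p) l.reverse) k :
        ∀ p : Nat.Primes, ZMod ((p : ℕ) ^ n)) = convOne k := by
    funext p
    have h3 := map_conv (Pi.evalRingHom (fun p : Nat.Primes => ZMod ((p : ℕ) ^ n)) p)
      (sumModP n) (fun l p => (-1) ^ l.length *
      nestedSumStar (initialList (fun m => (m : ZMod ((p : ℕ) ^ n))⁻¹) p) l.reverse) k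
    simp only [Pi.evalRingHom_apply] at h3
    rw [h3]
    refine (conv_nestedSum_nestedSumStar _ k).trans ?_
    cases k <;> rfl
  rw [h2]
  cases k
  · exact map_one _
  · exact map_zero _

theorem half_smul_of_two_mul {M : Type*} [Ring M] [Algebra ℚ M] {x y : M} {c : ℤ}
    (h : 2 * x = (c : M) * y) : x = ((1 / 2 : ℚ) * c) • y := by
  rw [mul_smul, Int.cast_smul_eq_zsmul, zsmul_eq_mul, ← h, two_mul, ← two_smul ℚ x, smul_smul]
  norm_num

theorem two_mul_zetaStarA {a b : ℕ} (hab : Even (a + b)) :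
    2 * zetaStarA 2 (oneTwoOne a b) =
      ((1 + (-1) ^ a * ((a + b + 3).choose (a + 2) : ℤ) : ℤ) : A 2) *
        (frakZA 2 ⟨a + b + 3, Nat.succ_pos _⟩ * xA 2) := by
  rw [zetaStarA_eq]
  unfold frakZA xA
  have h1 : (2 : A 2) = A.mk 2 2 := (map_ofNat _ 2).symm
  have h2 : ∀ c : ℤ, (c : A 2) = A.mk 2 c := fun c => (map_intCast _ c).symm
  rw [h1, h2]
  unfold A.mk
  rw [← map_mul, ← map_mul, ← map_mul]
  refine A.mk_eq_mk (n := 2) (2 ^ (a + b + 5)) fun p hp => ?_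
  have : Fact (p : ℕ).Prime := ⟨p.2⟩
  have h := two_mul_nestedSumStar_oneTwoOne_zmod (p := p) hab hp
  simp only [Pi.mul_apply, Pi.ofNat_apply, Pi.intCast_apply]
  rw [h]
  congr 4
  · congr 1
    simp only [PNat.mk_coe, Nat.add_one_sub_one, pow_one]
    omega
  · simp only [PNat.mk_coe]
    push_cast
    ring

theorem xA_sq : xA 2 ^ 2 = 0 := by
  rw [xA]
  unfold A.mk
  rw [← map_pow, ← map_zero (Ideal.Quotient.mk (finiteSupportIdeal 2))]
  refine A.mk_eq_mk (n := 2) 0 fun p _ => ?_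
  simp only [Pi.pow_apply, Pi.zero_apply]
  exact natCast_prime_sq

theorem zetaStarA_oneTwoOne {a b : ℕ} (hab : Even (a + b)) :
    zetaStarA 2 (oneTwoOne a b) =
      ((1 / 2 : ℚ) * (1 + (-1) ^ a * ((a + b + 3).choose (a + 2) : ℚ))) •
        (frakZA 2 ⟨a + b + 3, Nat.succ_pos _⟩ * xA 2) := by
  rw [half_smul_of_two_mul (two_mul_zetaStarA hab)]
  push_cast
  rfl

/-- An instance of `coarseSum_oneTwoOne` with x = x_𝒜. Here it is the star values that are already
known to be divisible by x. -/
theorem zetaStarA_oneTwoOne_eq_zetaA {a b : ℕ} (hab : Even (a + b)) :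
    zetaStarA 2 (oneTwoOne a b) = zetaA 2 (oneTwoOne b a) := by
  rw [← coarseSum_zetaA]
  have hp : ∀ p : Nat.Primes, ((p : ℕ) : ZMod ((p : ℕ) ^ 2)) ^ 2 = 0 := fun p => natCast_prime_sq
  have hy : ∀ p : Nat.Primes, ∀ n : ℕ, 1 ≤ n → n < (p : ℕ) →
      (n : ZMod ((p : ℕ) ^ 2)) * (n : ZMod ((p : ℕ) ^ 2))⁻¹ = 1 := fun p =>
    have : Fact (p : ℕ).Prime := ⟨p.2⟩
    natCast_mul_inv_zmod
  have hodd : ∀ p : Nat.Primes, 3 ≤ (p : ℕ) → Odd (p : ℕ) := fun p h =>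
    p.2.odd_of_ne_two (by omega)
  refine coarseSum_oneTwoOne xA_sq (conv_zetaA 2) (fun i => ?_) ?_ (fun i hi => ?_)
    (fun a b hab => Or.inr ?_) a b hab
  · rw [zetaA_eq, xA]
    refine A.dvd_mk (2 ^ (i + 1) + 3) fun p hpN => ?_
    exact p_dvd_nestedSum_one (hp p) (hy p) (hodd p (le_trans (Nat.le_add_left _ _) hpN)) (by omega)
      (le_trans (Nat.le_add_right _ _) hpN)
  · rw [zetaA_eq, ← map_one (Ideal.Quotient.mk (finiteSupportIdeal 2))]
    refine A.mk_eq_mk (n := 2) 0 fun p _ => ?_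
    simp [sumModP]
  · rw [zetaA_eq, ← map_zero (Ideal.Quotient.mk (finiteSupportIdeal 2))]
    refine A.mk_eq_mk (n := 2) (2 ^ (i + 1) + 3) fun p hpN => ?_
    exact nestedSum_one_odd (hp p) (hy p) (hodd p (le_trans (Nat.le_add_left _ _) hpN)) hi
      (le_trans (Nat.le_add_right _ _) hpN)
  · rw [coarseSum_zetaA, zetaStarA_oneTwoOne (by rwa [add_comm])]
    rw [← smul_mul_assoc]
    exact Dvd.intro_left _ rfl

theorem zetaA_oneTwoOne {a b : ℕ} (hab : Even (a + b)) :
    zetaA 2 (oneTwoOne a b) =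
      ((1 / 2 : ℚ) * (1 + (-1) ^ a * ((a + b + 3).choose (b + 2) : ℚ))) •
        (frakZA 2 ⟨a + b + 3, Nat.succ_pos _⟩ * xA 2) := by
  have hba : Even (b + a) := by rwa [add_comm]
  rw [← zetaStarA_oneTwoOne_eq_zetaA hba, zetaStarA_oneTwoOne hba]
  have hsign : (-1 : ℚ) ^ b = (-1) ^ a := by
    rw [Nat.even_add] at hab
    rcases Nat.even_or_odd a with h | h
    · rw [h.neg_one_pow, (hab.1 h).neg_one_pow]
    · rw [h.neg_one_pow, Odd.neg_one_pow]
      rw [← Nat.not_even_iff_odd] at h ⊢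
      tauto
  simp only [hsign, add_comm b a]

end CaseA

/-! ### The shuffle product -/

noncomputable section

/-- The word `w` as an element of `ℚ⟨e₀, e₁⟩`. -/
abbrev wordPoly (w : Word) : NCPoly := Finsupp.single w 1

/-- Right multiplication by a letter. -/
def appendLetter (x : Letter) : NCPoly →ₗ[ℚ] NCPoly := Finsupp.lmapDomain ℚ ℚ fun w => w ++ [x]

/-- Left multiplication by a letter. -/
def consLetter (x : Letter) : NCPoly →ₗ[ℚ] NCPoly := Finsupp.lmapDomain ℚ ℚ fun w => x :: w

@[simp] theorem appendLetter_single (x : Letter) (w : Word) (c : ℚ) :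
    appendLetter x (Finsupp.single w c) = Finsupp.single (w ++ [x]) c := by
  simp [appendLetter]

@[simp] theorem consLetter_single (x : Letter) (w : Word) (c : ℚ) :
    consLetter x (Finsupp.single w c) = Finsupp.single (x :: w) c := by
  simp [consLetter]

theorem consLetter_appendLetter (x y : Letter) (f : NCPoly) :
    consLetter x (appendLetter y f) = appendLetter y (consLetter x f) := by
  induction f using Finsupp.induction_linear with
  | zero => simp
  | add f g hf hg => simp [hf, hg]
  | single w c => simp

theorem shuffleWord_nil_left (v : Word) : shuffleWord [] v = wordPoly v := by
  rw [shuffleWord]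

theorem shuffleWord_nil_right (u : Word) : shuffleWord u [] = wordPoly u := by
  cases u <;> rw [shuffleWord]

theorem shuffleWord_cons_cons (x y : Letter) (u v : Word) :
    shuffleWord (x :: u) (y :: v) =
      consLetter x (shuffleWord u (y :: v)) + consLetter y (shuffleWord (x :: u) v) := by
  rw [shuffleWord]; rfl

/-- The recursion of the shuffle product with respect to the last letters. -/
theorem shuffleWord_append_append (x y : Letter) (u v : Word) :
    shuffleWord (u ++ [x]) (v ++ [y]) =
      appendLetter x (shuffleWord u (v ++ [y])) + appendLetter y (shuffleWord (u ++ [x]) v) := by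
  induction u generalizing v with
  | nil =>
    induction v with
    | nil =>
      simp only [List.nil_append, shuffleWord_cons_cons, shuffleWord_nil_left,
        shuffleWord_nil_right, consLetter_single, appendLetter_single, List.cons_append]
      rw [add_comm]
    | cons b v ih =>
      simp only [List.nil_append, List.cons_append] at ih ⊢
      rw [shuffleWord_cons_cons, shuffleWord_cons_cons, ih]
      simp only [shuffleWord_nil_left, map_add, consLetter_single, appendLetter_single,
        consLetter_appendLetter, List.cons_append]
      abel
  | cons a u ihu =>
    induction v with
    | nil =>
      have h := ihu []
      simp only [List.nil_append, List.cons_append] at h ⊢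
      rw [shuffleWord_cons_cons, shuffleWord_cons_cons, h]
      simp only [shuffleWord_nil_right, map_add, consLetter_single, appendLetter_single,
        consLetter_appendLetter, List.cons_append]
      abel
    | cons b v ihv =>
      have h := ihu (b :: v)
      simp only [List.cons_append] at ihv h ⊢
      rw [shuffleWord_cons_cons, shuffleWord_cons_cons, shuffleWord_cons_cons, h, ihv]
      simp only [map_add, consLetter_appendLetter]
      abel

/-- The shuffle product as a bilinear map. -/
def shuffleLin : NCPoly →ₗ[ℚ] NCPoly →ₗ[ℚ] NCPoly :=
  Finsupp.linearCombination ℚ fun u => Finsupp.linearCombination ℚ fun v => shuffleWord u v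

theorem shuffle_eq (f g : NCPoly) : shuffle f g = shuffleLin f g := by
  simp only [shuffle, shuffleLin, Finsupp.linearCombination_apply, Finsupp.sum,
    LinearMap.sum_apply, LinearMap.smul_apply, smul_sum, mul_smul]

@[simp] theorem shuffleLin_wordPoly (u v : Word) :
    shuffleLin (wordPoly u) (wordPoly v) = shuffleWord u v := by
  simp [shuffleLin]

/-- The word `e₁ⁱ`. -/
abbrev onesWord (i : ℕ) : Word := List.replicate i Letter.e1

/-- The shuffle product with `e₁ⁱ`. -/
def shuffleOnes (i : ℕ) : NCPoly →ₗ[ℚ] NCPoly := shuffleLin.flip (wordPoly (onesWord i))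

theorem shuffleOnes_apply (i : ℕ) (f : NCPoly) :
    shuffleOnes i f = shuffle f (wordPoly (onesWord i)) := by
  rw [shuffle_eq]; rfl

theorem shuffleOnes_wordPoly (i : ℕ) (u : Word) :
    shuffleOnes i (wordPoly u) = shuffleWord u (onesWord i) := by
  rw [shuffleOnes_apply, shuffle_eq, shuffleLin_wordPoly]

theorem shuffleOnes_zero (f : NCPoly) : shuffleOnes 0 f = f := by
  induction f using Finsupp.induction_linear with
  | zero => simp
  | add f g hf hg => simp [hf, hg]
  | single w c =>
    rw [← mul_one c, ← smul_eq_mul, ← Finsupp.smul_single, map_smul]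
    congr 1
    rw [shuffleOnes_wordPoly]
    exact shuffleWord_nil_right w

theorem shuffleOnes_nil (i : ℕ) : shuffleOnes i (wordPoly []) = wordPoly (onesWord i) := by
  rw [shuffleOnes_wordPoly, shuffleWord_nil_left]

theorem shuffleOnes_appendLetter (i : ℕ) (x : Letter) (f : NCPoly) :
    shuffleOnes (i + 1) (appendLetter x f) =
      appendLetter x (shuffleOnes (i + 1) f) +
        appendLetter Letter.e1 (shuffleOnes i (appendLetter x f)) := by
  induction f using Finsupp.induction_linear with
  | zero => simp
  | add f g hf hg => simp only [map_add, hf, hg]; abel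
  | single w c =>
    rw [← mul_one c, ← smul_eq_mul, ← Finsupp.smul_single]
    simp only [map_smul, ← smul_add]
    congr 1
    rw [appendLetter_single, shuffleOnes_wordPoly, shuffleOnes_wordPoly, shuffleOnes_wordPoly,
      onesWord, List.replicate_succ', shuffleWord_append_append]

theorem exists_append_of_ne_nil {w : Word} (hw : w ≠ []) : ∃ v x, w = v ++ [x] :=
  ⟨w.dropLast, w.getLast hw, (List.dropLast_append_getLast hw).symm⟩

/-- The words e₁ⁱ behave like divided powers of e₁. Induction on the total length, by the recursion
in the last letters and Pascal's rule, avoids associativity of the shuffle product in general. -/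
theorem shuffleOnes_shuffleOnes (i j : ℕ) (f : NCPoly) :
    shuffleOnes i (shuffleOnes j f) = ((i + j).choose i : ℚ) • shuffleOnes (i + j) f := by
  have key : ∀ (n : ℕ) (w : Word) (i j : ℕ), w.length + i + j = n →
      shuffleOnes i (shuffleOnes j (wordPoly w)) =
        ((i + j).choose i : ℚ) • shuffleOnes (i + j) (wordPoly w) := by
    have hnil : ∀ (n i j : ℕ), i + j = n → shuffleOnes i (shuffleOnes j (wordPoly [])) =
        ((i + j).choose i : ℚ) • shuffleOnes (i + j) (wordPoly []) := by
      intro n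
      induction n with
      | zero => rintro i j h; obtain ⟨rfl, rfl⟩ : i = 0 ∧ j = 0 := by omega
                simp [shuffleOnes_zero]
      | succ n ih =>
        intro i j h
        rcases i with _ | i
        · simp [shuffleOnes_zero]
        rcases j with _ | j
        · simp [shuffleOnes_zero]
        have h1 : ∀ m, wordPoly (onesWord (m + 1)) =
            appendLetter Letter.e1 (wordPoly (onesWord m)) := fun m => by
          rw [appendLetter_single, onesWord, List.replicate_succ']
        have e1 := ih (i + 1) j (by omega)
        have e2 := ih i (j + 1) (by omega)
        simp only [shuffleOnes_nil] at e1 e2 ⊢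
        rw [h1, shuffleOnes_appendLetter, ← h1, e1, e2, show i + (j + 1) = i + 1 + j by ring,
          show i + 1 + (j + 1) = i + 1 + j + 1 by ring, h1 (i + 1 + j),
          Nat.choose_succ_succ (i + 1 + j) i]
        simp only [map_smul, ← add_smul]
        push_cast
        rw [add_comm]
    intro n
    induction n with
    | zero =>
      intro w i j h
      obtain ⟨hw, rfl, rfl⟩ : w.length = 0 ∧ i = 0 ∧ j = 0 := by omega
      simp [shuffleOnes_zero]
    | succ n ih =>
      intro w i j h
      rcases i with _ | i
      · simp [shuffleOnes_zero]
      rcases j with _ | j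
      · simp [shuffleOnes_zero]
      by_cases hw : w = []
      · subst hw; exact hnil _ _ _ rfl
      obtain ⟨v, x, rfl⟩ := exists_append_of_ne_nil hw
      rw [List.length_append, List.length_singleton] at h
      have hx : wordPoly (v ++ [x]) = appendLetter x (wordPoly v) := by simp
      have e1 := ih (v ++ [x]) (i + 1) j (by simp; omega)
      have e2 := ih (v ++ [x]) i (j + 1) (by simp; omega)
      rcases n with _ | n
      · omega
      have e3 : shuffleOnes (i + 1) (shuffleOnes (j + 1) (wordPoly v)) =
          ((i + 1 + (j + 1)).choose (i + 1) : ℚ) • shuffleOnes (i + 1 + (j + 1)) (wordPoly v) :=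
        ih v _ _ (by omega)
      rw [hx] at e1 e2 ⊢
      rw [shuffleOnes_appendLetter j, map_add] at e2
      rw [shuffleOnes_appendLetter j, map_add, shuffleOnes_appendLetter i,
        shuffleOnes_appendLetter i, e3, e1]
      have e4 : ∀ A B C D : NCPoly, A + B + (C + D) = A + C + (B + D) := fun A B C D => by abel
      rw [e4, ← map_add, e2, show i + (j + 1) = i + 1 + j by ring,
        show i + 1 + (j + 1) = i + 1 + j + 1 by ring, shuffleOnes_appendLetter (i + 1 + j),
        Nat.choose_succ_succ (i + 1 + j) i]
      simp only [map_smul, smul_add]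
      push_cast
      simp only [add_smul]
      abel
  induction f using Finsupp.induction_linear with
  | zero => simp
  | add f g hf hg => simp [hf, hg]
  | single w c =>
    rw [← mul_one c, ← smul_eq_mul, ← Finsupp.smul_single]
    simp only [map_smul]
    rw [key _ w i j rfl, smul_comm]

theorem shuffleOnes_onesWord (i j : ℕ) : shuffleOnes i (wordPoly (onesWord j)) =
    ((i + j).choose i : ℚ) • wordPoly (onesWord (i + j)) := by
  rw [← shuffleOnes_nil, shuffleOnes_shuffleOnes, shuffleOnes_nil]

theorem e1ShufflePow_eq (i : ℕ) :
    e1ShufflePow i = (i.factorial : ℚ) • wordPoly (onesWord i) := by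
  induction i with
  | zero => simp [e1ShufflePow]
  | succ i ih =>
    have h := shuffleOnes_apply 1 (e1ShufflePow i)
    rw [e1ShufflePow]
    refine h.symm.trans ?_
    rw [ih, map_smul, shuffleOnes_onesWord, smul_smul, add_comm 1 i, Nat.choose_one_right,
      Nat.factorial_succ]
    push_cast
    rw [mul_comm]

/-- The words ending in `e₀`, shuffled with powers of `e₁`. -/
theorem shuffleOnes_appendLetter_eq_sum (i : ℕ) (x : Letter) (f : NCPoly) :
    shuffleOnes i (appendLetter x f) =
      ∑ j ∈ range (i + 1), (appendLetter Letter.e1)^[j] (appendLetter x (shuffleOnes (i - j) f)) := by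
  induction i with
  | zero => simp [shuffleOnes_zero]
  | succ i ih =>
    rw [shuffleOnes_appendLetter, ih, sum_range_succ' _ (i + 1), map_sum, add_comm]
    simp only [Function.iterate_succ', Function.comp_apply, Nat.add_sub_add_right]
    rfl

theorem sum_neg_one_pow_choose_smul {i : ℕ} (hi : i ≠ 0) (g : NCPoly) :
    ∑ j ∈ range (i + 1), ((-1 : ℚ) ^ j * (i.choose j : ℚ)) • g = 0 := by
  rw [← sum_smul]
  have h := Int.alternating_sum_range_choose_of_ne hi
  have h' := congrArg (Int.cast : ℤ → ℚ) h
  push_cast at h'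
  rw [h', zero_smul]

/-- The regularization formula: `x e₀ e₁ᵃ = ∑_{i+j=a} (-1)ʲ ((x ш e₁ʲ) e₀) ш e₁ⁱ`. -/
theorem appendLetter_iterate_eq_sum (a : ℕ) (f : NCPoly) :
    (appendLetter Letter.e1)^[a] (appendLetter Letter.e0 f) =
      ∑ i ∈ range (a + 1), (-1 : ℚ) ^ (a - i) •
        shuffleOnes i (appendLetter Letter.e0 (shuffleOnes (a - i) f)) := by
  have h : ∀ i ∈ range (a + 1), (-1 : ℚ) ^ (a - i) •
        shuffleOnes i (appendLetter Letter.e0 (shuffleOnes (a - i) f)) =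
      ∑ j ∈ range (i + 1), ((-1 : ℚ) ^ (a - i) * ((a - j).choose (i - j))) •
        (appendLetter Letter.e1)^[j] (appendLetter Letter.e0 (shuffleOnes (a - j) f)) := by
    intro i hi
    have hi' := mem_range_succ_iff.1 hi
    rw [shuffleOnes_appendLetter_eq_sum, smul_sum]
    refine sum_congr rfl fun j hj => ?_
    have hj' := mem_range_succ_iff.1 hj
    rw [shuffleOnes_shuffleOnes, show i - j + (a - i) = a - j by omega, map_smul, mul_smul]
    congr 1
    rw [← Module.End.coe_pow, map_smul]
  rw [sum_congr rfl h]
  -- Collect the terms by the length j of the trailing block of e₁'s. Their coefficients form an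
  -- alternating binomial sum of order a - j, which vanishes unless j = a.
  have hswap : ∑ i ∈ range (a + 1), ∑ j ∈ range (i + 1),
      ((-1 : ℚ) ^ (a - i) * ((a - j).choose (i - j))) •
        (appendLetter Letter.e1)^[j] (appendLetter Letter.e0 (shuffleOnes (a - j) f)) =
      ∑ j ∈ range (a + 1), ∑ i ∈ Ico j (a + 1),
      ((-1 : ℚ) ^ (a - i) * ((a - j).choose (i - j))) •
        (appendLetter Letter.e1)^[j] (appendLetter Letter.e0 (shuffleOnes (a - j) f)) := by
    refine sum_comm' fun i j => ?_
    simp only [mem_range, mem_Ico]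
    omega
  rw [hswap, sum_range_succ, sum_eq_zero, zero_add]
  · simp [shuffleOnes_zero]
  · intro j hj
    have hj' := mem_range.1 hj
    rw [sum_Ico_eq_sum_range, ← sum_range_reflect]
    rw [← sum_neg_one_pow_choose_smul (i := a - j) (by omega)
      ((appendLetter Letter.e1)^[j] (appendLetter Letter.e0 (shuffleOnes (a - j) f)))]
    rw [show a + 1 - j = a - j + 1 by omega]
    refine sum_congr rfl fun i hi => ?_
    have hi' := mem_range_succ_iff.1 hi
    rw [show a - (j + (a - j + 1 - 1 - i)) = i by omega,
      show j + (a - j + 1 - 1 - i) - j = a - j - i by omega, Nat.choose_symm hi']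

/-- The shuffle product of `e₁ⁱ e₀ e₁ʲ` and `e₁ᵐ`. -/
theorem shuffleOnes_two_blocks (m i j : ℕ) :
    shuffleOnes m (wordPoly (onesWord i ++ Letter.e0 :: onesWord j)) =
      ∑ t ∈ range (m + 1), (((m - t + i).choose i : ℚ) * ((t + j).choose j : ℚ)) •
        wordPoly (onesWord (m - t + i) ++ Letter.e0 :: onesWord (t + j)) := by
  have happ : ∀ (k t : ℕ), (appendLetter Letter.e1)^[t] (wordPoly (onesWord k ++ [Letter.e0])) =
      wordPoly (onesWord k ++ Letter.e0 :: onesWord t) := by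
    intro k t
    induction t with
    | zero => simp
    | succ t ih =>
      rw [Function.iterate_succ_apply', ih, appendLetter_single]
      simp [onesWord, List.replicate_succ']
  have hsucc : ∀ k t, appendLetter Letter.e1 (wordPoly (onesWord k ++ Letter.e0 :: onesWord t)) =
      wordPoly (onesWord k ++ Letter.e0 :: onesWord (t + 1)) := by
    intro k t
    rw [← happ, ← happ, Function.iterate_succ_apply']
  induction j generalizing m with
  | zero =>
    have h : wordPoly (onesWord i ++ Letter.e0 :: onesWord 0) =
        appendLetter Letter.e0 (wordPoly (onesWord i)) := by simp
    rw [h, shuffleOnes_appendLetter_eq_sum]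
    refine sum_congr rfl fun t _ => ?_
    rw [shuffleOnes_onesWord, map_smul, ← Module.End.coe_pow, map_smul, appendLetter_single,
      Module.End.coe_pow, happ, Nat.choose_symm_add]
    simp
  | succ j ih =>
    induction m with
    | zero => simp [shuffleOnes_zero]
    | succ m ihm =>
      rw [← hsucc, shuffleOnes_appendLetter, hsucc, ihm, ih, sum_range_succ', map_add, map_sum,
        map_sum, sum_range_succ' _ (m + 1)]
      simp only [map_smul, hsucc, Nat.add_sub_add_right, Nat.sub_zero, zero_add, Nat.choose_self]
      rw [add_right_comm, ← sum_add_distrib]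
      congr 1
      refine sum_congr rfl fun t _ => ?_
      rw [show t + 1 + (j + 1) = t + (j + 1) + 1 by ring, Nat.choose_succ_succ,
        show t + 1 + j = t + (j + 1) by ring, ← add_smul]
      push_cast
      rw [mul_add]

end

/-! ### Multiple polylogarithms as formal power series -/

noncomputable section

/-- The coefficients of the multiple polylogarithm of the reversed word. -/
def liCoeffRev : Word → ℕ → ℝ
  | [], n => if n = 0 then 1 else 0
  | Letter.e0 :: w, n => liCoeffRev w n / n
  | Letter.e1 :: w, n => (∑ m ∈ range n, liCoeffRev w m) / n

/-- The coefficient of `zⁿ` in the multiple polylogarithm of a word. -/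
def liCoeff (w : Word) (n : ℕ) : ℝ := liCoeffRev w.reverse n

theorem liCoeff_nil (n : ℕ) : liCoeff [] n = if n = 0 then 1 else 0 := rfl

theorem liCoeff_append_e0 (w : Word) (n : ℕ) : liCoeff (w ++ [Letter.e0]) n = liCoeff w n / n := by
  simp [liCoeff, liCoeffRev]

theorem liCoeff_append_e1 (w : Word) (n : ℕ) :
    liCoeff (w ++ [Letter.e1]) n = (∑ m ∈ range n, liCoeff w m) / n := by
  simp [liCoeff, liCoeffRev]

theorem liCoeff_nonneg (w : Word) (n : ℕ) : 0 ≤ liCoeff w n := by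
  induction w using List.reverseRecOn generalizing n with
  | nil => rw [liCoeff_nil]; split_ifs <;> norm_num
  | append_singleton w x ih =>
    cases x
    · rw [liCoeff_append_e0]; exact div_nonneg (ih n) n.cast_nonneg
    · rw [liCoeff_append_e1]; exact div_nonneg (sum_nonneg fun m _ => ih m) n.cast_nonneg

theorem liCoeff_zero {w : Word} (hw : w ≠ []) : liCoeff w 0 = 0 := by
  obtain ⟨v, x, rfl⟩ := exists_append_of_ne_nil hw
  cases x
  · rw [liCoeff_append_e0]; simp
  · rw [liCoeff_append_e1]; simp

/-- The linear extension of the multiple polylogarithm. -/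
def liPoly : NCPoly →ₗ[ℚ] PowerSeries ℝ :=
  Finsupp.linearCombination ℚ fun w => PowerSeries.mk (liCoeff w)

theorem coeff_liPoly_wordPoly (w : Word) (n : ℕ) :
    PowerSeries.coeff n (liPoly (wordPoly w)) = liCoeff w n := by
  simp [liPoly]

/-- `z d/dz` on formal power series. -/
def eulerDeriv (f : PowerSeries ℝ) : PowerSeries ℝ :=
  PowerSeries.X * PowerSeries.derivative ℝ f

theorem coeff_eulerDeriv (f : PowerSeries ℝ) (n : ℕ) :
    PowerSeries.coeff n (eulerDeriv f) = n * PowerSeries.coeff n f := by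
  rcases n with _ | n
  · simp [eulerDeriv]
  · rw [eulerDeriv, PowerSeries.coeff_succ_X_mul, PowerSeries.coeff_derivative]
    push_cast; ring

theorem eulerDeriv_mul (f g : PowerSeries ℝ) :
    eulerDeriv (f * g) = eulerDeriv f * g + f * eulerDeriv g := by
  simp only [eulerDeriv, Derivation.leibniz, smul_eq_mul]
  ring

theorem eulerDeriv_add (f g : PowerSeries ℝ) : eulerDeriv (f + g) = eulerDeriv f + eulerDeriv g := by
  simp only [eulerDeriv, map_add, mul_add]

theorem eq_of_eulerDeriv_eq {f g : PowerSeries ℝ} (h : eulerDeriv f = eulerDeriv g)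
    (h0 : PowerSeries.constantCoeff f = PowerSeries.constantCoeff g) : f = g := by
  ext n
  rcases n with _ | n
  · simpa using h0
  · have := congrArg (PowerSeries.coeff (n + 1)) h
    rw [coeff_eulerDeriv, coeff_eulerDeriv] at this
    exact mul_left_cancel₀ (by positivity) this

/-- `∑_{n ≥ 1} zⁿ`. -/
def geomSeries : PowerSeries ℝ := PowerSeries.X * PowerSeries.mk fun _ => 1

theorem coeff_geomSeries_mul (f : PowerSeries ℝ) (n : ℕ) :
    PowerSeries.coeff n (geomSeries * f) = ∑ m ∈ range n, PowerSeries.coeff m f := by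
  rcases n with _ | n
  · simp [geomSeries]
  · rw [geomSeries, mul_assoc, PowerSeries.coeff_succ_X_mul, mul_comm, PowerSeries.coeff_mul,
      Finset.Nat.sum_antidiagonal_eq_sum_range_succ_mk]
    simp

theorem linear_ext_wordPoly {M : Type*} [AddCommGroup M] [Module ℚ M] {F G : NCPoly →ₗ[ℚ] M}
    (h : ∀ w, F (wordPoly w) = G (wordPoly w)) : F = G :=
  Finsupp.lhom_ext' fun w => LinearMap.ext_ring (h w)

theorem single_eq_smul_wordPoly (w : Word) (c : ℚ) : Finsupp.single w c = c • wordPoly w := by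
  simp

theorem constantCoeff_liPoly_appendLetter (x : Letter) (f : NCPoly) :
    PowerSeries.constantCoeff (liPoly (appendLetter x f)) = 0 := by
  induction f using Finsupp.induction_linear with
  | zero => simp
  | add f g hf hg => simp [hf, hg]
  | single w c =>
    rw [single_eq_smul_wordPoly, map_smul, map_smul,
      ← PowerSeries.coeff_zero_eq_constantCoeff_apply, appendLetter_single]
    have := coeff_liPoly_wordPoly (w ++ [x]) 0
    rw [liCoeff_zero (by simp)] at this
    rw [show PowerSeries.coeff 0 (c • liPoly (wordPoly (w ++ [x]))) =
      c • PowerSeries.coeff 0 (liPoly (wordPoly (w ++ [x]))) from rfl, this, smul_zero]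

theorem coeff_rat_smul (c : ℚ) (f : PowerSeries ℝ) (n : ℕ) :
    PowerSeries.coeff n (c • f) = c * PowerSeries.coeff n f := by
  rw [show PowerSeries.coeff n (c • f) = c • PowerSeries.coeff n f from rfl, Rat.smul_def]

theorem eulerDeriv_liPoly_append_e0 {f : NCPoly} (hf : PowerSeries.constantCoeff (liPoly f) = 0) :
    eulerDeriv (liPoly (appendLetter Letter.e0 f)) = liPoly f := by
  have h : ∀ n, n ≠ 0 → PowerSeries.coeff n (eulerDeriv (liPoly (appendLetter Letter.e0 f))) =
      PowerSeries.coeff n (liPoly f) := by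
    intro n hn
    have hn' : (n : ℝ) ≠ 0 := by exact_mod_cast hn
    clear hf
    rw [coeff_eulerDeriv]
    induction f using Finsupp.induction_linear with
    | zero => simp
    | add f g hf hg => simp only [map_add, mul_add, hf, hg]
    | single w c =>
      rw [single_eq_smul_wordPoly, map_smul, map_smul, appendLetter_single, coeff_rat_smul,
        map_smul, coeff_rat_smul, coeff_liPoly_wordPoly,
        coeff_liPoly_wordPoly, liCoeff_append_e0]
      field_simp
  ext n
  rcases eq_or_ne n 0 with rfl | hn
  · rw [coeff_eulerDeriv]; simp [hf]
  · exact h n hn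

theorem eulerDeriv_liPoly_append_e1 (f : NCPoly) :
    eulerDeriv (liPoly (appendLetter Letter.e1 f)) = geomSeries * liPoly f := by
  ext n
  rw [coeff_eulerDeriv, coeff_geomSeries_mul]
  rcases eq_or_ne n 0 with rfl | hn
  · simp
  have hn' : (n : ℝ) ≠ 0 := by exact_mod_cast hn
  induction f using Finsupp.induction_linear with
  | zero => simp
  | add f g hf hg => simp only [map_add, mul_add, hf, hg, sum_add_distrib]
  | single w c =>
    rw [single_eq_smul_wordPoly, map_smul, map_smul, appendLetter_single, coeff_rat_smul, map_smul,
      coeff_liPoly_wordPoly, liCoeff_append_e1]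
    simp only [coeff_rat_smul, coeff_liPoly_wordPoly]
    rw [← mul_sum]
    field_simp

/-- The multiple polylogarithm is multiplicative for the products of `f` with the powers of `e₁`. -/
def LiMultiplicative (f : NCPoly) : Prop :=
  ∀ i, liPoly (shuffleOnes i f) = liPoly f * liPoly (wordPoly (onesWord i))

theorem liPoly_nil : liPoly (wordPoly []) = 1 := by
  ext n
  rw [coeff_liPoly_wordPoly, liCoeff_nil, PowerSeries.coeff_one]

theorem wordPoly_onesWord_succ (i : ℕ) :
    wordPoly (onesWord (i + 1)) = appendLetter Letter.e1 (wordPoly (onesWord i)) := by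
  rw [appendLetter_single, onesWord, List.replicate_succ']

theorem liMultiplicative_nil : LiMultiplicative (wordPoly []) := by
  intro i
  rw [shuffleOnes_nil, liPoly_nil, one_mul]

/-- Both sides have constant term 0 when `i > 0`, and the same image under z d/dz, by the Leibniz
rule and the last-letter recursion of the shuffle product. The condition for e₀ is needed because
division by n loses the constant term. -/
theorem LiMultiplicative.append {x : Letter} {f : NCPoly} (hf : LiMultiplicative f)
    (h0 : x = Letter.e0 → PowerSeries.constantCoeff (liPoly f) = 0) :
    LiMultiplicative (appendLetter x f) := by
  intro i
  induction i with
  | zero => rw [shuffleOnes_zero, onesWord, List.replicate_zero, liPoly_nil, mul_one]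
  | succ i ih =>
    apply eq_of_eulerDeriv_eq
    · rw [shuffleOnes_appendLetter, map_add, eulerDeriv_add, eulerDeriv_mul,
        eulerDeriv_liPoly_append_e1, ih, wordPoly_onesWord_succ, eulerDeriv_liPoly_append_e1]
      cases x
      · rw [eulerDeriv_liPoly_append_e0 (h0 rfl), eulerDeriv_liPoly_append_e0, hf,
          wordPoly_onesWord_succ]
        · ring
        · rw [hf, map_mul, h0 rfl, zero_mul]
      · rw [eulerDeriv_liPoly_append_e1, eulerDeriv_liPoly_append_e1, hf, wordPoly_onesWord_succ]
        ring
    · rw [shuffleOnes_appendLetter, map_add, map_add, map_mul]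
      simp only [constantCoeff_liPoly_appendLetter, zero_mul, add_zero]

theorem LiMultiplicative.shuffleOnes {f : NCPoly} (hf : LiMultiplicative f) (j : ℕ) :
    LiMultiplicative (shuffleOnes j f) := by
  intro i
  have hones : ∀ m, LiMultiplicative (wordPoly (onesWord m)) := by
    intro m
    induction m with
    | zero => exact liMultiplicative_nil
    | succ m ih => rw [wordPoly_onesWord_succ]; exact ih.append (by simp)
  rw [shuffleOnes_shuffleOnes, map_smul, hf, hf, mul_assoc, ← hones j i, shuffleOnes_onesWord,
    map_smul, mul_smul_comm]

end

/-! ### Estimates for the coefficients of multiple polylogarithms -/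

noncomputable section

/-- The fourth root of `n`. -/
def fourthRoot (n : ℕ) : ℝ := √√(n : ℝ)

theorem fourthRoot_nonneg (n : ℕ) : 0 ≤ fourthRoot n := Real.sqrt_nonneg _

theorem fourthRoot_pow_four (n : ℕ) : fourthRoot n ^ 4 = n := by
  rw [fourthRoot, show 4 = 2 * 2 from rfl, pow_mul, Real.sq_sqrt (Real.sqrt_nonneg _),
    Real.sq_sqrt n.cast_nonneg]

theorem fourthRoot_zero : fourthRoot 0 = 0 := by simp [fourthRoot]

theorem one_le_fourthRoot {n : ℕ} (hn : 1 ≤ n) : 1 ≤ fourthRoot n := by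
  rw [fourthRoot, Real.one_le_sqrt, Real.one_le_sqrt]
  exact_mod_cast hn

theorem fourthRoot_mono : Monotone fourthRoot := fun a b h => by
  unfold fourthRoot
  gcongr

theorem tendsto_fourthRoot : Filter.Tendsto fourthRoot Filter.atTop Filter.atTop :=
  Real.tendsto_sqrt_atTop.comp (Real.tendsto_sqrt_atTop.comp tendsto_natCast_atTop_atTop)

theorem fourthRoot_succ_pow_four (n : ℕ) : fourthRoot (n + 1) ^ 4 = fourthRoot n ^ 4 + 1 := by
  rw [fourthRoot_pow_four, fourthRoot_pow_four]; push_cast; rfl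

/-- The discrete form of integrating x^(-3/4), with the term at m = 0 being 0 by convention. Fourth
roots are a wasteful substitute for powers of logarithms that serves all words at once. -/
theorem sum_range_inv_fourthRoot_le (n : ℕ) :
    ∑ m ∈ range (n + 1), (fourthRoot m ^ 3)⁻¹ ≤ 4 * fourthRoot n := by
  induction n with
  | zero => simp [fourthRoot_zero]
  | succ n ih =>
    rw [sum_range_succ]
    have h4 := fourthRoot_succ_pow_four n
    have hr := fourthRoot_nonneg n
    have hs := one_le_fourthRoot (n := n + 1) (by omega)
    have hle := fourthRoot_mono n.le_succ
    set r := fourthRoot n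
    set s := fourthRoot (n + 1)
    have key : (s ^ 3)⁻¹ ≤ 4 * (s - r) := by
      rw [inv_le_iff_one_le_mul₀ (by positivity)]
      have h1 : r * s ^ 2 ≤ s ^ 3 := by nlinarith [sq_nonneg s]
      have h2 : r ^ 2 * s ≤ s ^ 3 := by nlinarith [mul_nonneg hr (by linarith : 0 ≤ s)]
      have h3 : r ^ 3 ≤ s ^ 3 := by gcongr
      calc 1 = (s - r) * (s ^ 3 + r * s ^ 2 + r ^ 2 * s + r ^ 3) := by linear_combination -h4
        _ ≤ (s - r) * (s ^ 3 + s ^ 3 + s ^ 3 + s ^ 3) := by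
          apply mul_le_mul_of_nonneg_left _ (by linarith)
          linarith
        _ = 4 * (s - r) * s ^ 3 := by ring
    linarith

/-- A telescoping bound for n^(-7/4). With r and s the fourth roots of n and n + 1, the crude
estimate s ≤ 2r yields the constant 24 = 3 · 2³. -/
theorem inv_fourthRoot_pow_seven_le {n : ℕ} (hn : 1 ≤ n) :
    (fourthRoot n ^ 7)⁻¹ ≤ 24 * ((fourthRoot n ^ 3)⁻¹ - (fourthRoot (n + 1) ^ 3)⁻¹) := by
  have h4 := fourthRoot_succ_pow_four n
  have hr := one_le_fourthRoot hn
  have hle := fourthRoot_mono n.le_succ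
  set r := fourthRoot n
  set s := fourthRoot (n + 1)
  have hr0 : 0 < r := by linarith
  have hs0 : 0 < s := by linarith
  have hs2 : s ≤ 2 * r := by
    by_contra! h
    have : (2 * r) ^ 4 < s ^ 4 := by gcongr
    have : 1 ≤ r ^ 4 := one_le_pow₀ hr
    nlinarith
  have e : (s - r) * ((s ^ 2 + r ^ 2) * (s + r)) = 1 := by linear_combination h4
  have h1 : 1 ≤ (s - r) * (s ^ 2 + s * r + r ^ 2) * (s + r) := by
    rw [← e]
    have : 0 ≤ (s - r) * (s + r) * (s * r) := by
      have := sub_nonneg.2 hle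
      positivity
    nlinarith
  have h2 : (r ^ 3)⁻¹ - (s ^ 3)⁻¹ = (s - r) * (s ^ 2 + s * r + r ^ 2) / (r ^ 3 * s ^ 3) := by
    field_simp; ring
  rw [h2, inv_eq_one_div, ← mul_div_assoc, div_le_div_iff₀ (by positivity) (by positivity)]
  have hX : 0 ≤ (s - r) * (s ^ 2 + s * r + r ^ 2) := by
    have := sub_nonneg.2 hle
    positivity
  calc 1 * (r ^ 3 * s ^ 3) ≤ (s - r) * (s ^ 2 + s * r + r ^ 2) * (s + r) * (r ^ 3 * s ^ 3) := by
        gcongr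
    _ ≤ (s - r) * (s ^ 2 + s * r + r ^ 2) * (2 * r + r) * (r ^ 3 * (2 * r) ^ 3) := by gcongr
    _ = 24 * ((s - r) * (s ^ 2 + s * r + r ^ 2)) * r ^ 7 := by ring

/-- The bound n^(-3/4) is stable under appending letters. For e₀ one divides by n ≥ 1; for e₁ the
partial sums are O(n^(1/4)), and division by n restores the exponent. -/
theorem exists_liCoeff_le {w : Word} (hw : w.head? = some Letter.e1) :
    ∃ C, 0 ≤ C ∧ ∀ n, liCoeff w n ≤ C * (fourthRoot n ^ 3)⁻¹ := by
  induction w using List.reverseRecOn with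
  | nil => simp at hw
  | append_singleton w x ih =>
    by_cases hnil : w = []
    · subst hnil
      obtain rfl : x = Letter.e1 := by simpa using hw
      refine ⟨1, zero_le_one, fun n => ?_⟩
      rw [liCoeff_append_e1]
      rcases Nat.eq_zero_or_pos n with rfl | hn
      · simp [fourthRoot_zero]
      have h1 : ∑ m ∈ range n, liCoeff [] m = 1 := by
        simp only [liCoeff_nil, sum_ite_eq', mem_range, hn, if_true]
      have h2 := one_le_fourthRoot hn
      rw [h1, one_mul, ← fourthRoot_pow_four n, one_div]
      gcongr
      norm_num
    have hw' : w.head? = some Letter.e1 := by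
      obtain ⟨y, v, rfl⟩ := List.exists_cons_of_ne_nil hnil
      simpa using hw
    obtain ⟨C, hC, h⟩ := ih hw'
    refine ⟨4 * C, by positivity, fun n => ?_⟩
    rcases Nat.eq_zero_or_pos n with rfl | hn
    · rw [liCoeff_zero (by simp), fourthRoot_zero]; simp
    have hq := one_le_fourthRoot hn
    have hn1 : (1 : ℝ) ≤ n := by exact_mod_cast hn
    cases x
    · rw [liCoeff_append_e0]
      refine (div_le_self (liCoeff_nonneg w n) hn1).trans ((h n).trans ?_)
      have : 0 ≤ (fourthRoot n ^ 3)⁻¹ := by positivity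
      gcongr
      linarith
    · rw [liCoeff_append_e1]
      have h1 : ∑ m ∈ range n, liCoeff w m ≤ C * (4 * fourthRoot n) := by
        refine (sum_le_sum fun m _ => h m).trans ?_
        rw [← mul_sum]
        gcongr
        refine le_trans ?_ (sum_range_inv_fourthRoot_le n)
        rw [sum_range_succ]
        have : 0 ≤ (fourthRoot n ^ 3)⁻¹ := by positivity
        linarith
      rw [div_le_iff₀ (by positivity)]
      refine h1.trans (le_of_eq ?_)
      rw [show (n : ℝ) = fourthRoot n ^ 4 from (fourthRoot_pow_four n).symm]
      field_simp

theorem sum_liCoeff_le {w : Word} {C : ℝ} (hC : 0 ≤ C)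
    (h : ∀ n, liCoeff w n ≤ C * (fourthRoot n ^ 3)⁻¹) (N : ℕ) :
    ∑ n ∈ range N, liCoeff w n ≤ 4 * C * fourthRoot N := by
  have : ∑ n ∈ range N, (fourthRoot n ^ 3)⁻¹ ≤ 4 * fourthRoot N := by
    refine le_trans ?_ (sum_range_inv_fourthRoot_le N)
    rw [sum_range_succ]
    have : 0 ≤ (fourthRoot N ^ 3)⁻¹ := by have := fourthRoot_nonneg N; positivity
    linarith
  calc ∑ n ∈ range N, liCoeff w n ≤ ∑ n ∈ range N, C * (fourthRoot n ^ 3)⁻¹ :=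
        sum_le_sum fun n _ => h n
    _ = C * ∑ n ∈ range N, (fourthRoot n ^ 3)⁻¹ := (mul_sum _ _ _).symm
    _ ≤ C * (4 * fourthRoot N) := by gcongr
    _ = _ := by ring

/-- The series of the coefficients of `liPoly f` converges to `z` at a polynomial rate. -/
def TailBound (f : NCPoly) (z : ℝ) : Prop :=
  ∃ C, 0 ≤ C ∧ ∀ N, 1 ≤ N →
    |∑ n ∈ range N, PowerSeries.coeff n (liPoly f) - z| ≤ C * (fourthRoot N ^ 3)⁻¹

theorem TailBound.zero : TailBound 0 0 := ⟨0, le_rfl, fun N _ => by simp⟩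

theorem TailBound.add {f g : NCPoly} {y z : ℝ} (hf : TailBound f y) (hg : TailBound g z) :
    TailBound (f + g) (y + z) := by
  obtain ⟨C, hC, h⟩ := hf
  obtain ⟨D, hD, h'⟩ := hg
  refine ⟨C + D, by positivity, fun N hN => ?_⟩
  simp only [map_add, sum_add_distrib]
  rw [add_sub_add_comm, add_mul]
  exact (abs_add_le _ _).trans (add_le_add (h N hN) (h' N hN))

theorem TailBound.smul {f : NCPoly} {z : ℝ} (hf : TailBound f z) (c : ℚ) :
    TailBound (c • f) (c * z) := by
  obtain ⟨C, hC, h⟩ := hf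
  refine ⟨|(c : ℝ)| * C, by positivity, fun N hN => ?_⟩
  simp only [map_smul, coeff_rat_smul]
  rw [← mul_sum, ← mul_sub, abs_mul, mul_assoc]
  exact mul_le_mul_of_nonneg_left (h N hN) (abs_nonneg _)

theorem tailBound_nil : TailBound (wordPoly []) 1 := by
  refine ⟨0, le_rfl, fun N hN => ?_⟩
  simp only [coeff_liPoly_wordPoly, liCoeff_nil, sum_ite_eq', mem_range]
  rw [if_pos (by omega)]
  simp

/-- The final e₀ improves the coefficients to O(n^(-7/4)), whose tails telescope to O(N^(-3/4)). The
limit is the supremum of the increasing partial sums. -/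
theorem exists_tailBound_append_e0 {w : Word} (hw : w.head? = some Letter.e1) :
    ∃ z, TailBound (wordPoly (w ++ [Letter.e0])) z := by
  obtain ⟨C, hC, h⟩ := exists_liCoeff_le hw
  have hb : ∀ n, 1 ≤ n → liCoeff (w ++ [Letter.e0]) n ≤
      24 * C * ((fourthRoot n ^ 3)⁻¹ - (fourthRoot (n + 1) ^ 3)⁻¹) := by
    intro n hn
    have hq := one_le_fourthRoot hn
    rw [liCoeff_append_e0]
    calc liCoeff w n / n ≤ C * (fourthRoot n ^ 3)⁻¹ / n := by
          gcongr
          exact h n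
      _ = C * (fourthRoot n ^ 7)⁻¹ := by
          rw [show (n : ℝ) = fourthRoot n ^ 4 from (fourthRoot_pow_four n).symm]
          field_simp
      _ ≤ C * (24 * ((fourthRoot n ^ 3)⁻¹ - (fourthRoot (n + 1) ^ 3)⁻¹)) := by
          gcongr
          exact inv_fourthRoot_pow_seven_le hn
      _ = _ := by ring
  set s : ℕ → ℝ := fun N => ∑ n ∈ range N, liCoeff (w ++ [Letter.e0]) n with hs
  have hmono : Monotone s := by
    refine monotone_nat_of_le_succ fun n => ?_
    simp only [hs, sum_range_succ]
    linarith [liCoeff_nonneg (w ++ [Letter.e0]) n]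
  have hstep : ∀ N, 1 ≤ N → ∀ M, N ≤ M →
      s M ≤ s N + 24 * C * ((fourthRoot N ^ 3)⁻¹ - (fourthRoot M ^ 3)⁻¹) := by
    intro N hN M hM
    induction M, hM using Nat.le_induction with
    | base => simp
    | succ M hM ih =>
      have := hb M (hN.trans hM)
      have e : s (M + 1) = s M + liCoeff (w ++ [Letter.e0]) M := sum_range_succ _ _
      rw [e]
      linarith
  have hstep' : ∀ N, 1 ≤ N → ∀ M, N ≤ M → s M ≤ s N + 24 * C * (fourthRoot N ^ 3)⁻¹ := by
    intro N hN M hM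
    refine (hstep N hN M hM).trans ?_
    have : 0 ≤ (fourthRoot M ^ 3)⁻¹ := by have := fourthRoot_nonneg M; positivity
    nlinarith
  have hbdd : BddAbove (Set.range s) := by
    refine ⟨s 1 + 24 * C * (fourthRoot 1 ^ 3)⁻¹, ?_⟩
    rintro _ ⟨M, rfl⟩
    rcases Nat.eq_zero_or_pos M with rfl | hM
    · have : 0 ≤ (fourthRoot 1 ^ 3)⁻¹ := by have := fourthRoot_nonneg 1; positivity
      have h01 : s 0 ≤ s 1 := hmono (zero_le_one' ℕ)
      have : 0 ≤ 24 * C * (fourthRoot 1 ^ 3)⁻¹ := by positivity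
      exact h01.trans (le_add_of_nonneg_right this)
    · exact hstep' 1 le_rfl M hM
  have hlim := tendsto_atTop_ciSup hmono hbdd
  refine ⟨⨆ i, s i, 24 * C, by positivity, fun N hN => ?_⟩
  simp only [coeff_liPoly_wordPoly]
  have h1 : s N ≤ ⨆ i, s i := le_ciSup hbdd N
  have h2 : ⨆ i, s i ≤ s N + 24 * C * (fourthRoot N ^ 3)⁻¹ :=
    le_of_tendsto hlim (Filter.eventually_atTop.2 ⟨N, fun M hM => hstep' N hN M hM⟩)
  rw [abs_sub_comm, abs_of_nonneg (sub_nonneg.2 h1)]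
  linarith

theorem tendsto_inv_fourthRoot_pow {j : ℕ} (hj : j ≠ 0) :
    Filter.Tendsto (fun N => (fourthRoot N ^ j)⁻¹) Filter.atTop (nhds 0) :=
  tendsto_inv_atTop_zero.comp ((Filter.tendsto_pow_atTop hj).comp tendsto_fourthRoot)

theorem TailBound.tendsto {f : NCPoly} {z : ℝ} (hf : TailBound f z) :
    Filter.Tendsto (fun N => ∑ n ∈ range N, PowerSeries.coeff n (liPoly f))
      Filter.atTop (nhds z) := by
  obtain ⟨C, hC, h⟩ := hf
  rw [← tendsto_sub_nhds_zero_iff]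
  have h0 : Filter.Tendsto (fun N => C * (fourthRoot N ^ 3)⁻¹) Filter.atTop (nhds 0) := by
    simpa using (tendsto_inv_fourthRoot_pow (j := 3) (by norm_num)).const_mul C
  exact squeeze_zero_norm' (Filter.eventually_atTop.2 ⟨1, fun N hN => h N hN⟩) h0

theorem sum_range_coeff_mul (F G : PowerSeries ℝ) (M : ℕ) :
    ∑ n ∈ range M, PowerSeries.coeff n (F * G) =
      ∑ m ∈ range M, PowerSeries.coeff m G * ∑ n ∈ range (M - m), PowerSeries.coeff n F := by
  have h : ∀ n ∈ range M, PowerSeries.coeff n (F * G) =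
      ∑ m ∈ range (n + 1), PowerSeries.coeff m G * PowerSeries.coeff (n - m) F := by
    intro n _
    rw [mul_comm, PowerSeries.coeff_mul, Finset.Nat.sum_antidiagonal_eq_sum_range_succ_mk]
  rw [sum_congr rfl h, sum_sigma', sum_congr rfl fun m _ => mul_sum _ _ _, sum_sigma']
  refine sum_bij' (fun x _ => ⟨x.2, x.1 - x.2⟩) (fun x _ => ⟨x.1 + x.2, x.1⟩) ?_ ?_ ?_ ?_ ?_
  · rintro ⟨n, m⟩ hx; simp only [mem_sigma, mem_range] at hx ⊢; omega
  · rintro ⟨n, m⟩ hx; simp only [mem_sigma, mem_range] at hx ⊢; omega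
  · rintro ⟨n, m⟩ hx
    simp only [mem_sigma, mem_range] at hx
    simp only [Sigma.mk.injEq, heq_eq_eq, and_true]; omega
  · rintro ⟨n, m⟩ hx; simp
  · rintro ⟨n, m⟩ hx; rfl

/-- The larger of m and M - m is at least M/2. Its fourth root is bounded below, crudely, by half of
that of M, whence the factor 8 after cubing. -/
theorem inv_fourthRoot_mul_le {m M : ℕ} (hm : m < M) :
    (fourthRoot m ^ 3)⁻¹ * (fourthRoot (M - m) ^ 3)⁻¹ ≤
      8 * (fourthRoot M ^ 3)⁻¹ * ((fourthRoot m ^ 3)⁻¹ + (fourthRoot (M - m) ^ 3)⁻¹) := by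
  rcases Nat.eq_zero_or_pos m with rfl | hm0
  · have := fourthRoot_nonneg M
    rw [fourthRoot_zero]
    simp only [ne_eq, OfNat.ofNat_ne_zero, not_false_eq_true, zero_pow, inv_zero, zero_mul,
      zero_add, Nat.sub_zero]
    positivity
  have key : ∀ a b : ℕ, 1 ≤ a → 1 ≤ b → b ≤ a → a + b = M →
      (fourthRoot a ^ 3)⁻¹ ≤ 8 * (fourthRoot M ^ 3)⁻¹ := by
    intro a b ha hb hab hM
    have h1 : fourthRoot M ≤ 2 * fourthRoot a := by
      have := one_le_fourthRoot ha
      refine le_of_pow_le_pow_left₀ (n := 4) (by norm_num) (by positivity) ?_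
      rw [mul_pow, fourthRoot_pow_four, fourthRoot_pow_four, ← hM]
      push_cast
      have : (b : ℝ) ≤ a := by exact_mod_cast hab
      have : (0 : ℝ) ≤ a := a.cast_nonneg
      linarith
    have h2 := one_le_fourthRoot (n := M) (by omega)
    have h3 := one_le_fourthRoot ha
    rw [← div_eq_mul_inv, inv_eq_one_div, div_le_div_iff₀ (by positivity) (by positivity)]
    calc 1 * fourthRoot M ^ 3 ≤ 1 * (2 * fourthRoot a) ^ 3 := by gcongr
      _ = 8 * fourthRoot a ^ 3 := by ring
  have h3 := one_le_fourthRoot hm0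
  have h4 := one_le_fourthRoot (n := M - m) (by omega)
  have h5 := one_le_fourthRoot (n := M) (by omega)
  have p1 : 0 ≤ 8 * (fourthRoot M ^ 3)⁻¹ * (fourthRoot m ^ 3)⁻¹ := by positivity
  have p2 : 0 ≤ 8 * (fourthRoot M ^ 3)⁻¹ * (fourthRoot (M - m) ^ 3)⁻¹ := by positivity
  rw [mul_add]
  rcases le_total m (M - m) with h | h
  · have := mul_le_mul_of_nonneg_right (key _ _ (by omega) hm0 h (by omega))
      (by positivity : 0 ≤ (fourthRoot m ^ 3)⁻¹)
    linarith
  · have := mul_le_mul_of_nonneg_right (key _ _ hm0 (by omega) h (by omega))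
      (by positivity : 0 ≤ (fourthRoot (M - m) ^ 3)⁻¹)
    linarith

theorem sum_inv_fourthRoot_mul_le (M : ℕ) :
    ∑ m ∈ range M, (fourthRoot m ^ 3)⁻¹ * (fourthRoot (M - m) ^ 3)⁻¹ ≤
      64 * (fourthRoot M ^ 2)⁻¹ := by
  have hM := fourthRoot_nonneg M
  have h1 : ∑ m ∈ range M, (fourthRoot m ^ 3)⁻¹ ≤ 4 * fourthRoot M := by
    refine le_trans ?_ (sum_range_inv_fourthRoot_le M)
    rw [sum_range_succ]
    have : 0 ≤ (fourthRoot M ^ 3)⁻¹ := by positivity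
    linarith
  have h2 : ∑ m ∈ range M, (fourthRoot (M - m) ^ 3)⁻¹ ≤ 4 * fourthRoot M := by
    refine le_trans (le_of_eq ?_) (sum_range_inv_fourthRoot_le M)
    rw [← sum_range_reflect, sum_range_succ', fourthRoot_zero]
    simp only [ne_eq, OfNat.ofNat_ne_zero, not_false_eq_true, zero_pow, inv_zero, add_zero]
    refine sum_congr rfl fun m hm => ?_
    have := mem_range.1 hm
    rw [show M - (M - 1 - m) = m + 1 by omega]
  calc _ ≤ ∑ m ∈ range M, 8 * (fourthRoot M ^ 3)⁻¹ *
          ((fourthRoot m ^ 3)⁻¹ + (fourthRoot (M - m) ^ 3)⁻¹) :=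
        sum_le_sum fun m hm => inv_fourthRoot_mul_le (mem_range.1 hm)
    _ = 8 * (fourthRoot M ^ 3)⁻¹ * (∑ m ∈ range M, (fourthRoot m ^ 3)⁻¹ +
          ∑ m ∈ range M, (fourthRoot (M - m) ^ 3)⁻¹) := by rw [← mul_sum, sum_add_distrib]
    _ ≤ 8 * (fourthRoot M ^ 3)⁻¹ * (4 * fourthRoot M + 4 * fourthRoot M) := by gcongr
    _ = 64 * (fourthRoot M ^ 2)⁻¹ := by
      rcases hM.eq_or_lt with h | h
      · rw [← h]; simp
      · field_simp; ring

/-- The partial sums of the coefficients of `liPoly (e₁ⁱ)`. -/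
def onesSum (M i : ℕ) : ℝ := ∑ n ∈ range M, liCoeff (onesWord i) n

/-- A partial sum of a Cauchy product runs over n + m < M. Replacing the inner partial sum up to M -
m by its limit z costs at most the sum of m^(-3/4) (M - m)^(-3/4), which is O(M^(-1/2)). -/
theorem TailBound.mul_onesWord {f : NCPoly} {z : ℝ} (hf : TailBound f z) (i : ℕ) :
    (fun M => ∑ n ∈ range M, PowerSeries.coeff n (liPoly f * liPoly (wordPoly (onesWord i))) -
      z * onesSum M i) =O[Filter.atTop] fun M => (fourthRoot M ^ 2)⁻¹ := by
  obtain ⟨C, hC, h⟩ := hf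
  have hdiff : ∀ M, ∑ n ∈ range M, PowerSeries.coeff n
      (liPoly f * liPoly (wordPoly (onesWord i))) - z * onesSum M i =
      ∑ m ∈ range M, liCoeff (onesWord i) m *
        (∑ n ∈ range (M - m), PowerSeries.coeff n (liPoly f) - z) := by
    intro M
    rw [sum_range_coeff_mul]
    simp only [coeff_liPoly_wordPoly, mul_sub, sum_sub_distrib, onesSum]
    rw [← sum_mul, mul_comm z]
  have hle : ∀ M, |∑ m ∈ range M, liCoeff (onesWord i) m *
        (∑ n ∈ range (M - m), PowerSeries.coeff n (liPoly f) - z)| ≤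
      ∑ m ∈ range M, liCoeff (onesWord i) m * (C * (fourthRoot (M - m) ^ 3)⁻¹) := by
    intro M
    refine (abs_sum_le_sum_abs _ _).trans (sum_le_sum fun m hm => ?_)
    rw [abs_mul, abs_of_nonneg (liCoeff_nonneg _ _)]
    exact mul_le_mul_of_nonneg_left (h _ (by have := mem_range.1 hm; omega)) (liCoeff_nonneg _ _)
  simp only [hdiff]
  rcases i with _ | i
  · refine Asymptotics.IsBigO.of_bound C (Filter.eventually_atTop.2 ⟨1, fun M hM => ?_⟩)
    have hq := one_le_fourthRoot hM
    rw [Real.norm_eq_abs, Real.norm_eq_abs, abs_of_nonneg (by positivity : 0 ≤ (fourthRoot M ^ 2)⁻¹)]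
    refine (hle M).trans ?_
    simp only [onesWord, List.replicate_zero, liCoeff_nil, ite_mul, one_mul, zero_mul, sum_ite_eq',
      mem_range]
    rw [if_pos (by omega), Nat.sub_zero]
    gcongr
    norm_num
  · obtain ⟨D, hD, h'⟩ := exists_liCoeff_le (w := onesWord (i + 1)) (by simp [List.replicate_succ])
    refine Asymptotics.IsBigO.of_bound (D * C * 64) (Filter.Eventually.of_forall fun M => ?_)
    have hq := fourthRoot_nonneg M
    rw [Real.norm_eq_abs, Real.norm_eq_abs, abs_of_nonneg (by positivity : 0 ≤ (fourthRoot M ^ 2)⁻¹)]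
    refine (hle M).trans ?_
    calc ∑ m ∈ range M, liCoeff (onesWord (i + 1)) m * (C * (fourthRoot (M - m) ^ 3)⁻¹)
        ≤ ∑ m ∈ range M, D * (fourthRoot m ^ 3)⁻¹ * (C * (fourthRoot (M - m) ^ 3)⁻¹) := by
          refine sum_le_sum fun m _ => ?_
          have := fourthRoot_nonneg (M - m)
          exact mul_le_mul_of_nonneg_right (h' m) (by positivity)
      _ = D * C * ∑ m ∈ range M, (fourthRoot m ^ 3)⁻¹ * (fourthRoot (M - m) ^ 3)⁻¹ := by
          rw [mul_sum]; exact sum_congr rfl fun m _ => by ring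
      _ ≤ D * C * (64 * (fourthRoot M ^ 2)⁻¹) := by
          gcongr
          exact sum_inv_fourthRoot_mul_le M
      _ = _ := by ring

end

/-! ### Multiple zeta values as limits -/

noncomputable section

open Filter Topology

theorem indexWord_nil : indexWord [] = [] := rfl

theorem indexWord_append (k l : Index) : indexWord (k ++ l) = indexWord k ++ indexWord l := by
  simp [indexWord]

theorem indexWord_singleton (m : ℕ+) :
    indexWord [m] = Letter.e1 :: List.replicate ((m : ℕ) - 1) Letter.e0 := by
  simp [indexWord]

theorem indexWord_replicate_one (a : ℕ) : indexWord (List.replicate a 1) = onesWord a := by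
  induction a with
  | zero => rfl
  | succ a ih =>
    rw [List.replicate_succ', indexWord_append, ih, onesWord, onesWord, List.replicate_succ']
    rfl

theorem liCoeff_append_block (w : Word) (j n : ℕ) :
    liCoeff (w ++ Letter.e1 :: List.replicate j Letter.e0) n =
      (∑ m ∈ range n, liCoeff w m) * ((n : ℝ)⁻¹) ^ (j + 1) := by
  induction j with
  | zero => rw [List.replicate_zero, liCoeff_append_e1]; simp [div_eq_mul_inv]
  | succ j ih =>
    rw [List.replicate_succ', ← List.cons_append, ← List.append_assoc, liCoeff_append_e0, ih,
      div_eq_mul_inv, pow_succ _ (j + 1), mul_assoc]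

/-- The truncated multiple zeta value `∑_{0 < n₁ < ⋯ < n_r < M} ∏ nᵢ ^ (-kᵢ)`. -/
def mzvTrunc (M : ℕ) (k : Index) : ℝ := nestedSum (initialList (fun n => (n : ℝ)⁻¹) M) k

theorem mzvTrunc_nil (M : ℕ) : mzvTrunc M [] = 1 := by
  rw [mzvTrunc, nestedSum_nil_right]

theorem sum_liCoeff_indexWord (k : Index) {M : ℕ} (hM : 1 ≤ M) :
    ∑ n ∈ range M, liCoeff (indexWord k) n = mzvTrunc M k := by
  induction k using List.reverseRecOn generalizing M with
  | nil =>
    rw [mzvTrunc_nil]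
    simp only [indexWord_nil, liCoeff_nil, sum_ite_eq', mem_range]
    rw [if_pos (by omega)]
  | append_singleton k m ih =>
    rw [mzvTrunc, nestedSum_initialList_concat, indexWord_append, indexWord_singleton,
      range_eq_Ico, sum_eq_sum_Ico_succ_bot (by omega), liCoeff_zero (by simp), zero_add]
    refine sum_congr rfl fun n hn => ?_
    rw [liCoeff_append_block, ih (mem_Ico.1 hn).1, Nat.sub_add_cancel m.pos]
    rfl

theorem onesSum_eq {M : ℕ} (hM : 1 ≤ M) (i : ℕ) :
    onesSum M i = mzvTrunc M (List.replicate i 1) := by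
  rw [onesSum, ← indexWord_replicate_one, sum_liCoeff_indexWord _ hM]

theorem Admissible.exists_indexWord_eq {k : Index} (hk : Admissible k) (hne : k ≠ []) :
    ∃ x : Word, x.head? = some Letter.e1 ∧ indexWord k = x ++ [Letter.e0] := by
  obtain ⟨l, m, rfl⟩ : ∃ l m, k = l ++ [m] :=
    ⟨k.dropLast, k.getLast hne, (List.dropLast_append_getLast hne).symm⟩
  have hm : 2 ≤ m := hk m (by simp)
  have hm' : 2 ≤ (m : ℕ) := by exact_mod_cast hm
  refine ⟨indexWord l ++ Letter.e1 :: List.replicate ((m : ℕ) - 2) Letter.e0, ?_, ?_⟩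
  · rcases l with _ | ⟨a, l⟩
    · simp [indexWord_nil]
    · simp [indexWord]
  · rw [indexWord_append, indexWord_singleton, show (m : ℕ) - 1 = (m : ℕ) - 2 + 1 by omega,
      List.replicate_succ']
    simp

theorem exists_tailBound_indexWord {k : Index} (hk : Admissible k) :
    ∃ z, TailBound (wordPoly (indexWord k)) z := by
  by_cases hne : k = []
  · subst hne; exact ⟨1, tailBound_nil⟩
  · obtain ⟨x, hx, h⟩ := hk.exists_indexWord_eq hne
    rw [h]
    exact exists_tailBound_append_e0 hx

theorem TailBound.tendsto_mzvTrunc {k : Index} {z : ℝ}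
    (h : TailBound (wordPoly (indexWord k)) z) :
    Tendsto (fun M => mzvTrunc M k) atTop (𝓝 z) := by
  refine h.tendsto.congr' (eventually_atTop.2 ⟨1, fun M hM => ?_⟩)
  simp only [coeff_liPoly_wordPoly]
  exact sum_liCoeff_indexWord k hM

open Classical in
-- The terms are nonnegative and the finite sets of tuples bounded by M exhaust the index set. So
-- convergence of the truncations gives summability and identifies the sum.
theorem mzv_eq_of_tendsto {k : Index} {z : ℝ}
    (h : Tendsto (fun M => mzvTrunc M k) atTop (𝓝 z)) : mzv k = z := by
  set X := {ν : Fin k.length → ℕ+ // StrictMono ν}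
  set g : X → ℝ := fun ν => ∏ i, 1 / ((ν.1 i : ℕ) : ℝ) ^ (k.get i : ℕ) with hg
  set e : X → Fin k.length → ℕ := fun ν i => ν.1 i with he
  have hinj : Function.Injective e := by
    intro ν ν' hν
    apply Subtype.ext
    funext i
    exact PNat.coe_injective (congrFun hν i)
  set S : ℕ → Finset X := fun M => ((Fintype.piFinset fun _ : Fin k.length => Ioo 0 M).filter
    StrictMono).preimage e hinj.injOn with hS
  have hmem : ∀ M ν, ν ∈ S M ↔ ∀ i, (ν.1 i : ℕ) < M := by
    intro M ν
    simp only [hS, mem_preimage, mem_filter, Fintype.mem_piFinset, mem_Ioo, he]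
    refine ⟨fun h i => (h.1 i).2, fun h => ⟨fun i => ⟨(ν.1 i).pos, h i⟩, fun i j hij => ?_⟩⟩
    exact_mod_cast ν.2 hij
  have hmono : Monotone S := by
    intro M M' hM ν hν
    rw [hmem] at hν ⊢
    exact fun i => (hν i).trans_le hM
  have htend : Tendsto S atTop atTop := by
    refine tendsto_atTop_finset_of_monotone hmono fun ν => ⟨∑ i, (ν.1 i : ℕ) + 1, ?_⟩
    rw [hmem]
    intro i
    exact Nat.lt_succ_of_le (single_le_sum (f := fun i => (ν.1 i : ℕ)) (fun _ _ => Nat.zero_le _)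
      (mem_univ i))
  have hsum : ∀ M, 1 ≤ M → ∑ ν ∈ S M, g ν = mzvTrunc M k := by
    intro M hM
    rw [mzvTrunc, ← sum_strictMono_eq_nestedSum_initialList _ hM,
      ← sum_preimage e _ hinj.injOn]
    · refine sum_congr rfl fun ν _ => ?_
      simp [hg, he]
    · intro ν hν hν'
      simp only [mem_filter, Fintype.mem_piFinset, mem_Ioo] at hν
      refine absurd ⟨⟨fun i => ⟨ν i, (hν.1 i).1⟩, fun i j hij => ?_⟩, ?_⟩ hν'
      · exact hν.2 hij
      · rfl
  have hg0 : ∀ ν, 0 ≤ g ν := fun ν => prod_nonneg fun i _ => by positivity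
  have hlim : Tendsto (fun M => ∑ ν ∈ S M, g ν) atTop (𝓝 z) :=
    h.congr' (eventually_atTop.2 ⟨1, fun M hM => (hsum M hM).symm⟩)
  have hle : ∀ M, ∑ ν ∈ S M, g ν ≤ z := fun M =>
    Monotone.ge_of_tendsto (fun a b hab => sum_le_sum_of_subset_of_nonneg (hmono hab)
      fun ν _ _ => hg0 ν) hlim M
  have hsummable : Summable g := by
    refine summable_of_sum_le (c := z) hg0 fun u => ?_
    obtain ⟨M, hM⟩ := (htend.eventually_ge_atTop u).exists
    exact (sum_le_sum_of_subset_of_nonneg hM fun ν _ _ => hg0 ν).trans (hle M)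
  exact tendsto_nhds_unique (hsummable.hasSum.comp htend) hlim

theorem Admissible.tailBound {k : Index} (hk : Admissible k) :
    TailBound (wordPoly (indexWord k)) (mzv k) := by
  obtain ⟨z, hz⟩ := exists_tailBound_indexWord hk
  rwa [mzv_eq_of_tendsto hz.tendsto_mzvTrunc]

theorem Admissible.tendsto_mzvTrunc {k : Index} (hk : Admissible k) :
    Tendsto (fun M => mzvTrunc M k) atTop (𝓝 (mzv k)) := hk.tailBound.tendsto_mzvTrunc

theorem coe_zeta {k : Index} (hk : Admissible k) : (zeta k : ℝ) = mzv k := by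
  rw [zeta, dif_pos hk]

/-! ### Shuffle regularization -/

/-- The words spanning `𝔥⁰`. -/
abbrev AdmissibleWord (w : Word) : Prop :=
  w = [] ∨ (w.head? = some Letter.e1 ∧ w.getLast? = some Letter.e0)

theorem exists_indexWord_eq {w : Word} (hw : w ≠ [] → w.head? = some Letter.e1) :
    ∃ k, indexWord k = w := by
  have key : ∀ w : Word, ∃ n k, w = List.replicate n Letter.e0 ++ indexWord k := by
    intro w
    induction w with
    | nil => exact ⟨0, [], rfl⟩
    | cons x w ih =>
      obtain ⟨n, k, rfl⟩ := ih
      cases x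
      · exact ⟨n + 1, k, by simp [List.replicate_succ]⟩
      · exact ⟨0, n.succPNat :: k, by simp [indexWord]⟩
  obtain ⟨n, k, rfl⟩ := key w
  rcases n with _ | n
  · exact ⟨k, by simp⟩
  · simp [List.replicate_succ] at hw

theorem AdmissibleWord.exists_index {w : Word} (hw : AdmissibleWord w) :
    ∃ k, Admissible k ∧ indexWord k = w := by
  obtain ⟨k, rfl⟩ := exists_indexWord_eq (w := w) fun h => (hw.resolve_left h).1
  refine ⟨k, ?_, rfl⟩
  intro m hm
  obtain ⟨l, rfl⟩ : ∃ l, k = l ++ [m] := by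
    rw [Option.mem_def, List.getLast?_eq_some_iff] at hm
    exact hm
  rcases hw with h | ⟨-, h⟩
  · simp [indexWord_append, indexWord_singleton] at h
  · rw [indexWord_append, indexWord_singleton] at h
    by_contra hlt
    obtain rfl : m = 1 := by
      have : m < 2 := not_le.1 hlt
      exact PNat.lt_add_one_iff.1 this |>.antisymm one_le
    simp at h

/-- The linear extension of `Z` to all words. -/
def zetaPoly : NCPoly →ₗ[ℚ] ZAlg := Finsupp.linearCombination ℚ fun w => zeta (wordIndex w)

theorem evalZ_apply (c : H0) : evalZ c = zetaPoly c := rfl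

theorem zetaPoly_indexWord (k : Index) : zetaPoly (wordPoly (indexWord k)) = zeta k := by
  simp [zetaPoly, wordIndex_indexWord]

theorem wordPoly_mem_H0 {w : Word} (hw : AdmissibleWord w) : wordPoly w ∈ H0 :=
  Finsupp.single_mem_supported ℚ 1 hw

theorem H0_induction {p : NCPoly → Prop} (h0 : p 0) (hadd : ∀ f g, p f → p g → p (f + g))
    (hsmul : ∀ (c : ℚ) f, p f → p (c • f)) (hw : ∀ w, AdmissibleWord w → p (wordPoly w))
    {f : NCPoly} (hf : f ∈ H0) : p f := by
  rw [H0, Finsupp.supported_eq_span_single] at hf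
  induction hf using Submodule.span_induction with
  | mem x hx => obtain ⟨w, h, rfl⟩ := hx; exact hw w h
  | zero => exact h0
  | add x y _ _ hx hy => exact hadd x y hx hy
  | smul c x _ hx => exact hsmul c x hx

theorem tailBound_of_mem_H0 {f : NCPoly} (hf : f ∈ H0) : TailBound f (zetaPoly f : ℝ) := by
  refine H0_induction (p := fun f => TailBound f (zetaPoly f : ℝ)) ?_ ?_ ?_ ?_ hf
  · simpa using TailBound.zero
  · intro f g hf hg
    simpa using hf.add hg
  · intro c f hf
    have := hf.smul c
    rw [map_smul]
    simpa [Rat.smul_def] using this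
  · intro w hw
    obtain ⟨k, hk, rfl⟩ := hw.exists_index
    rw [zetaPoly_indexWord, coe_zeta hk]
    exact hk.tailBound

/-- Right division by the letter `e₁`. -/
def stripE1 : NCPoly →ₗ[ℚ] NCPoly := Finsupp.linearCombination ℚ fun w =>
  match w.getLast? with
  | some Letter.e1 => wordPoly w.dropLast
  | _ => 0

theorem stripE1_appendLetter_e0 (f : NCPoly) : stripE1 (appendLetter Letter.e0 f) = 0 := by
  suffices h : stripE1 ∘ₗ appendLetter Letter.e0 = 0 from LinearMap.congr_fun h f
  exact linear_ext_wordPoly fun w => by simp [stripE1]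

theorem stripE1_appendLetter_e1 (f : NCPoly) : stripE1 (appendLetter Letter.e1 f) = f := by
  suffices h : stripE1 ∘ₗ appendLetter Letter.e1 = LinearMap.id from LinearMap.congr_fun h f
  exact linear_ext_wordPoly fun w => by simp [stripE1]

theorem stripE1_of_mem_H0 {f : NCPoly} (hf : f ∈ H0) : stripE1 f = 0 := by
  refine H0_induction (p := fun f => stripE1 f = 0) (map_zero _) ?_ ?_ ?_ hf
  · intro f g hf hg; rw [map_add, hf, hg, add_zero]
  · intro c f hf; rw [map_smul, hf, smul_zero]
  · intro w hw
    rcases hw with rfl | ⟨-, h⟩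
    · simp [stripE1]
    · simp [stripE1, h]

/-- Right division by e₁ acts as a derivation: the last letter of a shuffle comes from one factor or
the other. -/
theorem stripE1_shuffleOnes (i : ℕ) (f : NCPoly) :
    stripE1 (shuffleOnes (i + 1) f) = shuffleOnes (i + 1) (stripE1 f) + shuffleOnes i f := by
  suffices h : stripE1 ∘ₗ shuffleOnes (i + 1) = shuffleOnes (i + 1) ∘ₗ stripE1 + shuffleOnes i from
    LinearMap.congr_fun h f
  refine linear_ext_wordPoly fun w => ?_
  simp only [LinearMap.comp_apply, LinearMap.add_apply]
  rcases eq_or_ne w [] with rfl | hw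
  · rw [shuffleOnes_nil, shuffleOnes_nil, wordPoly_onesWord_succ, stripE1_appendLetter_e1,
      stripE1_of_mem_H0 (wordPoly_mem_H0 (Or.inl rfl)), map_zero, zero_add]
  · obtain ⟨v, x, rfl⟩ := exists_append_of_ne_nil hw
    rw [show wordPoly (v ++ [x]) = appendLetter x (wordPoly v) by simp, shuffleOnes_appendLetter, map_add, stripE1_appendLetter_e1]
    cases x
    · rw [stripE1_appendLetter_e0, stripE1_appendLetter_e0, map_zero]
    · rw [stripE1_appendLetter_e1, stripE1_appendLetter_e1]

theorem stripE1_iterate_shuffleOnes {f : NCPoly} (hf : f ∈ H0) (i j : ℕ) :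
    (stripE1 ^ j) (shuffleOnes i f) = if j ≤ i then shuffleOnes (i - j) f else 0 := by
  induction j with
  | zero => simp
  | succ j ih =>
    rw [pow_succ', Module.End.mul_apply, ih]
    split_ifs with h1 h2 h2
    · rw [show i - j = i - (j + 1) + 1 by omega, stripE1_shuffleOnes, stripE1_of_mem_H0 hf,
        map_zero, zero_add]
    · rw [show i - j = 0 by omega, shuffleOnes_zero, stripE1_of_mem_H0 hf]
    · omega
    · exact map_zero _

/-- An explicit form of the regularization: `∑ⱼ (-1)ʲ (D ʲ f) ш e₁ʲ`, `D` being right division by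
`e₁`. -/
def regTrunc (L : ℕ) : NCPoly →ₗ[ℚ] NCPoly :=
  ∑ j ∈ range L, (-1 : ℚ) ^ j • shuffleOnes j ∘ₗ (stripE1 ^ j)

/-- Since right division by e₁ kills 𝔥⁰, its j-th iterate turns f ш e₁ⁱ into f ш e₁^(i-j). Shuffling
back with e₁ʲ gives the coefficients (-1)^j C(i, j), whose sum vanishes for i > 0. -/
theorem regTrunc_shuffleOnes {f : NCPoly} (hf : f ∈ H0) {i L : ℕ} (hi : i < L) :
    regTrunc L (shuffleOnes i f) = if i = 0 then f else 0 := by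
  simp only [regTrunc, LinearMap.sum_apply, LinearMap.smul_apply, LinearMap.comp_apply,
    stripE1_iterate_shuffleOnes hf]
  have h : ∀ j ∈ range L, (-1 : ℚ) ^ j • shuffleOnes j (if j ≤ i then shuffleOnes (i - j) f else 0) =
      if j ∈ range (i + 1) then ((-1 : ℚ) ^ j * (i.choose j : ℚ)) • shuffleOnes i f else 0 := by
    intro j _
    simp only [mem_range_succ_iff]
    split_ifs with hj
    · rw [shuffleOnes_shuffleOnes, smul_smul, Nat.add_sub_cancel' hj]
    · simp
  rw [sum_congr rfl h, sum_ite_mem, inter_eq_right.2 (range_subset_range.2 hi)]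
  split_ifs with h0
  · subst h0; simp [shuffleOnes_zero]
  · exact sum_neg_one_pow_choose_smul h0 _

theorem shuffle_e1ShufflePow (f : NCPoly) (i : ℕ) :
    shuffle f (e1ShufflePow i) = (i.factorial : ℚ) • shuffleOnes i f := by
  rw [shuffleOnes_apply, shuffle_eq, shuffle_eq, e1ShufflePow_eq, map_smul]

theorem regTrunc_of_decomposition (c : ℕ →₀ H0) {L : ℕ} (hL : ∀ i ∈ c.support, i < L) :
    regTrunc L (c.sum fun i ci => shuffle (ci : NCPoly) (e1ShufflePow i)) = (c 0 : NCPoly) := by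
  rw [Finsupp.sum, map_sum]
  have h : ∀ i ∈ c.support, regTrunc L (shuffle (c i : NCPoly) (e1ShufflePow i)) =
      if i = 0 then (c 0 : NCPoly) else 0 := by
    intro i hi
    rw [shuffle_e1ShufflePow, map_smul, regTrunc_shuffleOnes (c i).2 (hL i hi)]
    split_ifs with h
    · subst h; simp
    · simp
  rw [sum_congr rfl h, sum_ite_eq']
  split_ifs with h
  · rfl
  · rw [Finsupp.notMem_support_iff.1 h]; rfl

/-- The operator `regTrunc` recovers c₀ from any decomposition of f. Hence the choice made in
`regSh` is forced as soon as one decomposition is exhibited. -/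
theorem IsShuffleReg.unique {f : NCPoly} {g h : H0} (hg : IsShuffleReg f g)
    (hh : IsShuffleReg f h) : g = h := by
  obtain ⟨c, rfl, hc⟩ := hg
  obtain ⟨d, rfl, hd⟩ := hh
  apply Subtype.ext
  set L := (c.support ∪ d.support).sup id + 1
  have hL : ∀ i ∈ c.support ∪ d.support, i < L := fun i hi =>
    Nat.lt_succ_of_le (le_sup (f := id) hi)
  rw [← regTrunc_of_decomposition c (fun i hi => hL i (mem_union_left _ hi)), ← hc,
    ← regTrunc_of_decomposition d (fun i hi => hL i (mem_union_right _ hi)), ← hd]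

theorem IsShuffleReg.regSh_eq {f : NCPoly} {g : H0} (hg : IsShuffleReg f g) : regSh f = g :=
  (Classical.epsilon_spec (p := IsShuffleReg f) ⟨g, hg⟩ : IsShuffleReg f (regSh f)).unique hg

theorem isShuffleReg_sum (n : ℕ) (c : ℕ → H0) :
    IsShuffleReg (∑ i ∈ range (n + 1), shuffleOnes i (c i : NCPoly)) (c 0) := by
  -- The i-th shuffle power of e₁ is i! times the word e₁ⁱ.
  refine ⟨∑ i ∈ range (n + 1), Finsupp.single i ((i.factorial : ℚ)⁻¹ • c i), ?_, ?_⟩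
  · simp [Finsupp.finsetSum_apply, Finsupp.single_apply]
  · rw [← Finsupp.sum_finsetSum_index (by simp [shuffle_eq]) (by simp [shuffle_eq])]
    refine sum_congr rfl fun i _ => ?_
    rw [Finsupp.sum_single_index (by simp [shuffle_eq]), shuffle_e1ShufflePow,
      Submodule.coe_smul, map_smul, smul_smul, mul_inv_cancel₀ (by positivity), one_smul]

end

/-! ### Asymptotics of truncated multiple zeta values -/

noncomputable section

open Filter Topology

theorem wordPoly_concat (w : Word) (x : Letter) :
    wordPoly (w ++ [x]) = appendLetter x (wordPoly w) := by simp

theorem liMultiplicative_wordPoly {w : Word} (hw : w ≠ [] → w.head? = some Letter.e1) :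
    LiMultiplicative (wordPoly w) := by
  induction w using List.reverseRecOn with
  | nil => exact liMultiplicative_nil
  | append_singleton w x ih =>
    have hw' : w ≠ [] → w.head? = some Letter.e1 := by
      intro h
      obtain ⟨y, v, rfl⟩ := List.exists_cons_of_ne_nil h
      simpa using hw
    rw [wordPoly_concat]
    refine (ih hw').append ?_
    rintro rfl
    have hne : w ≠ [] := by rintro rfl; simp at hw
    rw [← PowerSeries.coeff_zero_eq_constantCoeff_apply, coeff_liPoly_wordPoly, liCoeff_zero hne]

/-- The span of the words beginning with `e₁`. -/
def beginE1 : Submodule ℚ NCPoly := Finsupp.supported ℚ ℚ {w | w.head? = some Letter.e1}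

theorem beginE1_induction {p : NCPoly → Prop} (h0 : p 0) (hadd : ∀ f g, p f → p g → p (f + g))
    (hsmul : ∀ (c : ℚ) f, p f → p (c • f))
    (hw : ∀ w : Word, w.head? = some Letter.e1 → p (wordPoly w)) {f : NCPoly} (hf : f ∈ beginE1) :
    p f := by
  rw [beginE1, Finsupp.supported_eq_span_single] at hf
  induction hf using Submodule.span_induction with
  | mem x hx => obtain ⟨w, h, rfl⟩ := hx; exact hw w h
  | zero => exact h0
  | add x y _ _ hx hy => exact hadd x y hx hy
  | smul c x _ hx => exact hsmul c x hx

theorem appendLetter_mem_beginE1 (x : Letter) {f : NCPoly} (hf : f ∈ beginE1) :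
    appendLetter x f ∈ beginE1 := by
  refine beginE1_induction (p := fun f => appendLetter x f ∈ beginE1) ?_ ?_ ?_ ?_ hf
  · simp
  · intro f g hf hg; rw [map_add]; exact add_mem hf hg
  · intro c f hf; rw [map_smul]; exact Submodule.smul_mem _ c hf
  · intro w hw
    rw [appendLetter_single]
    refine Finsupp.single_mem_supported ℚ 1 ?_
    obtain ⟨v, rfl⟩ : ∃ v, w = Letter.e1 :: v := by
      cases w <;> simp_all
    simp

theorem appendLetter_e0_mem_H0 {f : NCPoly} (hf : f ∈ beginE1) :
    appendLetter Letter.e0 f ∈ H0 := by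
  refine beginE1_induction (p := fun f => appendLetter Letter.e0 f ∈ H0) ?_ ?_ ?_ ?_ hf
  · simp
  · intro f g hf hg; rw [map_add]; exact add_mem hf hg
  · intro c f hf; rw [map_smul]; exact Submodule.smul_mem _ c hf
  · intro w hw
    rw [appendLetter_single]
    refine wordPoly_mem_H0 (Or.inr ⟨?_, by simp⟩)
    obtain ⟨v, rfl⟩ : ∃ v, w = Letter.e1 :: v := by
      cases w <;> simp_all
    simp

theorem shuffleOnes_mem_beginE1 {w : Word} (hw : w.head? = some Letter.e1) (i : ℕ) :
    shuffleOnes i (wordPoly w) ∈ beginE1 := by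
  have hone : ∀ i, wordPoly (onesWord (i + 1)) ∈ beginE1 := fun i =>
    Finsupp.single_mem_supported ℚ 1 (by simp [List.replicate_succ])
  induction w using List.reverseRecOn generalizing i with
  | nil => simp at hw
  | append_singleton w x ih =>
    rcases eq_or_ne w [] with rfl | hne
    · obtain rfl : x = Letter.e1 := by simpa using hw
      change shuffleOnes i (wordPoly (onesWord 1)) ∈ beginE1
      rw [shuffleOnes_onesWord]
      exact Submodule.smul_mem _ _ (hone i)
    · have hw' : w.head? = some Letter.e1 := by
        obtain ⟨y, v, rfl⟩ := List.exists_cons_of_ne_nil hne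
        simpa using hw
      induction i with
      | zero => rw [shuffleOnes_zero]; exact Finsupp.single_mem_supported ℚ 1 hw
      | succ i ihi =>
        rw [wordPoly_concat] at ihi ⊢
        rw [shuffleOnes_appendLetter]
        exact add_mem (appendLetter_mem_beginE1 x (ih hw' _)) (appendLetter_mem_beginE1 _ ihi)

theorem wordPoly_append_onesWord (w : Word) (a : ℕ) :
    wordPoly (w ++ onesWord a) = (appendLetter Letter.e1)^[a] (wordPoly w) := by
  induction a with
  | zero => simp
  | succ a ih =>
    rw [Function.iterate_succ_apply', ← ih, appendLetter_single]
    simp [onesWord, List.replicate_succ']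

/-- The coefficients of the decomposition of `x e₀ e₁ᵃ` into products of elements of `𝔥⁰` and
powers of `e₁`. -/
def regCoeff (x : Word) (j : ℕ) : NCPoly :=
  (-1 : ℚ) ^ j • appendLetter Letter.e0 (shuffleOnes j (wordPoly x))

theorem regCoeff_mem_H0 {x : Word} (hx : x.head? = some Letter.e1) (j : ℕ) : regCoeff x j ∈ H0 :=
  Submodule.smul_mem _ _ (appendLetter_e0_mem_H0 (shuffleOnes_mem_beginE1 hx j))

theorem wordPoly_eq_sum_regCoeff (x : Word) (a : ℕ) :
    wordPoly (x ++ [Letter.e0] ++ onesWord a) =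
      ∑ i ∈ range (a + 1), shuffleOnes i (regCoeff x (a - i)) := by
  rw [wordPoly_append_onesWord, wordPoly_concat, appendLetter_iterate_eq_sum]
  exact sum_congr rfl fun i _ => by rw [regCoeff, map_smul]

theorem zetaSh_eq_regCoeff {k : Index} {x : Word} {a : ℕ} (hx : x.head? = some Letter.e1)
    (hk : indexWord k = x ++ [Letter.e0] ++ onesWord a) : zetaSh k = zetaPoly (regCoeff x a) := by
  have h := isShuffleReg_sum a fun i => ⟨regCoeff x (a - i), regCoeff_mem_H0 hx _⟩
  rw [← wordPoly_eq_sum_regCoeff, ← hk] at h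
  rw [zetaSh, h.regSh_eq, evalZ_apply, Nat.sub_zero]

/-- The word e₁ᵃ is its own decomposition, concentrated in degree a, so its constant term is 0 for a
> 0. -/
theorem zetaSh_replicate_one (a : ℕ) : zetaSh (List.replicate a 1) = if a = 0 then 1 else 0 := by
  have h := isShuffleReg_sum a fun i =>
    if i = a then ⟨wordPoly [], wordPoly_mem_H0 (Or.inl rfl)⟩ else 0
  have e : ∑ i ∈ range (a + 1), shuffleOnes i (((if i = a then
      ⟨wordPoly [], wordPoly_mem_H0 (Or.inl rfl)⟩ else 0 : H0) : NCPoly)) = wordPoly (onesWord a) := by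
    rw [sum_range_succ, sum_eq_zero, if_pos rfl, shuffleOnes_nil, zero_add]
    intro i hi
    rw [if_neg (mem_range.1 hi).ne, Submodule.coe_zero, map_zero]
  rw [e, ← indexWord_replicate_one] at h
  rw [zetaSh, h.regSh_eq, evalZ_apply]
  rcases eq_or_ne a 0 with rfl | ha
  · simp only [if_true]
    rw [show wordPoly [] = wordPoly (indexWord []) from rfl, zetaPoly_indexWord]
    apply Subtype.ext
    have hadm : Admissible [] := by intro m hm; simp at hm
    rw [coe_zeta hadm]
    change mzv [] = 1
    exact mzv_eq_of_tendsto (by simpa only [mzvTrunc_nil] using tendsto_const_nhds)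
  · rw [if_neg ha.symm, if_neg ha, Submodule.coe_zero, map_zero]

/-- The regularization divisor: `e_m(1, 1/2, …, 1/(M-1))` at `{1}ᵐ`, and zero elsewhere. -/
def onesTrunc (M : ℕ) (k : Index) : ℝ := if ∀ m ∈ k, m = 1 then mzvTrunc M k else 0

theorem onesTrunc_replicate (M i : ℕ) :
    onesTrunc M (List.replicate i 1) = mzvTrunc M (List.replicate i 1) := by
  rw [onesTrunc, if_pos fun m hm => List.eq_of_mem_replicate hm]

theorem exists_eq_append_replicate_one (k : Index) :
    (∃ a, k = List.replicate a 1) ∨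
      ∃ (l : Index) (m : ℕ+) (a : ℕ), 2 ≤ m ∧ k = l ++ [m] ++ List.replicate a 1 := by
  induction k using List.reverseRecOn with
  | nil => exact Or.inl ⟨0, rfl⟩
  | append_singleton k m ih =>
    rcases eq_or_ne m 1 with rfl | hm
    · rcases ih with ⟨a, rfl⟩ | ⟨l, m, a, hm, rfl⟩
      · exact Or.inl ⟨a + 1, by rw [List.replicate_succ']⟩
      · exact Or.inr ⟨l, m, a + 1, hm, by rw [List.replicate_succ', List.append_assoc]⟩
    · refine Or.inr ⟨k, m, 0, ?_, by simp⟩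
      have h1 : (1 : ℕ+) < m := lt_of_le_of_ne one_le (Ne.symm hm)
      exact PNat.add_one_le_iff.2 h1

/-- A cut to the left of the entry `m ≥ 2` leaves it in the suffix, where `onesTrunc` vanishes. Only
cuts within the trailing ones count. -/
theorem conv_onesTrunc (f : Index → ℝ) (M : ℕ) (l : Index) {m : ℕ+} (hm : 2 ≤ m) (a : ℕ) :
    conv f (onesTrunc M) (l ++ [m] ++ List.replicate a 1) =
      ∑ i ∈ range (a + 1), f (l ++ [m] ++ List.replicate (a - i) 1) *
        mzvTrunc M (List.replicate i 1) := by
  rw [conv_eq_sum, List.length_append, List.length_replicate, add_assoc, sum_range_add,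
    sum_eq_zero, zero_add, ← sum_range_reflect]
  · refine sum_congr rfl fun i hi => ?_
    have hi' := mem_range_succ_iff.1 hi
    rw [show a + 1 - 1 - i = a - i by omega, List.take_length_add_append,
      List.drop_length_add_append, List.take_replicate, List.drop_replicate,
      min_eq_left (by omega), show a - (a - i) = i by omega, onesTrunc_replicate]
  · intro i hi
    have hi' := mem_range.1 hi
    have hne : ¬ ∀ n ∈ (l ++ [m] ++ List.replicate a 1).drop i, n = 1 := by
      intro h
      have := h m (by
        rw [List.drop_append_of_le_length hi'.le]
        apply List.mem_append_left
        rw [List.drop_append_of_le_length (by simp at hi'; omega)]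
        simp)
      subst this
      exact absurd hm (by decide)
    rw [onesTrunc, if_neg hne, mul_zero]

theorem indexWord_append_replicate (l : Index) {m : ℕ+} (hm : 2 ≤ m) (a : ℕ) :
    ∃ x : Word, x.head? = some Letter.e1 ∧
      indexWord (l ++ [m] ++ List.replicate a 1) = x ++ [Letter.e0] ++ onesWord a := by
  have hadm : Admissible (l ++ [m]) := by intro n hn; simp at hn; rwa [← hn]
  obtain ⟨x, hx, h⟩ := hadm.exists_indexWord_eq (by simp)
  exact ⟨x, hx, by rw [indexWord_append, h, indexWord_replicate_one]⟩

/-- The asymptotic expansion of truncated multiple zeta values. -/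
theorem mzvTrunc_asymptotic (k : Index) :
    (fun M => mzvTrunc M k - conv (fun l => (zetaSh l : ℝ)) (onesTrunc M) k) =O[atTop]
      fun M => (fourthRoot M ^ 2)⁻¹ := by
  rcases exists_eq_append_replicate_one k with ⟨a, rfl⟩ | ⟨l, m, a, hm, rfl⟩
  · have h0 : ∀ M, mzvTrunc M (List.replicate a 1) -
        conv (fun l => (zetaSh l : ℝ)) (onesTrunc M) (List.replicate a 1) = 0 := by
      intro M
      rw [conv_eq_sum, sum_range_succ', sum_eq_zero, zero_add, List.take_zero, List.drop_zero,
        onesTrunc_replicate, show zetaSh [] = 1 from zetaSh_replicate_one 0]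
      · simp
      · intro i hi
        rw [List.length_replicate] at hi
        have hi' := mem_range.1 hi
        rw [List.take_replicate, zetaSh_replicate_one, if_neg (by omega)]
        simp
    simp only [h0]
    exact Asymptotics.isBigO_zero _ _
  · have hfun : ∀ x : Word, x.head? = some Letter.e1 →
        indexWord (l ++ [m] ++ List.replicate a 1) = x ++ [Letter.e0] ++ onesWord a →
        ∀ j, zetaSh (l ++ [m] ++ List.replicate j 1) = zetaPoly (regCoeff x j) := by
      intro x hx h j
      refine zetaSh_eq_regCoeff hx ?_
      rw [indexWord_append, indexWord_replicate_one] at h ⊢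
      rw [List.append_cancel_right h]
    obtain ⟨x, hx, hk⟩ := indexWord_append_replicate l hm a
    have hz := hfun x hx hk
    have hmul : ∀ j, LiMultiplicative (regCoeff x j) := by
      intro j i
      have h1 := (liMultiplicative_wordPoly (w := x) fun _ => hx).shuffleOnes j
      have h2 : LiMultiplicative (appendLetter Letter.e0 (shuffleOnes j (wordPoly x))) := by
        refine h1.append fun _ => ?_
        have hne : x ≠ [] := by rintro rfl; simp at hx
        rw [liMultiplicative_wordPoly fun _ => hx, map_mul,
          ← PowerSeries.coeff_zero_eq_constantCoeff_apply, coeff_liPoly_wordPoly,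
          liCoeff_zero hne, zero_mul]
      rw [regCoeff, map_smul, map_smul, map_smul, h2, smul_mul_assoc]
    -- Multiplicativity of polylogarithms writes the series of the word as the sum of the products
    -- Li(cᵢ) · Li(e₁ⁱ), where cᵢ is `regCoeff x (a - i)`. The partial sums on the left are exactly
    -- the error terms bounded by `TailBound.mul_onesWord`.
    have hsum : ∀ M, 1 ≤ M →
        ∑ i ∈ range (a + 1), (∑ n ∈ range M, PowerSeries.coeff n (liPoly (regCoeff x (a - i)) *
          liPoly (wordPoly (onesWord i))) - zetaPoly (regCoeff x (a - i)) * onesSum M i) =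
        mzvTrunc M (l ++ [m] ++ List.replicate a 1) - conv (fun l => (zetaSh l : ℝ)) (onesTrunc M)
          (l ++ [m] ++ List.replicate a 1) := by
      intro M hM
      rw [sum_sub_distrib, conv_onesTrunc _ _ _ hm]
      congr 1
      · rw [← sum_liCoeff_indexWord _ hM, hk, sum_comm]
        refine sum_congr rfl fun n _ => ?_
        rw [← coeff_liPoly_wordPoly, wordPoly_eq_sum_regCoeff, map_sum, map_sum]
        exact sum_congr rfl fun i _ => by rw [hmul]
      · exact sum_congr rfl fun i _ => by rw [hz, onesSum_eq hM]
    refine Asymptotics.IsBigO.congr' (Asymptotics.IsBigO.sum (s := range (a + 1)) fun i _ =>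
      (tailBound_of_mem_H0 (regCoeff_mem_H0 hx (a - i))).mul_onesWord i)
      (eventually_atTop.2 ⟨1, fun M hM => ?_⟩) EventuallyEq.rfl
    rw [Finset.sum_apply]
    exact hsum M hM

theorem mzvTrunc_isBigO (k : Index) : (fun M => mzvTrunc M k) =O[atTop] fourthRoot := by
  rcases eq_or_ne k [] with rfl | hne
  · simp only [mzvTrunc_nil]
    refine Asymptotics.IsBigO.of_bound 1 (eventually_atTop.2 ⟨1, fun M hM => ?_⟩)
    have := one_le_fourthRoot hM
    rw [norm_one, one_mul, Real.norm_of_nonneg (fourthRoot_nonneg M)]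
    exact this
  · have hw : (indexWord k).head? = some Letter.e1 := by
      obtain ⟨m, l, rfl⟩ := List.exists_cons_of_ne_nil hne
      simp [indexWord]
    obtain ⟨C, hC, h⟩ := exists_liCoeff_le hw
    refine Asymptotics.IsBigO.of_bound (4 * C) (eventually_atTop.2 ⟨1, fun M hM => ?_⟩)
    rw [← sum_liCoeff_indexWord k hM, Real.norm_of_nonneg (fourthRoot_nonneg M),
      Real.norm_of_nonneg (sum_nonneg fun n _ => liCoeff_nonneg _ _)]
    exact sum_liCoeff_le hC h M

end

/-! ### The limit of symmetric truncated sums -/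

noncomputable section

open Filter Topology

theorem nestedSum_map_neg {R : Type*} [CommRing R] (ys : List R) (k : Index) :
    nestedSum (ys.map fun y => -y) k = (-1) ^ wt k * nestedSum ys k := by
  induction ys generalizing k with
  | nil => cases k <;> simp [nestedSum]
  | cons y ys ih =>
    cases k with
    | nil => simp
    | cons k ks =>
      rw [List.map_cons, nestedSum_cons, nestedSum_cons, ih, ih, wt_cons, pow_add, neg_pow]
      ring

theorem wt_sign_append {R : Type*} [CommRing R] (k l : Index) :
    (-1 : R) ^ wt (k ++ l) = (-1) ^ wt k * (-1) ^ wt l := by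
  rw [wt_append, pow_add]

theorem mzvTrunc_singleton (k : ℕ+) (M : ℕ) :
    mzvTrunc M [k] = ∑ n ∈ Ico 1 M, ((n : ℝ)⁻¹) ^ (k : ℕ) :=
  nestedSum_initialList_singleton _ _ _

theorem admissible_singleton {k : ℕ+} (hk : 2 ≤ k) : Admissible [k] := by
  intro m hm
  simp only [List.getLast?_singleton, Option.mem_def, Option.some.injEq] at hm
  rwa [← hm]

/-- Euler's evaluation of the zeta values at even integers, modulo `ζ(2)`. -/
theorem zeta_even_mem {k : ℕ+} (hk : Even (k : ℕ)) : zeta [k] ∈ Ideal.span {zeta [2]} := by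
  have hval : ∀ (k : ℕ+) (j : ℕ), j ≠ 0 → (k : ℕ) = 2 * j → mzv [k] =
      (-1 : ℝ) ^ (j + 1) * 2 ^ (2 * j - 1) * Real.pi ^ (2 * j) * bernoulli (2 * j) /
        (2 * j).factorial := by
    intro k j hj hk
    apply mzv_eq_of_tendsto
    have h := (hasSum_zeta_nat hj).tendsto_sum_nat
    refine h.congr' (eventually_atTop.2 ⟨1, fun M hM => ?_⟩)
    beta_reduce
    rw [mzvTrunc_singleton, range_eq_Ico, sum_eq_sum_Ico_succ_bot (by omega)]
    have : (1 : ℝ) / ((0 : ℕ) : ℝ) ^ (2 * j) = 0 := by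
      rw [Nat.cast_zero, zero_pow (by omega), div_zero]
    rw [this, zero_add, hk]
    exact sum_congr rfl fun n _ => by simp
  obtain ⟨j, hj⟩ := hk
  rw [← two_mul] at hj
  have hj0 : j ≠ 0 := by rintro rfl; exact k.ne_zero hj
  have h2 : mzv [2] = Real.pi ^ 2 / 6 := by
    rw [hval 2 1 one_ne_zero rfl]
    norm_num [bernoulli_two, Nat.factorial]
    ring
  set c : ℚ := (-1) ^ (j + 1) * 2 ^ (2 * j - 1) * 6 ^ j * bernoulli (2 * j) / (2 * j).factorial
  have hadm : Admissible [k] :=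
    admissible_singleton (PNat.coe_le_coe _ _ |>.1 (show 2 ≤ (k : ℕ) by omega))
  have heq : zeta [k] = algebraMap ℚ ZAlg c * zeta [2] ^ j := by
    apply Subtype.ext
    rw [coe_zeta hadm, hval k j hj0 hj]
    have h2' : ((zeta [2] : ZAlg) : ℝ) = Real.pi ^ 2 / 6 := by
      rw [coe_zeta (admissible_singleton le_rfl), h2]
    have hc : ((algebraMap ℚ ZAlg c : ZAlg) : ℝ) = (c : ℝ) := rfl
    rw [MulMemClass.coe_mul, SubmonoidClass.coe_pow, hc, h2', div_pow, ← pow_mul]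
    simp only [c]
    push_cast
    field_simp
  rw [heq, ← Nat.succ_pred_eq_of_ne_zero hj0, pow_succ, ← mul_assoc]
  exact Ideal.mul_mem_left _ _ (Ideal.subset_span rfl)

/-- The elementary symmetric functions of `±1, ±1/2, …, ±1/(M-1)`. -/
def symTrunc (M : ℕ) (k : Index) : ℝ :=
  conv (onesTrunc M) (fun l => (-1) ^ wt l * onesTrunc M l) k

theorem symTrunc_replicate (M i : ℕ) : symTrunc M (List.replicate i 1) =
    nestedSum (initialList (fun n => (n : ℝ)⁻¹) M ++
      (initialList (fun n => (n : ℝ)⁻¹) M).map fun y => -y) (List.replicate i 1) := by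
  rw [symTrunc, nestedSum_append, conv_replicate, conv_replicate]
  refine sum_congr rfl fun j _ => ?_
  rw [onesTrunc_replicate, onesTrunc_replicate, nestedSum_map_neg]
  rfl

theorem symTrunc_of_not {M : ℕ} {k : Index} (hk : ¬ ∀ m ∈ k, m = 1) : symTrunc M k = 0 := by
  rw [symTrunc, conv_eq_sum]
  refine sum_eq_zero fun i _ => ?_
  by_cases h1 : ∀ m ∈ k.take i, m = 1
  · have h2 : ¬ ∀ m ∈ k.drop i, m = 1 := by
      intro h2
      apply hk
      intro m hm
      rw [← List.take_append_drop i k, List.mem_append] at hm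
      exact hm.elim (h1 m) (h2 m)
    rw [onesTrunc, onesTrunc, if_neg h2]; simp
  · rw [onesTrunc, if_neg h1, zero_mul]

/-- Newton's identities for the variables ±1/n: the odd power sums cancel, and the even ones tend to
2ζ(2r), which lies in the ideal generated by ζ(2). -/
theorem exists_tendsto_symTrunc_replicate (i : ℕ) : ∃ z : ZAlg,
    (i = 0 → z = 1) ∧ (i ≠ 0 → z ∈ Ideal.span {zeta [2]}) ∧
      Tendsto (fun M => symTrunc M (List.replicate i 1)) atTop (𝓝 (z : ℝ)) := by
  have hp : ∀ j : ℕ, ∃ z ∈ Ideal.span {zeta [2]}, Tendsto (fun M =>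
      ((initialList (fun n => (n : ℝ)⁻¹) M ++
        (initialList (fun n => (n : ℝ)⁻¹) M).map fun y => -y).map (· ^ (j + 1))).sum)
      atTop (𝓝 ((z : ZAlg) : ℝ)) := by
    intro j
    have hs : ∀ M, ((initialList (fun n => (n : ℝ)⁻¹) M ++
        (initialList (fun n => (n : ℝ)⁻¹) M).map fun y => -y).map (· ^ (j + 1))).sum =
        (1 + (-1) ^ (j + 1)) * mzvTrunc M [j.succPNat] := by
      intro M
      rw [List.map_append, List.sum_append, List.map_map, sum_map_initialList,
        sum_map_initialList, mzvTrunc_singleton, add_mul, mul_sum, mul_sum]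
      simp only [Function.comp_apply, neg_pow (_ : ℝ)⁻¹, one_mul, Nat.succPNat_coe]
    simp only [hs]
    rcases Nat.even_or_odd (j + 1) with h | h
    · have hle : (2 : ℕ+) ≤ j.succPNat := by
        rw [← PNat.coe_le_coe]
        change 2 ≤ j + 1
        obtain ⟨r, hr⟩ := h; omega
      refine ⟨2 * zeta [j.succPNat], Ideal.mul_mem_left _ _ (zeta_even_mem h), ?_⟩
      rw [h.neg_one_pow]
      push_cast
      rw [coe_zeta (admissible_singleton hle)]
      norm_num
      exact (admissible_singleton hle).tendsto_mzvTrunc.const_mul 2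
    · refine ⟨0, zero_mem _, ?_⟩
      rw [h.neg_one_pow]
      simp
  induction i using Nat.strong_induction_on with
  | _ i ih =>
    rcases eq_or_ne i 0 with rfl | hi
    · refine ⟨1, fun _ => rfl, fun h => absurd rfl h, ?_⟩
      have h1 : ∀ M, symTrunc M (List.replicate 0 1) = 1 := fun M => by
        rw [symTrunc_replicate, List.replicate_zero, nestedSum_nil_right]
      simp only [h1]
      exact tendsto_const_nhds
    · choose p hpm hpt using hp
      choose! c hc0 hcm hct using ih
      refine ⟨algebraMap ℚ ZAlg (i : ℚ)⁻¹ * ∑ j ∈ range i, (-1) ^ j * c (i - 1 - j) * p j,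
        fun h => absurd h hi, fun _ => Ideal.mul_mem_left _ _ (sum_mem fun j _ =>
          Ideal.mul_mem_left _ _ (hpm j)), ?_⟩
      have hrec : ∀ M, symTrunc M (List.replicate i 1) = (i : ℝ)⁻¹ * ∑ j ∈ range i, (-1) ^ j *
          symTrunc M (List.replicate (i - 1 - j) 1) *
          ((initialList (fun n => (n : ℝ)⁻¹) M ++
            (initialList (fun n => (n : ℝ)⁻¹) M).map fun y => -y).map (· ^ (j + 1))).sum := by
        intro M
        simp only [symTrunc_replicate]
        rw [← newton_nestedSum, inv_mul_cancel_left₀ (by exact_mod_cast hi)]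
      simp only [hrec]
      have hcoe : ((algebraMap ℚ ZAlg (i : ℚ)⁻¹ : ZAlg) : ℝ) = (i : ℝ)⁻¹ := by
        rw [show ((algebraMap ℚ ZAlg (i : ℚ)⁻¹ : ZAlg) : ℝ) = (((i : ℚ)⁻¹ : ℚ) : ℝ) from rfl]
        push_cast; rfl
      rw [MulMemClass.coe_mul, hcoe]
      push_cast
      refine Tendsto.const_mul _ (tendsto_finsetSum _ fun j hj => ?_)
      have hj' := mem_range.1 hj
      exact ((hct _ (by omega)).const_mul _).mul (hpt j)

theorem exists_tendsto_symTrunc : ∃ c : Index → ZAlg, c [] = 1 ∧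
    (∀ k, k ≠ [] → c k ∈ Ideal.span {zeta [2]}) ∧
    ∀ k, Tendsto (fun M => symTrunc M k) atTop (𝓝 (c k : ℝ)) := by
  have h : ∀ k : Index, ∃ z : ZAlg, (k = [] → z = 1) ∧ (k ≠ [] → z ∈ Ideal.span {zeta [2]}) ∧
      Tendsto (fun M => symTrunc M k) atTop (𝓝 (z : ℝ)) := by
    intro k
    by_cases hk : ∀ m ∈ k, m = 1
    · rw [List.eq_replicate_of_mem hk]
      obtain ⟨z, h0, h1, h2⟩ := exists_tendsto_symTrunc_replicate k.length
      exact ⟨z, fun h => h0 (by simpa using h), fun h => h1 (by simpa using h), h2⟩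
    · refine ⟨0, fun h => ?_, fun _ => zero_mem _, ?_⟩
      · subst h; simp at hk
      · simp only [symTrunc_of_not hk]; exact tendsto_const_nhds
  choose c h0 h1 h2 using h
  exact ⟨c, h0 [] rfl, h1, h2⟩

/-- Raising an exponent produces an entry greater than 1, where `onesTrunc` is zero. -/
theorem indexDeriv_onesTrunc (M : ℕ) (k : Index) : indexDeriv (onesTrunc M) k = 0 := by
  have key : ∀ k p : Index, indexDeriv (fun l => onesTrunc M (p ++ l)) k = 0 := by
    intro k
    induction k with
    | nil => intro p; rfl
    | cons k ks ih =>
      intro p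
      have h := ih (p ++ [k])
      simp only [List.append_assoc, List.singleton_append] at h
      rw [indexDeriv, h, onesTrunc, if_neg, mul_zero, add_zero]
      intro hall
      have := hall (k + 1) (by simp)
      have h1 : (k : ℕ) + 1 = 1 := by exact_mod_cast congrArg PNat.val this
      exact k.ne_zero (by omega)
  exact key k []

/-- `F` has the asymptotic expansion with regularized values `g`. -/
structure Expands (F : ℕ → Index → ℝ) (g : Index → ℝ) : Prop where
  asymptotic : ∀ k, (fun M => F M k - conv g (onesTrunc M) k) =O[atTop]
    fun M => (fourthRoot M ^ 2)⁻¹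
  isBigO : ∀ k, (fun M => F M k) =O[atTop] fourthRoot

theorem expands_mzvTrunc : Expands mzvTrunc fun l => (zetaSh l : ℝ) :=
  ⟨mzvTrunc_asymptotic, mzvTrunc_isBigO⟩

theorem indexDeriv_isBigO {F : ℕ → Index → ℝ} {g : ℕ → ℝ}
    (h : ∀ k, (fun M => F M k) =O[atTop] g) (k : Index) :
    (fun M => indexDeriv (F M) k) =O[atTop] g := by
  induction k generalizing F with
  | nil => exact Asymptotics.isBigO_zero _ _
  | cons k ks ih =>
    simp only [indexDeriv]
    exact ((h _).const_mul_left _).add (ih fun l => h (k :: l))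

/-- By the Leibniz rule for the convolution the derivation falls on the regularized values alone. -/
theorem Expands.indexDeriv {F : ℕ → Index → ℝ} {g : Index → ℝ} (h : Expands F g) :
    Expands (fun M => indexDeriv (F M)) (indexDeriv g) := by
  refine ⟨fun k => ?_, indexDeriv_isBigO h.isBigO⟩
  refine (indexDeriv_isBigO h.asymptotic k).congr_left fun M => ?_
  have h1 := indexDeriv_add (F M) (fun l => -1 * conv g (onesTrunc M) l) k
  rw [indexDeriv_mul_left, indexDeriv_conv,
    conv_congr (fun _ => rfl) (indexDeriv_onesTrunc M) (f' := g)] at h1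
  have h0 : conv g (fun _ => 0) k = 0 := by simp [conv_eq_sum]
  rw [h0, add_zero] at h1
  simp only [neg_one_mul, ← sub_eq_add_neg] at h1
  exact h1

theorem tendsto_conv {F G : ℕ → Index → ℝ} {f g : Index → ℝ}
    (hF : ∀ k, Tendsto (fun M => F M k) atTop (𝓝 (f k)))
    (hG : ∀ k, Tendsto (fun M => G M k) atTop (𝓝 (g k))) (k : Index) :
    Tendsto (fun M => conv (F M) (G M) k) atTop (𝓝 (conv f g k)) := by
  simp only [conv_eq_sum]
  exact tendsto_finsetSum _ fun i _ => (hF _).mul (hG _)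

theorem onesTrunc_reverse (M : ℕ) (k : Index) : onesTrunc M k.reverse = onesTrunc M k := by
  by_cases h : ∀ m ∈ k, m = 1
  · rw [List.eq_replicate_of_mem h, List.reverse_replicate]
  · rw [onesTrunc, onesTrunc, if_neg h, if_neg (by simpa using h)]

/-- Reversal makes the divergent factors `onesTrunc` of both sides adjacent, and together they form
the convergent `symTrunc`. The errors are O(M^(-1/2)) against growth O(M^(1/4)), so they disappear
in the limit. -/
theorem Expands.tendsto_conv_reverse {F G : ℕ → Index → ℝ} {f g : Index → ℝ} {c : Index → ℝ}
    (hF : Expands F f) (hG : Expands G g)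
    (hc : ∀ k, Tendsto (fun M => symTrunc M k) atTop (𝓝 (c k))) (k : Index) :
    Tendsto (fun M => conv (F M) (fun l => (-1) ^ wt l * G M l.reverse) k) atTop
      (𝓝 (conv f (conv c fun l => (-1) ^ wt l * g l.reverse) k)) := by
  have hmain : ∀ M, conv (conv f (onesTrunc M))
      (fun l => (-1) ^ wt l * conv g (onesTrunc M) l.reverse) k =
      conv f (conv (symTrunc M) fun l => (-1) ^ wt l * g l.reverse) k := by
    intro M
    rw [conv_assoc]
    refine conv_congr (fun _ => rfl) (fun l => ?_) k
    have hs : symTrunc M = conv (onesTrunc M) (fun l => (-1) ^ wt l * onesTrunc M l) := rfl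
    rw [hs, conv_assoc]
    refine conv_congr (fun _ => rfl) (fun l => ?_) l
    rw [conv_reverse, conv_twist (fun l => (-1) ^ wt l) wt_sign_append]
    simp only [onesTrunc_reverse]
  have hlim : Tendsto (fun M => conv (conv f (onesTrunc M))
      (fun l => (-1) ^ wt l * conv g (onesTrunc M) l.reverse) k) atTop
      (𝓝 (conv f (conv c fun l => (-1) ^ wt l * g l.reverse) k)) := by
    simp only [hmain]
    exact tendsto_conv (F := fun _ => f) (fun _ => tendsto_const_nhds)
      (tendsto_conv hc (G := fun _ l => (-1) ^ wt l * g l.reverse) fun _ => tendsto_const_nhds) k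
  have hsmall : (fun M => (fourthRoot M ^ 2)⁻¹) =O[atTop] fourthRoot := by
    refine Asymptotics.IsBigO.of_bound 1 (eventually_atTop.2 ⟨1, fun M hM => ?_⟩)
    have := one_le_fourthRoot hM
    rw [one_mul, Real.norm_of_nonneg (by positivity), Real.norm_of_nonneg (by positivity)]
    exact (inv_le_one_of_one_le₀ (one_le_pow₀ this)).trans this
  have hFmain : ∀ l, (fun M => conv f (onesTrunc M) l) =O[atTop] fourthRoot := fun l =>
    ((hF.isBigO l).sub ((hF.asymptotic l).trans hsmall)).congr_left fun M => by ring
  have hdiff : (fun M => conv (F M) (fun l => (-1) ^ wt l * G M l.reverse) k -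
      conv (conv f (onesTrunc M)) (fun l => (-1) ^ wt l * conv g (onesTrunc M) l.reverse) k)
      =O[atTop] fun M => (fourthRoot M ^ 2)⁻¹ * fourthRoot M := by
    simp only [conv_eq_sum (F _), conv_eq_sum (conv f (onesTrunc _)), ← sum_sub_distrib]
    refine Asymptotics.IsBigO.fun_sum fun i _ => ?_
    have h1 := ((hF.asymptotic (k.take i)).mul
      ((hG.isBigO (k.drop i).reverse).const_mul_left ((-1) ^ wt (k.drop i))))
    have h2 := (((hG.asymptotic (k.drop i).reverse).const_mul_left ((-1) ^ wt (k.drop i))).mul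
      (hFmain (k.take i)))
    exact (h1.add h2).congr_left fun M => by ring
  have hzero : Tendsto (fun M => (fourthRoot M ^ 2)⁻¹ * fourthRoot M) atTop (𝓝 0) := by
    refine (tendsto_inv_fourthRoot_pow (j := 1) one_ne_zero).congr' ?_
    refine eventually_atTop.2 ⟨1, fun M hM => ?_⟩
    have := one_le_fourthRoot hM
    field_simp
  have := (hdiff.trans_tendsto hzero).add hlim
  simpa using this

end

/-! ### `𝒮₂`-multiple zeta values as limits -/

noncomputable section

open Filter Topology TrivSqZeroExt

/-- The ring homomorphism `R[ε] → S` extending `φ` and mapping `ε` to `x`. -/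
def dualEval {R S : Type*} [CommRing R] [CommRing S] (φ : R →+* S) (x : S) (hx : x ^ 2 = 0) :
    DualNumber R →+* S where
  toFun d := φ d.fst + φ d.snd * x
  map_one' := by simp
  map_zero' := by simp
  map_add' a b := by simp; ring
  map_mul' a b := by
    simp only [fst_mul, snd_mul, map_mul, map_add, smul_eq_mul, MulOpposite.smul_eq_mul_unop,
      MulOpposite.unop_op]
    linear_combination -(φ a.snd * φ b.snd) * hx

theorem dualEval_apply {R S : Type*} [CommRing R] [CommRing S] (φ : R →+* S) (x : S)
    (hx : x ^ 2 = 0) (d : DualNumber R) : dualEval φ x hx d = φ d.fst + φ d.snd * x := rfl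

theorem xS_sq : xS 2 ^ 2 = 0 := by
  rw [xS, S.proj, ← map_pow, Ideal.Quotient.eq_zero_iff_mem]
  exact Ideal.subset_span rfl

/-- The structure map `𝒵 → 𝒮₂`. -/
def zAlgToS : ZAlg →+* S 2 :=
  (S.proj 2).comp ((PowerSeries.C (R := ZBar)).comp (Ideal.Quotient.mk (Ideal.span {zeta [2]})))

theorem zAlgToS_eq_zero {z : ZAlg} (hz : z ∈ Ideal.span {zeta [2]}) : zAlgToS z = 0 := by
  simp only [zAlgToS, RingHom.comp_apply]
  rw [Ideal.Quotient.eq_zero_iff_mem.2 hz, map_zero, map_zero]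

theorem proj_eq_coeff (F : PowerSeries ZBar) : S.proj 2 F =
    S.proj 2 (PowerSeries.C (PowerSeries.coeff 0 F)) +
      S.proj 2 (PowerSeries.C (PowerSeries.coeff 1 F)) * xS 2 := by
  rw [xS, ← map_mul, ← map_add, S.proj, Ideal.Quotient.eq, Ideal.mem_span_singleton,
    PowerSeries.X_pow_dvd_iff]
  intro m hm
  interval_cases m
  · simp
  · rw [map_sub, map_add, PowerSeries.coeff_C_mul, PowerSeries.coeff_one_X, PowerSeries.coeff_C]
    simp

theorem coeff_zero_tailSeries (k : Index) :
    PowerSeries.coeff 0 (tailSeries k) = zetaSh k.reverse := by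
  rw [tailSeries, PowerSeries.coeff_mk, Finset.Nat.antidiagonalTuple_zero_right, sum_singleton]
  simp only [Pi.zero_apply, add_zero, Nat.choose_zero_right, prod_const_one, Nat.cast_one, one_mul]
  congr 1
  rw [addReverse]
  simp only [Pi.zero_apply, add_zero]
  congr 1
  exact List.ofFn_get k

theorem sum_antidiagonalTuple_succ {M : Type*} [AddCommMonoid M] (r n : ℕ)
    (F : (Fin (r + 1) → ℕ) → M) :
    ∑ l ∈ Finset.Nat.antidiagonalTuple (r + 1) n, F l =
      ∑ p ∈ antidiagonal n, ∑ l ∈ Finset.Nat.antidiagonalTuple r p.2, F (Fin.cons p.1 l) := by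
  rw [sum_sigma']
  refine sum_bij' (fun l _ => ⟨(l 0, ∑ i, l (Fin.succ i)), fun i => l i.succ⟩)
    (fun x _ => Fin.cons x.1.1 x.2) ?_ ?_ ?_ ?_ ?_
  · intro l hl
    rw [Finset.Nat.mem_antidiagonalTuple, Fin.sum_univ_succ] at hl
    simp [hl, Finset.Nat.mem_antidiagonalTuple]
  · rintro ⟨⟨p, q⟩, l⟩ hx
    simp only [mem_sigma, HasAntidiagonal.mem_antidiagonal, Finset.Nat.mem_antidiagonalTuple] at hx
    rw [Finset.Nat.mem_antidiagonalTuple, Fin.sum_univ_succ]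
    simp [hx.1, hx.2]
  · intro l _
    exact Fin.cons_self_tail l
  · rintro ⟨⟨p, q⟩, l⟩ hx
    simp only [mem_sigma, HasAntidiagonal.mem_antidiagonal, Finset.Nat.mem_antidiagonalTuple] at hx
    simp [hx.2]
  · intro l _
    congr 1
    exact (Fin.cons_self_tail l).symm

/-- `(k₁ + l₁, …, k_r + l_r)`. -/
def addIndex (k : Index) (l : Fin k.length → ℕ) : Index :=
  List.ofFn fun j => (⟨(k.get j : ℕ) + l j, Nat.add_pos_left (k.get j).pos _⟩ : ℕ+)

theorem addIndex_cons (k : ℕ+) (ks : Index) (p : ℕ) (l : Fin ks.length → ℕ) :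
    addIndex (k :: ks) (Fin.cons p l) =
      (⟨(k : ℕ) + p, Nat.add_pos_left k.pos _⟩ : ℕ+) :: addIndex ks l :=
  List.ofFn_succ

theorem addIndex_zero (k : Index) : addIndex k 0 = k := List.ofFn_get k

/-- Exactly one lⱼ equals 1, and its binomial coefficient is kⱼ. Thus the coefficient of t in the
tail series is the derivation `indexDeriv`. -/
theorem sum_choose_mul_addIndex (k : Index) (f : Index → ZAlg) :
    ∑ l ∈ Finset.Nat.antidiagonalTuple k.length 1,
      ((∏ j, ((k.get j : ℕ) + l j - 1).choose (l j) : ℕ) : ZAlg) * f (addIndex k l) =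
      indexDeriv f k := by
  induction k generalizing f with
  | nil => simp [indexDeriv]
  | cons k ks ih =>
    rw [indexDeriv, ← ih]
    refine (sum_antidiagonalTuple_succ ks.length 1 _).trans ?_
    rw [show antidiagonal 1 = {(0, 1), (1, 0)} from rfl, sum_pair (by simp), add_comm]
    congr 1
    · rw [Finset.Nat.antidiagonalTuple_zero_right, sum_singleton]
      change ((∏ j : Fin (ks.length + 1), _ : ℕ) : ZAlg) * _ = _
      rw [Fin.prod_univ_succ, addIndex_cons, addIndex_zero]
      simp only [List.get_eq_getElem, Fin.val_zero, List.getElem_cons_zero, Fin.cons_zero,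
        Nat.add_sub_cancel, Nat.choose_one_right, Fin.val_succ, List.getElem_cons_succ,
        Fin.cons_succ, Pi.zero_apply, Nat.choose_zero_right, prod_const_one, mul_one]
      rfl
    · refine sum_congr rfl fun l _ => ?_
      change ((∏ j : Fin (ks.length + 1), _ : ℕ) : ZAlg) * _ = _
      rw [Fin.prod_univ_succ, addIndex_cons]
      simp only [List.get_eq_getElem, Fin.val_zero, List.getElem_cons_zero, Fin.cons_zero,
        Nat.choose_zero_right, one_mul, Fin.val_succ, List.getElem_cons_succ, Fin.cons_succ]
      rfl

theorem coeff_one_tailSeries (k : Index) :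
    PowerSeries.coeff 1 (tailSeries k) = indexDeriv zetaSh k.reverse := by
  rw [tailSeries, PowerSeries.coeff_mk, indexDeriv_reverse, ← sum_choose_mul_addIndex]
  rfl

theorem coeff_zetaShatSh (m : ℕ) (k : Index) :
    PowerSeries.coeff m (zetaShatSh k) =
      conv zetaSh (fun l => (-1) ^ wt l * PowerSeries.coeff m (tailSeries l)) k := by
  rw [zetaShatSh, map_sum, conv_eq_sum]
  refine sum_congr rfl fun i _ => ?_
  have h : (-1 : PowerSeries ZAlg) ^ wt (k.drop i) = PowerSeries.C ((-1) ^ wt (k.drop i)) := by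
    simp
  rw [h, ← map_mul, PowerSeries.coeff_C_mul]
  ring

theorem zetaS_two_eq (k : Index) : zetaS 2 k =
    zAlgToS (conv zetaSh (fun l => (-1) ^ wt l * zetaSh l.reverse) k) +
      zAlgToS (conv zetaSh (fun l => (-1) ^ wt l * indexDeriv zetaSh l.reverse) k) * xS 2 := by
  rw [zetaS, proj_eq_coeff, zetaShat, PowerSeries.coeff_map, PowerSeries.coeff_map,
    coeff_zetaShatSh, coeff_zetaShatSh]
  simp only [coeff_zero_tailSeries, coeff_one_tailSeries]
  rfl

theorem zetaStarS_eq_coarseSum (n : ℕ) (k : Index) : zetaStarS n k = coarseSum (zetaS n) k := by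
  rw [zetaStarS, zetaStarShat, map_list_sum, List.map_map, coarseSum]
  rfl

/-- The nested sums over `1 < ⋯ < M - 1` and `-(M - 1) < ⋯ < -1`, with an infinitesimal shift
of the second half. -/
def dualTrunc (M : ℕ) (k : Index) : DualNumber ℝ :=
  nestedSum ((initialList (fun n => (n : ℝ)⁻¹) M).map (inlHom ℝ ℝ) ++
    (((initialList (fun n => (n : ℝ)⁻¹) M).map fun y => (inl y + inr (y ^ 2) : DualNumber ℝ)).map
      fun y => -y).reverse) k

theorem dualTrunc_eq (M : ℕ) (k : Index) : dualTrunc M k =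
    inl (conv (mzvTrunc M) (fun l => (-1) ^ wt l * mzvTrunc M l.reverse) k) +
      inr (conv (mzvTrunc M) (fun l => (-1) ^ wt l * indexDeriv (mzvTrunc M) l.reverse) k) := by
  rw [dualTrunc, nestedSum_append, conv_eq_sum, conv_eq_sum, conv_eq_sum]
  have h1 : ∀ l, nestedSum ((initialList (fun n => (n : ℝ)⁻¹) M).map (inlHom ℝ ℝ)) l =
      inl (mzvTrunc M l) := fun l => (map_nestedSum (inlHom ℝ ℝ) _ l).symm
  simp only [h1, nestedSum_reverse, nestedSum_map_neg, nestedSum_dualNumber, wt_reverse]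
  have h2 : ∀ l, nestedSum (initialList (fun n => (n : ℝ)⁻¹) M) l = mzvTrunc M l := fun _ => rfl
  have h3 : ∀ n : ℕ, (-1 : DualNumber ℝ) ^ n = inl ((-1) ^ n) := fun n => by
    ext <;> simp [fst_pow, snd_pow]
  rw [← funext h2]
  simp only [h3]
  ext
  · simp [fst_sum]
  · simp [snd_sum]

theorem conv_dualTrunc (M : ℕ) (k : Index) :
    conv (dualTrunc M) (fun l => (-1) ^ l.length * coarseSum (dualTrunc M) l.reverse) k =
      convOne k := by
  have h : ∀ l, coarseSum (dualTrunc M) l = nestedSumStar _ l := fun l =>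
    (nestedSumStar_eq_sum_coarsenings _ l).symm
  simp only [h]
  exact conv_nestedSum_nestedSumStar _ k

/-- The inclusion `𝒵[ε] → ℝ[ε]`. -/
def dualIncl : DualNumber ZAlg →+* DualNumber ℝ :=
  dualEval ((inlHom ℝ ℝ).comp (ZAlg.val : ZAlg →+* ℝ)) (inr 1) (by ext <;> simp [sq])

theorem dualIncl_apply (d : DualNumber ZAlg) :
    dualIncl d = inl (d.fst : ℝ) + inr (d.snd : ℝ) := by
  rw [dualIncl, dualEval_apply]
  ext <;> simp

theorem dualIncl_injective : Function.Injective dualIncl := by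
  intro d d' h
  rw [dualIncl_apply, dualIncl_apply] at h
  have h1 := congrArg fst h
  have h2 := congrArg snd h
  simp only [fst_add, fst_inl, fst_inr, add_zero, snd_add, snd_inl, snd_inr, zero_add] at h1 h2
  ext
  · exact h1
  · exact h2

/-- The limit differs from the defining expression of ζ_{𝒮₂} by a convolution factor c, the limit of
`symTrunc`. Modulo ζ(2) this factor is the unit of the convolution. -/
theorem exists_dual_limit : ∃ L : Index → DualNumber ZAlg,
    (∀ k, dualEval zAlgToS (xS 2) xS_sq (L k) = zetaS 2 k) ∧
    ∀ k, Tendsto (fun M => dualTrunc M k) atTop (𝓝 (dualIncl (L k))) := by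
  obtain ⟨c, hc0, hc1, hc⟩ := exists_tendsto_symTrunc
  refine ⟨fun k => inl (conv zetaSh (conv c fun l => (-1) ^ wt l * zetaSh l.reverse) k) +
    inr (conv zetaSh (conv c fun l => (-1) ^ wt l * indexDeriv zetaSh l.reverse) k),
    fun k => ?_, fun k => ?_⟩
  · have hcS : ∀ l, zAlgToS (c l) = convOne l := by
      intro l
      cases l with
      | nil => rw [hc0, map_one]; rfl
      | cons m l => exact zAlgToS_eq_zero (hc1 _ (by simp))
    have hconv : ∀ h : Index → ZAlg, zAlgToS (conv zetaSh (conv c h) k) =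
        zAlgToS (conv zetaSh h k) := by
      intro h
      refine (map_conv (R := ZAlg) (R' := S 2) zAlgToS _ _ k).trans (Eq.trans ?_ (map_conv (R := ZAlg) (R' := S 2) zAlgToS _ _ k).symm)
      refine conv_congr (fun _ => rfl) (fun l => ?_) k
      refine (map_conv (R := ZAlg) (R' := S 2) zAlgToS _ _ l).trans ?_
      rw [funext hcS, conv_one_left]
    rw [dualEval_apply, zetaS_two_eq]
    simp only [fst_add, snd_add, fst_inl, snd_inl, fst_inr, snd_inr, add_zero, zero_add, hconv]
  · have h1 := expands_mzvTrunc.tendsto_conv_reverse expands_mzvTrunc hc k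
    have h2 := expands_mzvTrunc.tendsto_conv_reverse expands_mzvTrunc.indexDeriv hc k
    simp only [dualTrunc_eq]
    rw [dualIncl_apply]
    have hcoe : ∀ f g h : Index → ZAlg, ((conv f (conv g h) k : ZAlg) : ℝ) =
        conv (fun l => (f l : ℝ)) (conv (fun l => (g l : ℝ)) fun l => (h l : ℝ)) k := by
      intro f g h
      have := map_conv (ZAlg.val : ZAlg →+* ℝ) f (conv g h) k
      refine this.trans (conv_congr (fun _ => rfl) (fun l => ?_) k)
      exact map_conv (ZAlg.val : ZAlg →+* ℝ) g h l
    have hder : ∀ l, ((indexDeriv zetaSh l : ZAlg) : ℝ) = indexDeriv (fun l => (zetaSh l : ℝ)) l :=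
      map_indexDeriv (ZAlg.val : ZAlg →+* ℝ) zetaSh
    simp only [fst_add, snd_add, fst_inl, snd_inl, fst_inr, snd_inr, add_zero, zero_add, hcoe]
    push_cast
    simp only [hder]
    exact ((TrivSqZeroExt.continuous_inl.tendsto _).comp h1).add ((TrivSqZeroExt.continuous_inr.tendsto _).comp h2)

theorem tendsto_coarseSum {f : ℕ → Index → DualNumber ℝ} {g : Index → DualNumber ℝ}
    (h : ∀ k, Tendsto (fun M => f M k) atTop (𝓝 (g k))) (k : Index) :
    Tendsto (fun M => coarseSum (f M) k) atTop (𝓝 (coarseSum g k)) :=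
  tendsto_list_sum _ fun l _ => h l

theorem map_coarseSum {R R' : Type*} [CommRing R] [CommRing R'] (φ : R →+* R') (f : Index → R)
    (k : Index) : φ (coarseSum f k) = coarseSum (fun l => φ (f l)) k := by
  rw [coarseSum, coarseSum, map_list_sum, List.map_map]
  rfl

theorem map_convOne {R R' : Type*} [CommRing R] [CommRing R'] (φ : R →+* R') (k : Index) :
    φ (convOne k) = convOne k := by
  cases k
  · exact map_one φ
  · exact map_zero φ

theorem map_conv_coarseSum {R R' : Type*} [CommRing R] [CommRing R'] (φ : R →+* R') (f : Index → R)
    (k : Index) : φ (conv f (fun l => (-1) ^ l.length * coarseSum f l.reverse) k) =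
      conv (fun l => φ (f l))
        (fun l => (-1) ^ l.length * coarseSum (fun l => φ (f l)) l.reverse) k := by
  rw [map_conv]
  simp only [map_mul, map_pow, map_neg, map_one, map_coarseSum]

/-- The relation is exact for each M in ℝ[ε] and passes to the limit. It is then pulled back along
the injection of 𝒵[ε] into ℝ[ε] and mapped to 𝒮₂ by ε ↦ t. -/
theorem conv_zetaS (k : Index) :
    conv (zetaS 2) (fun l => (-1) ^ l.length * coarseSum (zetaS 2) l.reverse) k = convOne k := by
  obtain ⟨L, hS, hlim⟩ := exists_dual_limit
  have hL : conv L (fun l => (-1) ^ l.length * coarseSum L l.reverse) k = convOne k := by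
    apply dualIncl_injective
    rw [map_conv_coarseSum, map_convOne]
    have hT : Tendsto (fun M => conv (dualTrunc M)
        (fun l => (-1) ^ l.length * coarseSum (dualTrunc M) l.reverse) k) atTop
        (𝓝 (conv (fun l => dualIncl (L l))
          (fun l => (-1) ^ l.length * coarseSum (fun l => dualIncl (L l)) l.reverse) k)) := by
      simp only [conv_eq_sum]
      exact tendsto_finsetSum _ fun i _ =>
        (hlim _).mul (tendsto_const_nhds.mul (tendsto_coarseSum hlim _))
    simp only [conv_dualTrunc] at hT
    exact tendsto_nhds_unique hT tendsto_const_nhds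
  have h := congrArg (dualEval zAlgToS (xS 2) xS_sq) hL
  rw [map_conv_coarseSum, map_convOne] at h
  simpa only [hS] using h

end

/-! ### Duality -/

noncomputable section

open Filter Topology
open scoped ENNReal

/-- `m! n! / (m + n)!`. -/
def connector (m n : ℕ) : ℝ := ((m + n).choose m : ℝ)⁻¹

theorem connector_nonneg (m n : ℕ) : 0 ≤ connector m n := by
  unfold connector; positivity

theorem connector_comm (m n : ℕ) : connector m n = connector n m := by
  rw [connector, connector, add_comm n m, Nat.choose_symm_add]

theorem connector_zero_right (m : ℕ) : connector m 0 = 1 := by simp [connector]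

/-- The telescoping identity behind the transport of letters: summed over the first argument, it
trades a factor 1/m for a factor 1/n. -/
theorem connector_succ (m : ℕ) {n : ℕ} (hn : 1 ≤ n) :
    ((m + 1 : ℕ) : ℝ)⁻¹ * connector (m + 1) n =
      (n : ℝ)⁻¹ * (connector m n - connector (m + 1) n) := by
  have h : ((m + 1 + n).choose (m + 1) : ℝ) * (m + 1) = ((m + n).choose m : ℝ) * (m + 1 + n) := by
    have := Nat.add_one_mul_choose_eq (m + n) m
    rw [show m + n + 1 = m + 1 + n by ring] at this
    have h' := congrArg (Nat.cast : ℕ → ℝ) this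
    push_cast at h'
    linarith
  have h1 : ((m + 1 + n).choose (m + 1) : ℝ) ≠ 0 := by
    exact_mod_cast (Nat.choose_pos (by omega)).ne'
  have h2 : ((m + n).choose m : ℝ) ≠ 0 := by exact_mod_cast (Nat.choose_pos (by omega)).ne'
  have h3 : (n : ℝ) ≠ 0 := by exact_mod_cast (by omega : n ≠ 0)
  have h4 : (m : ℝ) + 1 ≠ 0 := by positivity
  rw [connector, connector]
  push_cast
  field_simp
  linear_combination -h

theorem tendsto_connector {n : ℕ} (hn : 1 ≤ n) : Tendsto (fun m => connector m n) atTop (𝓝 0) := by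
  refine squeeze_zero (fun m => connector_nonneg m n) (fun m => ?_)
    (tendsto_one_div_add_atTop_nhds_zero_nat (𝕜 := ℝ))
  rw [connector, one_div]
  refine inv_anti₀ (by positivity) ?_
  have h : m + 1 ≤ (m + n).choose m := by
    calc m + 1 = (m + 1).choose m := by simp
      _ ≤ (m + n).choose m := Nat.choose_le_choose _ (by omega)
  exact_mod_cast h

theorem tsum_connector (m : ℕ) {n : ℕ} (hn : 1 ≤ n) :
    ∑' j, ENNReal.ofReal (((m + 1 + j : ℕ) : ℝ)⁻¹ * connector (m + 1 + j) n) =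
      ENNReal.ofReal ((n : ℝ)⁻¹ * connector m n) := by
  have hnonneg : ∀ j, 0 ≤ ((m + 1 + j : ℕ) : ℝ)⁻¹ * connector (m + 1 + j) n := fun j =>
    mul_nonneg (by positivity) (connector_nonneg _ _)
  have h : HasSum (fun j => ((m + 1 + j : ℕ) : ℝ)⁻¹ * connector (m + 1 + j) n)
      ((n : ℝ)⁻¹ * connector m n) := by
    rw [hasSum_iff_tendsto_nat_of_nonneg hnonneg]
    have hs : ∀ J, ∑ j ∈ range J, ((m + 1 + j : ℕ) : ℝ)⁻¹ * connector (m + 1 + j) n =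
        (n : ℝ)⁻¹ * (connector m n - connector (m + J) n) := by
      intro J
      induction J with
      | zero => simp
      | succ J ih =>
        rw [sum_range_succ, ih, show m + 1 + J = m + J + 1 by ring, connector_succ _ hn,
          show m + (J + 1) = m + J + 1 by ring]
        ring
    simp only [hs]
    have hc : Tendsto (fun J => connector (m + J) n) atTop (𝓝 0) :=
      (tendsto_connector hn).comp (tendsto_add_atTop_nat m |>.congr fun J => add_comm J m)
    simpa using (tendsto_const_nhds.sub hc).const_mul (n : ℝ)⁻¹
  rw [← ENNReal.ofReal_tsum_of_nonneg hnonneg h.summable, h.tsum_eq]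

theorem tsum_sum_range_mul (f g : ℕ → ℝ≥0∞) :
    ∑' m, (∑ i ∈ range m, f i) * g m = ∑' i, f i * ∑' j, g (i + 1 + j) := by
  have h1 : ∀ m, (∑ i ∈ range m, f i) * g m = ∑' i, if i < m then f i * g m else 0 := by
    intro m
    rw [sum_mul, tsum_eq_sum (s := range m) fun i hi => if_neg (by simpa using hi)]
    exact sum_congr rfl fun i hi => (if_pos (mem_range.1 hi)).symm
  simp only [h1]
  rw [ENNReal.tsum_comm]
  refine tsum_congr fun i => ?_
  rw [← ENNReal.tsum_mul_left]
  have hinj : Function.Injective fun j => i + 1 + j := add_right_injective (i + 1)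
  rw [← hinj.tsum_eq (f := fun m => if i < m then f i * g m else 0)]
  · exact tsum_congr fun j => if_pos (by omega)
  · intro m hm
    have : i < m := by
      by_contra h
      exact hm (if_neg h)
    exact ⟨m - (i + 1), by simp; omega⟩

/-- The coefficients of multiple polylogarithms as extended nonnegative reals. -/
def liENN (w : Word) (n : ℕ) : ℝ≥0∞ := ENNReal.ofReal (liCoeff w n)

/-- The connected sum of two words. -/
def connectedSum (u v : Word) : ℝ≥0∞ :=
  ∑' m, ∑' n, liENN u m * liENN v n * ENNReal.ofReal (connector m n)

theorem connectedSum_comm (u v : Word) : connectedSum u v = connectedSum v u := by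
  rw [connectedSum, ENNReal.tsum_comm]
  refine tsum_congr fun n => tsum_congr fun m => ?_
  rw [connector_comm, mul_comm (liENN u m)]

/-- Summing out the largest variable on the left with `tsum_connector` leaves a factor 1/n on the
right. A final e₁ of one word thus moves to the other word as e₀. Extended nonnegative reals make
every interchange of sums legitimate. -/
theorem connectedSum_append_e1 (u : Word) {v : Word} (hv : v ≠ []) :
    connectedSum (u ++ [Letter.e1]) v = connectedSum u (v ++ [Letter.e0]) := by
  rw [connectedSum_comm, connectedSum_comm u]
  refine tsum_congr fun n => ?_
  rcases Nat.eq_zero_or_pos n with rfl | hn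
  · have h1 : liENN v 0 = 0 := by rw [liENN, liCoeff_zero hv, ENNReal.ofReal_zero]
    have h2 : liENN (v ++ [Letter.e0]) 0 = 0 := by
      rw [liENN, liCoeff_zero (by simp), ENNReal.ofReal_zero]
    simp [h1, h2]
  have h : ∀ m, liENN v n * liENN (u ++ [Letter.e1]) m * ENNReal.ofReal (connector n m) =
      liENN v n * ((∑ i ∈ range m, liENN u i) *
        ENNReal.ofReal ((m : ℝ)⁻¹ * connector m n)) := by
    intro m
    simp only [liENN]
    rw [← ENNReal.ofReal_sum_of_nonneg fun i _ => liCoeff_nonneg u i, liCoeff_append_e1,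
      div_eq_mul_inv, ENNReal.ofReal_mul (sum_nonneg fun i _ => liCoeff_nonneg u i),
      ENNReal.ofReal_mul (by positivity), connector_comm n m]
    ring
  simp only [h]
  rw [ENNReal.tsum_mul_left, tsum_sum_range_mul, ← ENNReal.tsum_mul_left]
  refine tsum_congr fun i => ?_
  rw [tsum_connector i hn, ENNReal.ofReal_mul (by positivity), liENN, liENN, liENN,
    liCoeff_append_e0, div_eq_mul_inv, ENNReal.ofReal_mul (liCoeff_nonneg v n), connector_comm i n]
  ring

/-- The word obtained by reversal and exchange of the letters. -/
def dualWord (w : Word) : Word :=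
  (w.map fun x => match x with
    | Letter.e0 => Letter.e1
    | Letter.e1 => Letter.e0).reverse

theorem connectedSum_eq_nil {u : Word} (hu : u ≠ [] → u.head? = some Letter.e1) {v : Word}
    (hv : v ≠ []) : connectedSum u v = connectedSum [] (v ++ dualWord u) := by
  induction u using List.reverseRecOn generalizing v with
  | nil => simp [dualWord]
  | append_singleton u x ih =>
    have hu' : u ≠ [] → u.head? = some Letter.e1 := by
      intro h
      obtain ⟨y, w, rfl⟩ := List.exists_cons_of_ne_nil h
      simpa using hu
    cases x
    · have hne : u ≠ [] := by rintro rfl; simp at hu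
      rw [connectedSum_comm, ← connectedSum_append_e1 v hne, connectedSum_comm,
        ih hu' (by simp)]
      simp [dualWord]
    · rw [connectedSum_append_e1 u hv, ih hu' (by simp)]
      simp [dualWord]

theorem connectedSum_nil (u : Word) : connectedSum u [] = ∑' n, liENN u n := by
  refine tsum_congr fun n => ?_
  rw [tsum_eq_single 0]
  · simp [liENN, liCoeff_nil, connector_zero_right]
  · intro m hm
    simp [liENN, liCoeff_nil, hm]

theorem tsum_liENN_dualWord {u : Word} (hu : u.head? = some Letter.e1) :
    ∑' n, liENN (dualWord (u ++ [Letter.e0])) n = ∑' n, liENN (u ++ [Letter.e0]) n := by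
  have hne : u ≠ [] := by rintro rfl; simp at hu
  -- The transport of a final e₁ needs a nonempty partner. So the final e₀ is moved first, which
  -- makes the partner `[e1]`; the letters of `u` then follow.
  rw [← connectedSum_nil, ← connectedSum_nil, connectedSum_comm (u ++ [Letter.e0]),
    ← connectedSum_append_e1 [] hne, List.nil_append, connectedSum_comm [Letter.e1],
    connectedSum_eq_nil (fun _ => hu) (by simp), connectedSum_comm]
  simp [dualWord]

theorem Admissible.hasSum_liCoeff {k : Index} (hk : Admissible k) :
    HasSum (liCoeff (indexWord k)) (mzv k) := by
  rw [hasSum_iff_tendsto_nat_of_nonneg (liCoeff_nonneg _)]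
  simpa only [coeff_liPoly_wordPoly] using hk.tailBound.tendsto

theorem Admissible.tsum_liENN {k : Index} (hk : Admissible k) :
    ∑' n, liENN (indexWord k) n = ENNReal.ofReal (mzv k) := by
  rw [← hk.hasSum_liCoeff.tsum_eq,
    ENNReal.ofReal_tsum_of_nonneg (liCoeff_nonneg _) hk.hasSum_liCoeff.summable]
  rfl

theorem Admissible.mzv_nonneg {k : Index} (hk : Admissible k) : 0 ≤ mzv k :=
  hk.hasSum_liCoeff.nonneg (liCoeff_nonneg _)

/-- The duality of multiple zeta values. -/
theorem zeta_eq_of_dualWord {k l : Index} (hk : Admissible k) (hl : Admissible l) (hne : k ≠ [])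
    (h : indexWord l = dualWord (indexWord k)) : zeta l = zeta k := by
  apply Subtype.ext
  rw [coe_zeta hk, coe_zeta hl]
  obtain ⟨x, hx, hkx⟩ := hk.exists_indexWord_eq hne
  have := tsum_liENN_dualWord hx
  rw [← hkx, ← h, hk.tsum_liENN, hl.tsum_liENN] at this
  exact (ENNReal.ofReal_eq_ofReal_iff hl.mzv_nonneg hk.mzv_nonneg).1 this

end

/-! ### Relations between double zeta values -/

noncomputable section

open Filter Topology
open scoped ENNReal

/-- The solution of the recursion `u (i + 1) (j + 1) = u i (j + 1) + u (i + 1) j`. -/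
theorem lattice_recursion {M : Type*} [AddCommMonoid M] {u : ℕ → ℕ → M} {t : ℕ → M} {N : ℕ}
    (hu : ∀ i j, i + j + 2 ≤ N → u (i + 1) (j + 1) = u i (j + 1) + u (i + 1) j)
    (h0 : ∀ j, u 0 j = t j) (h0' : ∀ j, u j 0 = t j) (i j : ℕ) (hij : i + j + 2 ≤ N) :
    u (i + 1) (j + 1) =
      ∑ q ∈ range (i + j + 1), ((i + j - q).choose j + (i + j - q).choose i) • t (q + 1) := by
  have hzero : ∀ j, j + 2 ≤ N → u 1 (j + 1) =
      ∑ q ∈ range (j + 1), ((j - q).choose j + 1) • t (q + 1) ∧ u (j + 1) 1 =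
      ∑ q ∈ range (j + 1), (1 + (j - q).choose j) • t (q + 1) := by
    intro j
    have hsum : ∀ j, ∑ q ∈ range (j + 1), ((j - q).choose j + 1) • t (q + 1) =
        t 1 + ∑ q ∈ range (j + 1), t (q + 1) := by
      intro j
      simp only [add_smul, one_smul, sum_add_distrib]
      congr 1
      rw [sum_range_succ', sum_eq_zero, zero_add]
      · simp
      · intro q hq
        have := mem_range.1 hq
        rw [Nat.choose_eq_zero_of_lt (by omega), zero_smul]
    have hsum' : ∀ j, ∑ q ∈ range (j + 1), (1 + (j - q).choose j) • t (q + 1) =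
        t 1 + ∑ q ∈ range (j + 1), t (q + 1) := fun j => by
      rw [← hsum]; exact sum_congr rfl fun q _ => by rw [add_comm 1]
    induction j with
    | zero =>
      intro hN
      have := hu 0 0 hN
      rw [h0, h0'] at this
      simp [this, two_smul]
    | succ j ih =>
      intro hN
      obtain ⟨h1, h2⟩ := ih (by omega)
      have e1 := hu 0 (j + 1) (by omega)
      have e2 := hu (j + 1) 0 (by omega)
      rw [h0, zero_add] at e1
      rw [h0', zero_add] at e2
      rw [hsum, e1, h1, hsum, hsum', e2, h2, hsum', sum_range_succ _ (j + 1)]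
      constructor <;> abel
  induction h : i + j generalizing i j with
  | zero =>
    obtain ⟨rfl, rfl⟩ : i = 0 ∧ j = 0 := by omega
    simpa using (hzero 0 (by omega)).1
  | succ s ih =>
    rcases i with _ | i
    · obtain rfl : j = s + 1 := by omega
      simpa using (hzero (s + 1) (by omega)).1
    rcases j with _ | j
    · obtain rfl : i = s := by omega
      simpa using (hzero (i + 1) (by omega)).2
    rw [hu _ _ hij, ih i (j + 1) (by omega) (by omega), ih (i + 1) j (by omega) (by omega),
      sum_range_succ _ (s + 1), ← sum_add_distrib]
    simp only [Nat.sub_self, Nat.choose_zero_succ, add_zero, zero_smul]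
    refine sum_congr rfl fun q hq => ?_
    have hq' := mem_range.1 hq
    rw [← add_smul, show s + 1 - q = s - q + 1 by omega, Nat.choose_succ_succ _ j,
      Nat.choose_succ_succ _ i]
    congr 1
    ring

/-- Tornheim's double series `∑ m⁻ⁱ l⁻ʲ (m + l)⁻ᵏ`. -/
def tornheim (i j k : ℕ) : ℝ≥0∞ :=
  ∑' m : ℕ, ∑' l : ℕ, ENNReal.ofReal (((m : ℝ) + 1)⁻¹ ^ i * ((l : ℝ) + 1)⁻¹ ^ j *
    ((m : ℝ) + l + 2)⁻¹ ^ k)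

theorem tornheim_comm (i j k : ℕ) : tornheim i j k = tornheim j i k := by
  rw [tornheim, ENNReal.tsum_comm]
  refine tsum_congr fun m => tsum_congr fun l => ?_
  rw [add_comm (l : ℝ) m]
  congr 1
  ring

/-- Partial fractions: 1/(ml) = (1/m + 1/l)/(m + l). -/
theorem tornheim_succ_succ (i j k : ℕ) :
    tornheim (i + 1) (j + 1) k = tornheim i (j + 1) (k + 1) + tornheim (i + 1) j (k + 1) := by
  rw [tornheim, tornheim, tornheim, ← ENNReal.tsum_add]
  refine tsum_congr fun m => ?_
  rw [← ENNReal.tsum_add]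
  refine tsum_congr fun l => ?_
  rw [← ENNReal.ofReal_add (by positivity) (by positivity)]
  congr 1
  have h1 : (m : ℝ) + 1 ≠ 0 := by positivity
  have h2 : (l : ℝ) + 1 ≠ 0 := by positivity
  have h3 : (m : ℝ) + l + 2 ≠ 0 := by positivity
  have h : ((m : ℝ) + 1)⁻¹ * ((l : ℝ) + 1)⁻¹ =
      ((m : ℝ) + l + 2)⁻¹ * (((m : ℝ) + 1)⁻¹ + ((l : ℝ) + 1)⁻¹) := by
    field_simp
    ring
  simp only [pow_succ]
  linear_combination ((m : ℝ) + 1)⁻¹ ^ i * ((l : ℝ) + 1)⁻¹ ^ j * ((m : ℝ) + l + 2)⁻¹ ^ k * h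

theorem liCoeff_indexWord_singleton (k : ℕ+) (n : ℕ) :
    liCoeff (indexWord [k]) n = ((n : ℝ)⁻¹) ^ (k : ℕ) := by
  have h := liCoeff_append_block [] ((k : ℕ) - 1) n
  rw [List.nil_append, Nat.sub_add_cancel k.pos] at h
  rw [indexWord_singleton, h]
  rcases Nat.eq_zero_or_pos n with rfl | hn
  · simp [k.ne_zero]
  · simp [liCoeff_nil, hn]

theorem liCoeff_indexWord_pair (i j : ℕ+) (n : ℕ) : liCoeff (indexWord [i, j]) n =
    (∑ m ∈ range n, ((m : ℝ)⁻¹) ^ (i : ℕ)) * ((n : ℝ)⁻¹) ^ (j : ℕ) := by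
  rw [show [i, j] = [i] ++ [j] from rfl, indexWord_append, indexWord_singleton j,
    liCoeff_append_block, Nat.sub_add_cancel j.pos]
  simp only [liCoeff_indexWord_singleton]

theorem admissible_pair (i : ℕ+) {j : ℕ+} (hj : 2 ≤ j) : Admissible [i, j] := by
  intro m hm
  simp only [List.getLast?_cons_cons, List.getLast?_singleton, Option.mem_def,
    Option.some.injEq] at hm
  rwa [← hm]

theorem ofReal_mzv_pair (i : ℕ+) {j : ℕ+} (hj : 2 ≤ j) :
    ENNReal.ofReal (mzv [i, j]) = tornheim i 0 j := by
  rw [← (admissible_pair i hj).tsum_liENN]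
  have h : ∀ n, liENN (indexWord [i, j]) n =
      (∑ m ∈ range n, ENNReal.ofReal (((m : ℝ)⁻¹) ^ (i : ℕ))) *
        ENNReal.ofReal (((n : ℝ)⁻¹) ^ (j : ℕ)) := by
    intro n
    rw [liENN, liCoeff_indexWord_pair, ENNReal.ofReal_mul (sum_nonneg fun m _ => by positivity),
      ENNReal.ofReal_sum_of_nonneg fun m _ => by positivity]
  simp only [h]
  rw [tsum_sum_range_mul, tsum_eq_zero_add' ENNReal.summable]
  simp only [Nat.cast_zero, inv_zero, ne_eq, i.ne_zero, not_false_eq_true, zero_pow,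
    ENNReal.ofReal_zero, zero_mul, zero_add]
  refine tsum_congr fun m => ?_
  rw [← ENNReal.tsum_mul_left]
  refine tsum_congr fun l => ?_
  rw [← ENNReal.ofReal_mul (by positivity)]
  congr 1
  push_cast
  rw [pow_zero, mul_one, show (m : ℝ) + 1 + 1 + l = m + l + 2 by ring]

theorem ofReal_mzv_singleton {k : ℕ+} (hk : 2 ≤ k) : ENNReal.ofReal (mzv [k]) =
    ∑' m : ℕ, ENNReal.ofReal (((m : ℝ) + 1)⁻¹ ^ (k : ℕ)) := by
  rw [← (admissible_singleton hk).tsum_liENN, tsum_eq_zero_add' ENNReal.summable]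
  simp [liENN, liCoeff_indexWord_singleton]

theorem tornheim_zero_right (i j : ℕ+) (hi : 2 ≤ i) (hj : 2 ≤ j) :
    tornheim i j 0 = ENNReal.ofReal (mzv [i]) * ENNReal.ofReal (mzv [j]) := by
  rw [ofReal_mzv_singleton hi, ofReal_mzv_singleton hj, ← ENNReal.tsum_mul_right]
  refine tsum_congr fun m => ?_
  rw [← ENNReal.tsum_mul_left]
  refine tsum_congr fun l => ?_
  rw [pow_zero, mul_one, ENNReal.ofReal_mul (by positivity)]

theorem hasSum_inv_mul_inv_add (m : ℕ) :
    HasSum (fun l : ℕ => ((l : ℝ) + 1)⁻¹ * ((m : ℝ) + l + 2)⁻¹)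
      (((m : ℝ) + 1)⁻¹ * ∑ i ∈ range (m + 1), ((i : ℝ) + 1)⁻¹) := by
  rw [hasSum_iff_tendsto_nat_of_nonneg fun l => by positivity]
  have hs : ∀ L : ℕ, ∑ l ∈ range L, ((l : ℝ) + 1)⁻¹ * ((m : ℝ) + l + 2)⁻¹ =
      ((m : ℝ) + 1)⁻¹ * (∑ i ∈ range (m + 1), ((i : ℝ) + 1)⁻¹ -
        ∑ i ∈ range (m + 1), ((L + i : ℕ) + 1 : ℝ)⁻¹) := by
    intro L
    have h1 : ∑ l ∈ range L, ((l : ℝ) + 1)⁻¹ * ((m : ℝ) + l + 2)⁻¹ =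
        ((m : ℝ) + 1)⁻¹ * (∑ l ∈ range L, ((l : ℝ) + 1)⁻¹ -
          ∑ l ∈ range L, ((m + 1 + l : ℕ) + 1 : ℝ)⁻¹) := by
      rw [← sum_sub_distrib, mul_sum]
      refine sum_congr rfl fun l _ => ?_
      push_cast
      have h2 : (l : ℝ) + 1 ≠ 0 := by positivity
      have h3 : (m : ℝ) + l + 2 ≠ 0 := by positivity
      have h4 : (m : ℝ) + 1 + l + 1 ≠ 0 := by positivity
      field_simp
      ring
    have h2 := sum_range_add (fun i : ℕ => ((i : ℝ) + 1)⁻¹) L (m + 1)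
    have h3 := sum_range_add (fun i : ℕ => ((i : ℝ) + 1)⁻¹) (m + 1) L
    rw [add_comm L] at h2
    rw [h1]
    congr 1
    linarith
  simp only [hs]
  have hi : ∀ i : ℕ, Tendsto (fun L : ℕ => ((L + i : ℕ) + 1 : ℝ)⁻¹) atTop (𝓝 0) := fun i =>
    ((tendsto_one_div_add_atTop_nhds_zero_nat (𝕜 := ℝ)).comp (tendsto_add_atTop_nat i)).congr
      fun L => by simp
  have h0 := tendsto_finsetSum (range (m + 1)) fun i _ => hi i
  rw [sum_const_zero] at h0
  simpa using (tendsto_const_nhds.sub h0).const_mul ((m : ℝ) + 1)⁻¹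

/-- The inner sum is a harmonic number divided by its upper limit, and the top term of that harmonic
number is split off as ζ(i + 2). -/
theorem tornheim_one_one (i : ℕ+) : tornheim i 1 1 =
    ENNReal.ofReal (mzv [1, i + 1]) + ENNReal.ofReal (mzv [i + 2]) := by
  have hi1 : (2 : ℕ+) ≤ i + 1 := by
    rw [← PNat.coe_le_coe, PNat.add_coe]
    have := i.pos
    change 2 ≤ (i : ℕ) + 1
    omega
  have hi2 : (2 : ℕ+) ≤ i + 2 := by
    rw [← PNat.coe_le_coe, PNat.add_coe]
    change 2 ≤ (i : ℕ) + 2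
    omega
  rw [← (admissible_pair 1 hi1).tsum_liENN, tsum_eq_zero_add' ENNReal.summable,
    ofReal_mzv_singleton hi2, show liENN (indexWord [1, i + 1]) 0 = 0 by
      simp [liENN, liCoeff_indexWord_pair], zero_add, ← ENNReal.tsum_add]
  refine tsum_congr fun m => ?_
  have hm : ∀ l : ℕ, ((m : ℝ) + 1)⁻¹ ^ (i : ℕ) * ((l : ℝ) + 1)⁻¹ ^ 1 * ((m : ℝ) + l + 2)⁻¹ ^ 1 =
      ((m : ℝ) + 1)⁻¹ ^ (i : ℕ) * (((l : ℝ) + 1)⁻¹ * ((m : ℝ) + l + 2)⁻¹) := fun l => by ring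
  have hsum := (hasSum_inv_mul_inv_add m).mul_left (((m : ℝ) + 1)⁻¹ ^ (i : ℕ))
  simp only [hm]
  rw [← ENNReal.ofReal_tsum_of_nonneg (fun l => by positivity) hsum.summable, hsum.tsum_eq,
    liENN, ← ENNReal.ofReal_add (liCoeff_nonneg _ _) (by positivity), liCoeff_indexWord_pair]
  congr 1
  rw [sum_range_succ, sum_range_succ' _ m]
  simp only [PNat.one_coe, pow_one, Nat.cast_zero, inv_zero, add_zero, PNat.add_coe]
  push_cast
  ring

/-- The double zeta values `ζ(q + 1, n - q + 1)` of weight `n + 2`. -/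
def doubleZeta (n q : ℕ) : ZAlg := zeta [q.succPNat, (n - q).succPNat]

theorem two_le_succPNat {n : ℕ} (hn : 1 ≤ n) : (2 : ℕ+) ≤ n.succPNat := by
  rw [← PNat.coe_le_coe]
  change 2 ≤ n + 1
  omega

theorem admissible_doubleZeta {n q : ℕ} (hq : q < n) :
    Admissible [q.succPNat, (n - q).succPNat] :=
  admissible_pair _ (two_le_succPNat (by omega))

theorem tornheim_recursion (n i j : ℕ) (hij : i + j ≤ n) :
    tornheim (i + 1) (j + 1) (n - i - j) = ∑ q ∈ range (i + j + 1),
      ((i + j - q).choose j + (i + j - q).choose i) • tornheim (q + 1) 0 (n - q + 1) := by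
  have h := lattice_recursion (u := fun i j => tornheim i j (n + 2 - i - j))
    (t := fun j => tornheim j 0 (n + 2 - j)) (N := n + 2) ?_ ?_ ?_ i j (by omega)
  · rw [show n + 2 - (i + 1) - (j + 1) = n - i - j by omega] at h
    rw [h]
    refine sum_congr rfl fun q hq => ?_
    have := mem_range.1 hq
    rw [show n + 2 - (q + 1) = n - q + 1 by omega]
  · intro i j hij
    rw [tornheim_succ_succ]
    congr 2 <;> omega
  · intro j
    rw [tornheim_comm]
    simp
  · intro j; simp

theorem ofReal_doubleZeta {n q : ℕ} (hq : q < n) :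
    tornheim (q + 1) 0 (n - q + 1) = ENNReal.ofReal (doubleZeta n q : ℝ) := by
  rw [doubleZeta, coe_zeta (admissible_doubleZeta hq),
    ofReal_mzv_pair _ (two_le_succPNat (by omega))]
  rfl

theorem doubleZeta_nonneg {n q : ℕ} (hq : q < n) : (0 : ℝ) ≤ (doubleZeta n q : ℝ) := by
  rw [doubleZeta, coe_zeta (admissible_doubleZeta hq)]
  exact (admissible_doubleZeta hq).mzv_nonneg

theorem sum_nsmul_ofReal_doubleZeta (n : ℕ) (c : ℕ → ℕ) :
    ∑ q ∈ range n, c q • ENNReal.ofReal (doubleZeta n q : ℝ) =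
      ENNReal.ofReal ((∑ q ∈ range n, (c q : ZAlg) * doubleZeta n q : ZAlg) : ℝ) := by
  push_cast
  rw [ENNReal.ofReal_sum_of_nonneg]
  · refine sum_congr rfl fun q _ => ?_
    rw [ENNReal.ofReal_mul (by positivity), ENNReal.ofReal_natCast, nsmul_eq_mul]
  · intro q hq
    exact mul_nonneg (by positivity) (doubleZeta_nonneg (mem_range.1 hq))

theorem sum_mul_doubleZeta_nonneg (n : ℕ) (c : ℕ → ℕ) :
    (0 : ℝ) ≤ ((∑ q ∈ range n, (c q : ZAlg) * doubleZeta n q : ZAlg) : ℝ) := by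
  push_cast
  exact sum_nonneg fun q hq => mul_nonneg (by positivity) (doubleZeta_nonneg (mem_range.1 hq))

/-- The shuffle product of two zeta values. -/
theorem zeta_mul_zeta_eq_sum {n i j : ℕ} (hi : 1 ≤ i) (hj : 1 ≤ j) (hij : i + j = n) :
    zeta [i.succPNat] * zeta [j.succPNat] =
      ∑ q ∈ range n, (((n - q).choose j + (n - q).choose i : ℕ) : ZAlg) * doubleZeta n q := by
  apply Subtype.ext
  have h := tornheim_recursion n i j hij.le
  -- The term q = n would be the divergent ζ(n + 1, 1). Its coefficient is 0 because i and j are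
  -- positive.
  rw [show n - i - j = 0 by omega, hij, sum_range_succ, Nat.sub_self,
    Nat.choose_eq_zero_of_lt hi, Nat.choose_eq_zero_of_lt hj, add_zero, zero_smul, add_zero,
    sum_congr rfl fun q hq => by rw [ofReal_doubleZeta (mem_range.1 hq)],
    sum_nsmul_ofReal_doubleZeta n fun q => (n - q).choose j + (n - q).choose i] at h
  have h' := tornheim_zero_right i.succPNat j.succPNat (two_le_succPNat hi) (two_le_succPNat hj)
  simp only [Nat.succPNat_coe] at h'
  have hA := admissible_singleton (two_le_succPNat hi)
  have hB := admissible_singleton (two_le_succPNat hj)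
  rw [show i.succ = i + 1 from rfl, show j.succ = j + 1 from rfl, h,
    ← ENNReal.ofReal_mul hA.mzv_nonneg,
    ENNReal.ofReal_eq_ofReal_iff (sum_mul_doubleZeta_nonneg _ _)
      (mul_nonneg hA.mzv_nonneg hB.mzv_nonneg)] at h'
  rw [MulMemClass.coe_mul, coe_zeta hA, coe_zeta hB]
  exact h'.symm

/-- The sum formula for double zeta values. -/
theorem sum_doubleZeta {n : ℕ} (hn : 1 ≤ n) :
    ∑ q ∈ range n, doubleZeta n q = zeta [(n + 1).succPNat] := by
  obtain ⟨m, rfl⟩ : ∃ m, n = m + 1 := ⟨n - 1, by omega⟩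
  -- The series T(1, m+1, 1) is evaluated twice. Both expressions contain one extra copy of ζ(1,
  -- m+2), which is finite and cancels.
  have h := tornheim_recursion (m + 1) 0 m (by omega)
  rw [show m + 1 - 0 - m = 1 by omega, zero_add, zero_add,
    sum_congr rfl fun q hq => by rw [ofReal_doubleZeta (mem_range.1 hq)],
    sum_nsmul_ofReal_doubleZeta (m + 1) fun q => (m - q).choose m + (m - q).choose 0] at h
  have h' := tornheim_one_one m.succPNat
  have hA := admissible_singleton (two_le_succPNat (n := m + 1 + 1) (by omega))
  have hB := admissible_doubleZeta (n := m + 1) (q := 0) (by omega)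
  have e1 : m.succPNat + 1 = (m + 1 - 0).succPNat := PNat.eq rfl
  have e2 : m.succPNat + 2 = (m + 1 + 1).succPNat := PNat.eq rfl
  have e3 : (1 : ℕ+) = Nat.succPNat 0 := rfl
  rw [tornheim_comm, Nat.succPNat_coe, e1, e2, e3, ← coe_zeta hA, ← coe_zeta hB] at h'
  have hs : ∑ q ∈ range (m + 1), (((m - q).choose m + (m - q).choose 0 : ℕ) : ZAlg) *
      doubleZeta (m + 1) q = doubleZeta (m + 1) 0 + ∑ q ∈ range (m + 1), doubleZeta (m + 1) q := by
    simp only [Nat.choose_zero_right, Nat.cast_add, Nat.cast_one, add_mul, one_mul, sum_add_distrib]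
    congr 1
    rw [sum_range_succ', sum_eq_zero]
    · simp
    · intro q hq
      have := mem_range.1 hq
      rw [Nat.choose_eq_zero_of_lt (by omega), Nat.cast_zero, zero_mul]
  have hA0 : (0 : ℝ) ≤ (zeta [(m + 1 + 1).succPNat] : ℝ) := by
    rw [coe_zeta hA]; exact hA.mzv_nonneg
  have hB0 := doubleZeta_nonneg (n := m + 1) (q := 0) (by omega)
  have hfin := h.symm.trans h'
  change _ = ENNReal.ofReal (doubleZeta (m + 1) 0 : ℝ) + _ at hfin
  rw [← ENNReal.ofReal_add hB0 hA0, ENNReal.ofReal_eq_ofReal_iff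
    (sum_mul_doubleZeta_nonneg (m + 1) fun q => (m - q).choose m + (m - q).choose 0)
    (add_nonneg hB0 hA0), hs] at hfin
  apply Subtype.ext
  rw [AddMemClass.coe_add] at hfin
  exact add_left_cancel hfin

/-- The stuffle product of two zeta values. -/
theorem zeta_mul_zeta_stuffle {i j : ℕ+} (hi : 2 ≤ i) (hj : 2 ≤ j) :
    zeta [i] * zeta [j] = zeta [i, j] + zeta [j, i] + zeta [i + j] := by
  have hfin : ∀ ys : List ℝ, nestedSum ys [i] * nestedSum ys [j] =
      nestedSum ys [i, j] + nestedSum ys [j, i] + nestedSum ys [i + j] := by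
    intro ys
    induction ys with
    | nil => simp [nestedSum]
    | cons y ys ih =>
      simp only [nestedSum_cons, nestedSum_nil_right, PNat.add_coe, pow_add]
      linear_combination ih
  have hij : (2 : ℕ+) ≤ i + j := hi.trans (PNat.lt_add_right i j).le
  apply Subtype.ext
  push_cast
  rw [coe_zeta (admissible_singleton hi), coe_zeta (admissible_singleton hj),
    coe_zeta (admissible_pair i hj), coe_zeta (admissible_pair j hi),
    coe_zeta (admissible_singleton hij)]
  refine tendsto_nhds_unique ((admissible_singleton hi).tendsto_mzvTrunc.mul
    (admissible_singleton hj).tendsto_mzvTrunc) ?_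
  refine Tendsto.congr (fun M => (hfin _).symm) ?_
  exact ((admissible_pair i hj).tendsto_mzvTrunc.add (admissible_pair j hi).tendsto_mzvTrunc).add
    (admissible_singleton hij).tendsto_mzvTrunc

end

/-! ### Regularized values at indices with one or two entries greater than one -/

noncomputable section

theorem onesWord_succ (a : ℕ) : onesWord (a + 1) = onesWord a ++ [Letter.e1] :=
  List.replicate_succ'

theorem indexWord_oneTwoOne (a b : ℕ) :
    indexWord (oneTwoOne a b) = onesWord (a + 1) ++ [Letter.e0] ++ onesWord b := by
  rw [oneTwoOne, indexWord_append, indexWord_append, indexWord_replicate_one,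
    indexWord_replicate_one, onesWord_succ]
  simp [indexWord_singleton]

theorem head?_onesWord_append (p : ℕ) (w : Word) :
    (onesWord (p + 1) ++ w).head? = some Letter.e1 := by
  simp [onesWord, List.replicate_succ]

theorem zetaPoly_eq_of_dualWord {w : Word} {l : Index} (hl : Admissible l)
    (hw : w.head? = some Letter.e1) (hw' : w.getLast? = some Letter.e0)
    (h : indexWord l = dualWord w) : zetaPoly (wordPoly w) = zeta l := by
  obtain ⟨k, hk, rfl⟩ := AdmissibleWord.exists_index (w := w) (Or.inr ⟨hw, hw'⟩)
  rw [zetaPoly_indexWord, zeta_eq_of_dualWord hk hl ?_ h]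
  rintro rfl
  simp [indexWord_nil] at hw

theorem zetaPoly_one_block {p : ℕ} (hp : 1 ≤ p) :
    zetaPoly (wordPoly (onesWord p ++ [Letter.e0])) = zeta [p.succPNat] := by
  obtain ⟨q, rfl⟩ : ∃ q, p = q + 1 := ⟨p - 1, by omega⟩
  refine zetaPoly_eq_of_dualWord (admissible_singleton (two_le_succPNat hp))
    (head?_onesWord_append _ _) (by simp) ?_
  simp [indexWord_singleton, dualWord]

theorem zetaPoly_two_blocks {n q : ℕ} (hq : q < n) :
    zetaPoly (wordPoly (onesWord (n - q) ++ Letter.e0 :: onesWord q ++ [Letter.e0])) =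
      doubleZeta n q := by
  obtain ⟨p, hp⟩ : ∃ p, n - q = p + 1 := ⟨n - q - 1, by omega⟩
  refine zetaPoly_eq_of_dualWord (admissible_doubleZeta hq) ?_ List.getLast?_concat ?_
  · rw [hp, List.append_assoc]; exact head?_onesWord_append _ _
  · rw [show [q.succPNat, (n - q).succPNat] = [q.succPNat] ++ [(n - q).succPNat] from rfl,
      indexWord_append, indexWord_singleton, indexWord_singleton]
    simp [dualWord]

/-- Regularization shuffles the trailing e₁ᵇ into the ones before e₀, giving a binomial multiple of
a word e₁ⁿ e₀, whose dual e₁ e₀ⁿ has depth one. -/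
theorem zetaSh_oneTwoOne (a b : ℕ) : zetaSh (oneTwoOne a b) =
    (-1) ^ b * ((a + b + 1).choose b : ZAlg) * zeta [(a + b + 1).succPNat] := by
  rw [zetaSh_eq_regCoeff (by simp [List.replicate_succ]) (indexWord_oneTwoOne a b), regCoeff,
    shuffleOnes_onesWord, map_smul, map_smul, map_smul, appendLetter_single,
    zetaPoly_one_block (by omega), show b + (a + 1) = a + b + 1 by ring]
  rw [Algebra.smul_def, Algebra.smul_def]
  simp [mul_assoc]

/-- The regularized value at `e₁ᴾ e₀ e₁^Q e₀ e₁ᶜ`. -/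
theorem zetaSh_two_blocks {k : Index} {P Q c n : ℕ} (hP : 1 ≤ P) (hn : P + Q + c = n)
    (hk : indexWord k = onesWord P ++ Letter.e0 :: onesWord Q ++ [Letter.e0] ++ onesWord c) :
    zetaSh k = (-1) ^ c * ∑ t ∈ range (c + 1),
      ((n - (t + Q)).choose P : ZAlg) * ((t + Q).choose Q : ZAlg) * doubleZeta n (t + Q) := by
  obtain ⟨p, rfl⟩ : ∃ p, P = p + 1 := ⟨P - 1, by omega⟩
  rw [zetaSh_eq_regCoeff (head?_onesWord_append _ _) hk, regCoeff, shuffleOnes_two_blocks,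
    map_smul, map_sum, map_sum, Algebra.smul_def]
  congr 1
  · simp
  · refine sum_congr rfl fun t ht => ?_
    have ht' := mem_range_succ_iff.1 ht
    rw [map_smul, map_smul, appendLetter_single, show c - t + (p + 1) = n - (t + Q) by omega,
      zetaPoly_two_blocks (by omega), Algebra.smul_def]
    simp

theorem indexDeriv_replicate_one {R : Type*} [CommRing R] (f : Index → R) (m : ℕ) :
    indexDeriv f (List.replicate m 1) =
      ∑ i ∈ range m, f (oneTwoOne i (m - 1 - i)) := by
  induction m generalizing f with
  | zero => rfl
  | succ m ih =>
    rw [List.replicate_succ, indexDeriv, ih, sum_range_succ', add_comm]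
    congr 1
    · refine sum_congr rfl fun i _ => ?_
      rw [← oneTwoOne_succ, show m + 1 - 1 - (i + 1) = m - 1 - i by omega]
    · simp [oneTwoOne_zero]
      rfl

/-- The coefficients form an alternating row of Pascal's triangle without its last entry. -/
theorem indexDeriv_zetaSh_replicate_one {m : ℕ} (hm : 1 ≤ m) :
    indexDeriv zetaSh (List.replicate m 1) = -(-1) ^ m * zeta [m.succPNat] := by
  have h1 : ∀ i ∈ range m, zetaSh (oneTwoOne i (m - 1 - i)) =
      (-1) ^ (m - 1 - i) * (m.choose (m - 1 - i) : ZAlg) * zeta [m.succPNat] := by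
    intro i hi
    have := mem_range.1 hi
    rw [zetaSh_oneTwoOne, show i + (m - 1 - i) + 1 = m by omega]
  rw [indexDeriv_replicate_one, sum_congr rfl h1, ← sum_mul,
    sum_range_reflect (fun j => (-1 : ZAlg) ^ j * (m.choose j : ZAlg)) m]
  congr 1
  have h2 := congrArg (Int.cast : ℤ → ZAlg) (Int.alternating_sum_range_choose_of_ne
    (n := m) (by omega))
  rw [sum_range_succ] at h2
  push_cast at h2
  rw [Nat.choose_self, Nat.cast_one, mul_one] at h2
  linear_combination h2

theorem indexDeriv_zetaSh_oneTwoOne_eq_sum (a b : ℕ) :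
    indexDeriv zetaSh (oneTwoOne b a) =
      ∑ i ∈ range (b + 1), (-1) ^ a * ∑ t ∈ range (a + 1),
        ((a + b + 1 - (t + (b - i))).choose (i + 1) : ZAlg) * ((t + (b - i)).choose (b - i) : ZAlg) *
          doubleZeta (a + b + 1) (t + (b - i)) +
      ∑ j ∈ range (a + 1), (-1) ^ (a - j) * ∑ t ∈ range (a - j + 1),
        ((a + b + 1 - (t + j)).choose (b + 1) : ZAlg) * ((t + j).choose j : ZAlg) *
          doubleZeta (a + b + 1) (t + j) := by
  have h3 : zetaSh (List.replicate b 1 ++ [3] ++ List.replicate a 1) =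
      (-1) ^ a * ∑ t ∈ range (a + 1),
        ((a + b + 1 - (t + 0)).choose (b + 1) : ZAlg) * ((t + 0).choose 0 : ZAlg) *
          doubleZeta (a + b + 1) (t + 0) := by
    refine zetaSh_two_blocks (by omega) (by ring) ?_
    rw [indexWord_append, indexWord_append, indexWord_replicate_one, indexWord_replicate_one,
      indexWord_singleton, onesWord_succ b, show ((3 : ℕ+) : ℕ) - 1 = 2 from rfl]
    simp [List.replicate_succ]
  have h22 : ∀ i j c : ℕ, i + j + c + 2 = a + b + 1 →
      zetaSh (oneTwoOne i j ++ [2] ++ List.replicate c 1) =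
      (-1) ^ c * ∑ t ∈ range (c + 1),
        ((a + b + 1 - (t + (j + 1))).choose (i + 1) : ZAlg) * ((t + (j + 1)).choose (j + 1) : ZAlg) *
          doubleZeta (a + b + 1) (t + (j + 1)) := by
    intro i j c h
    refine zetaSh_two_blocks (by omega) (by omega) ?_
    rw [indexWord_append, indexWord_append, indexWord_oneTwoOne, indexWord_replicate_one,
      indexWord_singleton, onesWord_succ j, show ((2 : ℕ+) : ℕ) - 1 = 1 from rfl]
    simp
  rw [oneTwoOne, indexDeriv_append, indexDeriv_append, indexDeriv_replicate_one,
    indexDeriv_replicate_one, sum_range_succ' _ a, sum_range_succ _ b]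
  have hA : ∀ i ∈ range b, zetaSh (oneTwoOne i (b - 1 - i) ++ [2] ++ List.replicate a 1) =
      (-1) ^ a * ∑ t ∈ range (a + 1),
        ((a + b + 1 - (t + (b - i))).choose (i + 1) : ZAlg) * ((t + (b - i)).choose (b - i) : ZAlg) *
          doubleZeta (a + b + 1) (t + (b - i)) := by
    intro i hi
    have hi' := mem_range.1 hi
    rw [h22 i (b - 1 - i) a (by omega), show b - 1 - i + 1 = b - i by omega]
  have hB : ∀ j ∈ range a, zetaSh (List.replicate b 1 ++ [2] ++ oneTwoOne j (a - 1 - j)) =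
      (-1) ^ (a - (j + 1)) * ∑ t ∈ range (a - (j + 1) + 1),
        ((a + b + 1 - (t + (j + 1))).choose (b + 1) : ZAlg) * ((t + (j + 1)).choose (j + 1) : ZAlg) *
          doubleZeta (a + b + 1) (t + (j + 1)) := by
    intro j hj
    have hj' := mem_range.1 hj
    rw [← h22 b j (a - (j + 1)) (by omega), show a - (j + 1) = a - 1 - j by omega]
    congr 1
    simp [oneTwoOne]
  rw [sum_congr rfl hA, sum_congr rfl hB]
  -- Raising the entry 2 has multiplicity 2. One copy supplies the term i = b of the first sum, the
  -- other the term j = 0 of the second.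
  have hmid : indexDeriv (fun m => zetaSh (List.replicate b 1 ++ m ++ List.replicate a 1)) [2] =
      2 * zetaSh (List.replicate b 1 ++ [3] ++ List.replicate a 1) := by
    have h1 : (2 : ℕ+) + 1 = 3 := rfl
    have h2 : ((2 : ℕ+) : ℕ) = 2 := rfl
    simp only [indexDeriv, add_zero, h1, h2]
    norm_num
  rw [hmid, h3, Nat.sub_self, Nat.sub_zero]
  ring

/-- The regularized value of the derivative in terms of double zeta values. -/
theorem indexDeriv_zetaSh_oneTwoOne (a b : ℕ) :
    indexDeriv zetaSh (oneTwoOne b a) = (-1) ^ a *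
      (∑ q ∈ range (a + b + 1), (((a + b + 1).choose (b + 1) : ZAlg) - (q.choose (b + 1) : ZAlg)) *
        doubleZeta (a + b + 1) q + ((a + b + 1).choose (b + 1) : ZAlg) * doubleZeta (a + b + 1) 0) := by
  set n := a + b + 1 with hn
  rw [indexDeriv_zetaSh_oneTwoOne_eq_sum, mul_add]
  congr 1
  · rw [← mul_sum]
    congr 1
    have h1 : ∀ i ∈ range (b + 1), ∑ t ∈ range (a + 1),
        ((n - (t + (b - i))).choose (i + 1) : ZAlg) * ((t + (b - i)).choose (b - i) : ZAlg) *
          doubleZeta n (t + (b - i)) =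
        ∑ q ∈ range n, ((n - q).choose (i + 1) : ZAlg) * (q.choose (b - i) : ZAlg) *
          doubleZeta n q := by
      intro i hi
      have hi' := mem_range_succ_iff.1 hi
      rw [show range n = range (b - i + (a + 1) + i) by congr 1; omega,
        sum_range_add _ (b - i + (a + 1)) i, sum_range_add _ (b - i) (a + 1)]
      rw [sum_eq_zero (s := range (b - i)), sum_eq_zero (s := range i), zero_add, add_zero]
      · exact sum_congr rfl fun t _ => by rw [add_comm t]
      · intro q hq
        have := mem_range.1 hq
        rw [Nat.choose_eq_zero_of_lt (k := i + 1) (by omega), Nat.cast_zero, zero_mul, zero_mul]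
      · intro q hq
        have := mem_range.1 hq
        rw [Nat.choose_eq_zero_of_lt (n := q) (by omega), Nat.cast_zero, mul_zero, zero_mul]
    rw [sum_congr rfl h1, sum_comm]
    refine sum_congr rfl fun q hq => ?_
    have hq' := mem_range.1 hq
    rw [← sum_mul]
    congr 1
    -- Vandermonde's identity; the missing summand accounts for the subtracted C(q, b+1).
    have h2 := Nat.add_choose_eq (n - q) q (b + 1)
    rw [show n - q + q = n by omega, Finset.Nat.sum_antidiagonal_eq_sum_range_succ_mk,
      sum_range_succ'] at h2
    simp only [Nat.add_sub_add_right, Nat.choose_zero_right, one_mul, Nat.sub_zero] at h2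
    rw [h2]
    push_cast
    ring
  · have h1 : ∀ j ∈ range (a + 1), (-1 : ZAlg) ^ (a - j) * ∑ t ∈ range (a - j + 1),
        ((n - (t + j)).choose (b + 1) : ZAlg) * ((t + j).choose j : ZAlg) * doubleZeta n (t + j) =
        ∑ q ∈ Ico j (a + 1), (-1 : ZAlg) ^ (a - j) * (((n - q).choose (b + 1) : ZAlg) *
          (q.choose j : ZAlg) * doubleZeta n q) := by
      intro j hj
      have hj' := mem_range_succ_iff.1 hj
      rw [sum_Ico_eq_sum_range, mul_sum, show a + 1 - j = a - j + 1 by omega]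
      exact sum_congr rfl fun t _ => by rw [add_comm t]
    rw [sum_congr rfl h1]
    have hswap : ∑ j ∈ range (a + 1), ∑ q ∈ Ico j (a + 1), (-1 : ZAlg) ^ (a - j) *
        (((n - q).choose (b + 1) : ZAlg) * (q.choose j : ZAlg) * doubleZeta n q) =
        ∑ q ∈ range (a + 1), ∑ j ∈ range (q + 1), (-1 : ZAlg) ^ (a - j) *
        (((n - q).choose (b + 1) : ZAlg) * (q.choose j : ZAlg) * doubleZeta n q) := by
      refine sum_comm' fun j q => ?_
      simp only [mem_range, mem_Ico]
      omega
    -- The alternating sum of C(q, j) over j vanishes for q > 0, so only the term of ζ(1, n + 1) is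
    -- left.
    rw [hswap, sum_range_succ', sum_eq_zero, zero_add]
    · simp
    · intro q hq
      have hq' := mem_range.1 hq
      have h2 := congrArg (Int.cast : ℤ → ZAlg) (Int.alternating_sum_range_choose_of_ne
        (n := q + 1) (by omega))
      push_cast at h2
      have h3 : ∀ j ∈ range (q + 1 + 1), (-1 : ZAlg) ^ (a - j) *
          (((n - (q + 1)).choose (b + 1) : ZAlg) * ((q + 1).choose j : ZAlg) *
            doubleZeta n (q + 1)) =
          (-1) ^ a * ((n - (q + 1)).choose (b + 1) : ZAlg) * doubleZeta n (q + 1) *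
            ((-1) ^ j * ((q + 1).choose j : ZAlg)) := by
        intro j hj
        have hj' := mem_range_succ_iff.1 hj
        have h4 : (-1 : ZAlg) ^ (a - j) = (-1) ^ a * (-1) ^ j := by
          have h5 : (-1 : ZAlg) ^ j * (-1) ^ j = 1 := by rw [← mul_pow]; simp
          nth_rewrite 2 [← Nat.sub_add_cancel (show j ≤ a by omega)]
          rw [pow_add, mul_assoc, h5, mul_one]
        rw [h4]
        ring
      rw [sum_congr rfl h3, ← mul_sum, h2, mul_zero]

end

/-! ### The parity theorem in depth two -/

section BinaryForm

variable {K : Type*} [CommRing K]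

/-- The binary form with coefficients `e₀, …, eₙ`. -/
def binaryForm (e : ℕ → K) (n : ℕ) (u v : K) : K :=
  ∑ p ∈ range (n + 1), e p * (u ^ p * v ^ (n - p))

theorem binaryForm_swap (e : ℕ → K) (n : ℕ) (u v : K) :
    binaryForm e n v u = ∑ p ∈ range (n + 1), e (n - p) * (u ^ p * v ^ (n - p)) := by
  rw [binaryForm, ← sum_range_reflect]
  refine sum_congr rfl fun p hp => ?_
  rw [mem_range] at hp
  rw [show n + 1 - 1 - p = n - p by omega, show n - (n - p) = p by omega, mul_comm (v ^ _)]

theorem binaryForm_neg {n : ℕ} (hn : Odd n) (e : ℕ → K) (u v : K) :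
    binaryForm e n (-u) (-v) = -binaryForm e n u v := by
  rw [binaryForm, binaryForm, ← sum_neg_distrib]
  refine sum_congr rfl fun p hp => ?_
  rw [mem_range] at hp
  have h : (-1 : K) ^ p * (-1) ^ (n - p) = -1 := by
    rw [← pow_add, show p + (n - p) = n by omega, hn.neg_one_pow]
  rw [neg_pow u, neg_pow v]
  linear_combination e p * u ^ p * v ^ (n - p) * h

theorem binaryForm_add (e : ℕ → K) (n : ℕ) (x y : K) : binaryForm e n (x + y) x =
    binaryForm (fun s => ∑ p ∈ range (n + 1), (p.choose s : K) * e p) n y x := by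
  simp only [binaryForm, sum_mul]
  rw [sum_comm]
  refine sum_congr rfl fun p hp => ?_
  rw [mem_range] at hp
  rw [add_comm x y, add_pow, sum_mul, mul_sum]
  refine sum_subset_zero_on_sdiff (range_subset_range.2 (by omega)) ?_ ?_
  · intro s hs
    rw [mem_sdiff, mem_range, mem_range] at hs
    rw [Nat.choose_eq_zero_of_lt (by omega)]
    simp
  · intro s hs
    rw [mem_range] at hs
    rw [show n - s = (p - s) + (n - p) by omega, pow_add]
    ring

/-- Write F for the form. The hypotheses say that F(u, v) + F(v, u) is a multiple of z and that
F(x+y, x) + F(x+y, y) = 0. Following (u, v), (u, u-v), (u-v, u), (u-v, -v), (v-u, v), (v, v-u), (v,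
u), (u, v), where the odd degree gives F(-x, -y) = -F(x, y), one returns to F(u, v) with opposite
sign, up to multiples of z. -/
theorem two_mul_binaryForm {n : ℕ} (hn : Odd n) {e : ℕ → K} {z : K}
    (h1 : ∀ p ≤ n, e p + e (n - p) = -z)
    (h2 : ∀ s ≤ n, ∑ p ∈ range (n + 1), (p.choose s : K) * e p +
      ∑ p ∈ range (n + 1), (p.choose (n - s) : K) * e p = 0) (u v : K) :
    2 * binaryForm e n u v = z * (binaryForm 1 n u (u - v) - binaryForm 1 n (v - u) v -
      binaryForm 1 n u v) := by
  have swap : ∀ u v, binaryForm e n u v + binaryForm e n v u = -z * binaryForm 1 n u v := by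
    intro u v
    rw [binaryForm_swap e n u v, binaryForm, binaryForm, ← sum_add_distrib, mul_sum]
    refine sum_congr rfl fun p hp => ?_
    rw [mem_range] at hp
    rw [Pi.one_apply]
    linear_combination u ^ p * v ^ (n - p) * h1 p (by omega)
  have shift : ∀ x y, binaryForm e n (x + y) x + binaryForm e n (x + y) y = 0 := by
    intro x y
    rw [binaryForm_add, add_comm x y, binaryForm_add, binaryForm_swap _ n y x, binaryForm,
      ← sum_add_distrib]
    refine sum_eq_zero fun s hs => ?_
    rw [mem_range] at hs
    linear_combination y ^ s * x ^ (n - s) * h2 s (by omega)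
  have e1 := shift v (u - v)
  have e2 := shift u (-v)
  have e3 := binaryForm_neg hn e (v - u) v
  rw [add_sub_cancel] at e1
  rw [← sub_eq_add_neg] at e2
  rw [neg_sub] at e3
  have e4 := shift (v - u) u
  rw [sub_add_cancel] at e4
  linear_combination e1 - swap u (u - v) + e2 - e3 + swap (v - u) v - e4 + swap u v

theorem binaryForm_one_mul_sub (n : ℕ) (u v : K) :
    binaryForm 1 n u v * (u - v) = u ^ (n + 1) - v ^ (n + 1) := by
  rw [← geom_sum₂_mul, binaryForm]
  simp

theorem sum_range_choose_eq (n b : ℕ) :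
    ∑ p ∈ range (n + 1), (p.choose b : K) = ((n + 1).choose (b + 1) : K) := by
  rw [← Nat.cast_sum]
  congr 1
  induction n with
  | zero => cases b <;> simp [Nat.choose]
  | succ n ih => rw [sum_range_succ, ih, Nat.choose_succ_succ' (n + 1), add_comm]

open Polynomial in
-- Evaluate the form over K[X] at u = 1 + X and v = 1. The coefficient of X^b on the left is the
-- binomial sum, and on the right there are geometric sums.
theorem two_mul_sum_choose_mul {n : ℕ} (hn : Odd n) {e : ℕ → K} {z : K}
    (h1 : ∀ p ≤ n, e p + e (n - p) = -z)
    (h2 : ∀ s ≤ n, ∑ p ∈ range (n + 1), (p.choose s : K) * e p +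
      ∑ p ∈ range (n + 1), (p.choose (n - s) : K) * e p = 0) {b : ℕ} (hb : b ≤ n) :
    2 * ∑ p ∈ range (n + 1), (p.choose b : K) * e p =
      z * ((n + 1).choose b - (-1) ^ b - (n + 1).choose (b + 1)) := by
  have key := two_mul_binaryForm hn (e := fun p => C (e p)) (z := C z)
    (fun p hp => by rw [← C_add, h1 p hp, C_neg])
    (fun s hs => by
      simp only [← C_eq_natCast, ← C_mul, ← map_sum C]
      rw [← C_add, h2 s hs, C_0]) (1 + X) 1
  have k1 : binaryForm 1 n (1 + X : K[X]) (1 + X - 1) = (1 + X) ^ (n + 1) - X ^ (n + 1) := by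
    rw [add_sub_cancel_left]
    have := binaryForm_one_mul_sub n (1 + X : K[X]) X
    rwa [add_sub_cancel_right, mul_one] at this
  have k2 : binaryForm 1 n (1 - (1 + X) : K[X]) 1 = ∑ p ∈ range (n + 1), C ((-1) ^ p) * X ^ p := by
    refine sum_congr rfl fun p _ => ?_
    rw [sub_add_cancel_left, neg_pow (X : K[X])]
    simp
  have k3 : binaryForm 1 n (1 + X : K[X]) 1 = ∑ p ∈ range (n + 1), (1 + X) ^ p := by
    refine sum_congr rfl fun p _ => ?_
    simp
  rw [k1, k2, k3] at key
  have key' := congrArg (coeff · b) key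
  simp only [binaryForm, one_pow, mul_one, coeff_C_mul, coeff_sub, finsetSum_coeff,
    coeff_one_add_X_pow, coeff_X_pow, ← C_ofNat, sum_range_choose_eq] at key'
  simp only [mul_ite, mul_one, mul_zero, sum_ite_eq, mem_range, if_neg (show b ≠ n + 1 by omega),
    if_pos (show b < n + 1 by omega), sub_zero] at key'
  simpa only [mul_comm (e _)] using key'

/-- The preceding evaluation for the reversed coefficients d(n - p), turned back by the symmetry
`h1`. -/
theorem neg_sum_choose_mul {n : ℕ} (hn : Odd n) {d : ℕ → K} {z : K}
    (h1 : ∀ q ≤ n, d q + d (n - q) = -z)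
    (h2 : ∀ s ≤ n, ∑ q ∈ range (n + 1), (((n - q).choose s : K) * d q +
      ((n - q).choose (n - s) : K) * d q) = 0) {b : ℕ} (hb : b < n) :
    2 * -∑ q ∈ range (n + 1), (q.choose (b + 1) : K) * d q =
      ((-1) ^ b + (n + 2).choose (b + 2)) * z := by
  have key := two_mul_sum_choose_mul hn (e := fun p => d (n - p)) (z := z)
    (fun p hp => by rw [h1 _ (Nat.sub_le n p)]) (fun s hs => by
      rw [← h2 s hs, ← sum_add_distrib, ← sum_range_reflect]
      refine sum_congr rfl fun p hp => ?_
      rw [mem_range] at hp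
      rw [show n + 1 - 1 - p = n - p by omega, show n - (n - p) = p by omega])
    (show b + 1 ≤ n from hb)
  have h3 : ∑ q ∈ range (n + 1), (q.choose (b + 1) : K) * d q +
      ∑ q ∈ range (n + 1), (q.choose (b + 1) : K) * d (n - q) =
      -z * ((n + 1).choose (b + 2) : K) := by
    rw [← sum_range_choose_eq, ← sum_add_distrib, mul_sum]
    refine sum_congr rfl fun q hq => ?_
    rw [mem_range] at hq
    linear_combination (q.choose (b + 1) : K) * h1 q (by omega)
  rw [Nat.choose_succ_succ' (n + 1), Nat.cast_add]
  rw [pow_succ] at key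
  linear_combination -2 * h3 + key

end BinaryForm

noncomputable section

variable {R : Type*} [CommRing R] (φ : ZAlg →+* R)

/-- The total weight i + j + 2 is odd, so one of the two arguments is even and Euler's evaluation
applies to it. -/
theorem map_zeta_mul_zeta_eq_zero (hφ : ∀ z ∈ Ideal.span {zeta [2]}, φ z = 0) {i j : ℕ}
    (hij : Odd (i + j)) : φ (zeta [i.succPNat] * zeta [j.succPNat]) = 0 := by
  apply hφ
  rcases Nat.even_or_odd i with hi | hi
  · refine Ideal.mul_mem_left _ _ (zeta_even_mem ?_)
    rw [Nat.succPNat_coe]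
    rw [Nat.odd_add', iff_true_right hi] at hij
    exact hij.add_one
  · refine Ideal.mul_mem_right _ _ (zeta_even_mem ?_)
    rw [Nat.succPNat_coe]
    exact hi.add_one

theorem two_mul_map_indexDeriv_zetaSh (hφ : ∀ z ∈ Ideal.span {zeta [2]}, φ z = 0) {a b : ℕ}
    (hab : Even (a + b)) : 2 * φ (indexDeriv zetaSh (oneTwoOne b a)) =
      (1 + (-1) ^ a * ((a + b + 3).choose (b + 2) : R)) * φ (zeta [(a + b + 2).succPNat]) := by
  obtain ⟨n, hn⟩ : ∃ n, n = a + b + 1 := ⟨_, rfl⟩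
  have hodd : Odd n := hn ▸ hab.add_one
  set z := φ (zeta [(n + 1).succPNat]) with hz
  -- The entry q = n would be the divergent ζ(n + 1, 1). The value assigned to it is the one that
  -- makes the stuffle relation `h1` hold at the two ends; the sum formula then makes `h2` hold for
  -- s = 0 and s = n.
  set d : ℕ → R := fun q => if q = n then -z - φ (doubleZeta n 0) else φ (doubleZeta n q) with hd
  have hdn : d n = -z - φ (doubleZeta n 0) := if_pos rfl
  have hdq : ∀ q ∈ range n, d q = φ (doubleZeta n q) := fun q hq =>
    if_neg (mem_range.1 hq).ne
  have hd0 : d 0 = φ (doubleZeta n 0) := hdq 0 (mem_range.2 (by omega))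
  have hsum : ∑ q ∈ range n, d q = z := by
    rw [sum_congr rfl hdq, ← map_sum, sum_doubleZeta (by omega)]
  have h1 : ∀ q ≤ n, d q + d (n - q) = -z := by
    intro q hq
    rcases Nat.eq_zero_or_pos q with rfl | hq0
    · rw [Nat.sub_zero, hdn, hd0]
      ring
    rcases hq.eq_or_lt with rfl | hqn
    · rw [Nat.sub_self, hdn, hd0]
      ring
    have h := map_zeta_mul_zeta_eq_zero φ hφ (i := q) (j := n - q)
      (by rwa [Nat.add_sub_cancel' hq])
    rw [zeta_mul_zeta_stuffle (two_le_succPNat hq0) (two_le_succPNat (by omega)), map_add,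
      map_add] at h
    rw [hdq q (mem_range.2 hqn), hdq (n - q) (mem_range.2 (by omega)), doubleZeta, doubleZeta,
      Nat.sub_sub_self hq]
    have h' : q.succPNat + (n - q).succPNat = (n + 1).succPNat := by
      apply PNat.eq
      simp only [PNat.add_coe, Nat.succPNat_coe]
      omega
    rw [h'] at h
    linear_combination h
  have h2 : ∀ s ≤ n, ∑ q ∈ range (n + 1), (((n - q).choose s : R) * d q +
      ((n - q).choose (n - s) : R) * d q) = 0 := by
    have hend : ∑ q ∈ range (n + 1), (((n - q).choose 0 : R) * d q +
        ((n - q).choose n : R) * d q) = 0 := by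
      rw [sum_add_distrib, sum_eq_single_of_mem (s := range (n + 1)) (a := 0)
        (f := fun q => ((n - q).choose n : R) * d q) (by simp)]
      · simp only [Nat.choose_zero_right, Nat.cast_one, one_mul, Nat.sub_zero, Nat.choose_self]
        rw [sum_range_succ, hsum, hdn, hd0]
        ring
      · intro q hq hq0
        rw [Nat.choose_eq_zero_of_lt (by omega), Nat.cast_zero, zero_mul]
    intro s hs
    rcases Nat.eq_zero_or_pos s with rfl | hs0
    · rwa [Nat.sub_zero]
    rcases hs.eq_or_lt with rfl | hsn
    · rw [Nat.sub_self, ← hend]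
      exact sum_congr rfl fun q _ => add_comm _ _
    have h := map_zeta_mul_zeta_eq_zero φ hφ (i := n - s) (j := s)
      (by rwa [Nat.sub_add_cancel hs])
    rw [zeta_mul_zeta_eq_sum (by omega) hs0 (Nat.sub_add_cancel hs), map_sum] at h
    rw [sum_range_succ, Nat.sub_self, Nat.choose_eq_zero_of_lt hs0,
      Nat.choose_eq_zero_of_lt (show 0 < n - s by omega), ← h]
    simp only [Nat.cast_zero, zero_mul, add_zero]
    refine sum_congr rfl fun q hq => ?_
    rw [hdq q hq, map_mul, map_natCast, Nat.cast_add, add_mul]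
  have key := neg_sum_choose_mul hodd h1 h2 (b := b) (by omega)
  have hV : φ (indexDeriv zetaSh (oneTwoOne b a)) =
      (-1) ^ a * -∑ q ∈ range (n + 1), (q.choose (b + 1) : R) * d q := by
    rw [indexDeriv_zetaSh_oneTwoOne, ← hn, map_mul, map_pow, map_neg, map_one, map_add, map_mul,
      map_natCast, map_sum, sum_range_succ, hdn]
    have h3 : ∑ q ∈ range n, φ ((((n.choose (b + 1) : ℕ) : ZAlg) - ((q.choose (b + 1) : ℕ) : ZAlg)) *
        doubleZeta n q) = (n.choose (b + 1) : R) * z -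
          ∑ q ∈ range n, (q.choose (b + 1) : R) * d q := by
      rw [← hsum, mul_sum, ← sum_sub_distrib]
      refine sum_congr rfl fun q hq => ?_
      rw [hdq q hq, map_mul, map_sub, map_natCast, map_natCast, sub_mul]
    rw [h3]
    ring
  have hpow : (-1 : R) ^ a * (-1) ^ b = 1 := by rw [← pow_add, hab.neg_one_pow]
  rw [hV, show a + b + 2 = n + 1 by omega, ← hz, show a + b + 3 = n + 2 by omega]
  linear_combination (-1) ^ a * key + z * hpow

end

/-! ### The values of `ζ_{𝒮₂}` and `ζ^⋆_{𝒮₂}` -/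

noncomputable section

section ReducedValues

variable {R : Type*} [CommRing R] (φ : ZAlg →+* R)

theorem map_zetaSh_replicate_one (i : ℕ) :
    φ (zetaSh (List.replicate i 1)) = if i = 0 then 1 else 0 := by
  rw [zetaSh_replicate_one, apply_ite φ, map_one, map_zero]

theorem map_zetaSh_oneTwoOne_eq_zero (hφ : ∀ z ∈ Ideal.span {zeta [2]}, φ z = 0) {a b : ℕ}
    (hab : Even (a + b)) : φ (zetaSh (oneTwoOne a b)) = 0 := by
  refine hφ _ ?_
  rw [zetaSh_oneTwoOne]
  refine Ideal.mul_mem_left _ _ (zeta_even_mem ?_)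
  rw [Nat.succPNat_coe]
  exact hab.add_one.add_one

theorem map_conv_zetaSh_oneTwoOne_eq_zero (hφ : ∀ z ∈ Ideal.span {zeta [2]}, φ z = 0) {a b : ℕ}
    (hab : Even (a + b)) :
    φ (conv zetaSh (fun l => (-1) ^ wt l * zetaSh l.reverse) (oneTwoOne a b)) = 0 := by
  rw [conv_oneTwoOne, map_add, map_sum, map_sum, sum_eq_zero, sum_eq_zero, add_zero]
  · intro i hi
    rw [mem_range] at hi
    rw [List.reverse_replicate, map_mul, map_mul, map_zetaSh_replicate_one]
    split_ifs with h
    · rw [show i = b by omega, map_zetaSh_oneTwoOne_eq_zero φ hφ hab, zero_mul]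
    · rw [mul_zero, mul_zero]
  · intro i hi
    rw [reverse_oneTwoOne, map_mul, map_mul, map_zetaSh_replicate_one]
    split_ifs with h
    · rw [h, Nat.sub_zero, map_zetaSh_oneTwoOne_eq_zero φ hφ (add_comm a b ▸ hab), mul_zero,
        mul_zero]
    · rw [zero_mul]

/-- A nonempty prefix of ones has regularized value 0. A prefix containing the 2 gives a product of
two zeta values of odd total weight, or the derivative at the empty index, which is 0. Only the
empty prefix contributes. -/
theorem map_conv_indexDeriv_zetaSh_oneTwoOne (hφ : ∀ z ∈ Ideal.span {zeta [2]}, φ z = 0)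
    {a b : ℕ} (hab : Even (a + b)) :
    φ (conv zetaSh (fun l => (-1) ^ wt l * indexDeriv zetaSh l.reverse) (oneTwoOne a b)) =
      φ (indexDeriv zetaSh (oneTwoOne b a)) := by
  rw [conv_oneTwoOne, map_add, map_sum, map_sum, sum_eq_single_of_mem 0 (by simp), sum_eq_zero,
    add_zero]
  · rw [Nat.sub_zero, reverse_oneTwoOne, wt_oneTwoOne, map_mul, map_zetaSh_replicate_one,
      if_pos rfl, one_mul, (hab.add even_two).neg_one_pow, one_mul]
  · intro i hi
    rw [mem_range] at hi
    rw [List.reverse_replicate]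
    rcases Nat.eq_zero_or_pos (b - i) with h | h
    · rw [h, List.replicate_zero, indexDeriv, mul_zero, mul_zero, map_zero]
    · have h0 := map_zeta_mul_zeta_eq_zero φ hφ (i := a + i + 1) (j := b - i) (by
        rw [show a + i + 1 + (b - i) = a + b + 1 by omega]
        exact hab.add_one)
      rw [map_mul] at h0
      rw [indexDeriv_zetaSh_replicate_one h, zetaSh_oneTwoOne]
      simp only [map_mul]
      linear_combination (φ ((-1) ^ i) * φ ((a + i + 1).choose i) *
        φ ((-1) ^ wt (List.replicate (b - i) (1 : ℕ+))) * φ (-(-1) ^ (b - i))) * h0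
  · intro i _ hi
    rw [map_mul, map_zetaSh_replicate_one, if_neg hi, zero_mul]

theorem map_conv_zetaSh_replicate_one_eq_zero {m : ℕ} (hm : 1 ≤ m) :
    φ (conv zetaSh (fun l => (-1) ^ wt l * zetaSh l.reverse) (List.replicate m 1)) = 0 := by
  rw [conv_replicate, map_sum]
  refine sum_eq_zero fun i hi => ?_
  rw [List.reverse_replicate, map_mul, map_mul, map_zetaSh_replicate_one, map_zetaSh_replicate_one]
  split_ifs with h1 h2
  · omega
  all_goals simp

theorem map_conv_indexDeriv_zetaSh_replicate_one {m : ℕ} (hm : 1 ≤ m) :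
    φ (conv zetaSh (fun l => (-1) ^ wt l * indexDeriv zetaSh l.reverse) (List.replicate m 1)) =
      -φ (zeta [m.succPNat]) := by
  rw [conv_replicate, map_sum, sum_eq_single_of_mem 0 (by simp)]
  · rw [Nat.sub_zero, List.reverse_replicate, wt_replicate_one, map_mul, map_zetaSh_replicate_one,
      if_pos rfl, one_mul, indexDeriv_zetaSh_replicate_one hm, ← mul_assoc, mul_neg, ← pow_add,
      (Even.add_self m).neg_one_pow, neg_one_mul, map_neg]
  · intro i _ hi
    rw [map_mul, map_zetaSh_replicate_one, if_neg hi, zero_mul]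

theorem two_mul_eq_of_oneTwoOne (hφ : ∀ z ∈ Ideal.span {zeta [2]}, φ z = 0) {x y : R} {a b : ℕ}
    (hab : Even (a + b))
    (hy : y = φ (conv zetaSh (fun l => (-1) ^ wt l * zetaSh l.reverse) (oneTwoOne a b)) +
      φ (conv zetaSh (fun l => (-1) ^ wt l * indexDeriv zetaSh l.reverse) (oneTwoOne a b)) * x) :
    2 * y = ((1 + (-1) ^ a * ((a + b + 3).choose (b + 2) : ℤ) : ℤ) : R) *
      (φ (zeta [(a + b + 2).succPNat]) * x) := by
  rw [hy, map_conv_zetaSh_oneTwoOne_eq_zero φ hφ hab,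
    map_conv_indexDeriv_zetaSh_oneTwoOne φ hφ hab]
  push_cast
  linear_combination x * two_mul_map_indexDeriv_zetaSh φ hφ hab

theorem eq_neg_mul_of_replicate_one {x y : R} {m : ℕ} (hm : 1 ≤ m)
    (hy : y = φ (conv zetaSh (fun l => (-1) ^ wt l * zetaSh l.reverse) (List.replicate m 1)) +
      φ (conv zetaSh (fun l => (-1) ^ wt l * indexDeriv zetaSh l.reverse)
        (List.replicate m 1)) * x) :
    y = x * -φ (zeta [m.succPNat]) := by
  rw [hy, map_conv_zetaSh_replicate_one_eq_zero φ hm,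
    map_conv_indexDeriv_zetaSh_replicate_one φ hm, zero_add, mul_comm]

theorem eq_one_of_nil {x y : R}
    (hy : y = φ (conv zetaSh (fun l => (-1) ^ wt l * zetaSh l.reverse) []) +
      φ (conv zetaSh (fun l => (-1) ^ wt l * indexDeriv zetaSh l.reverse) []) * x) : y = 1 := by
  have h : zetaSh [] = 1 := zetaSh_replicate_one 0
  rw [hy]
  simp [conv, indexDeriv, h]

end ReducedValues

theorem two_mul_zetaS {a b : ℕ} (hab : Even (a + b)) :
    2 * zetaS 2 (oneTwoOne a b) = ((1 + (-1) ^ a * ((a + b + 3).choose (b + 2) : ℤ) : ℤ) : S 2) *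
      (frakZS 2 ⟨a + b + 3, Nat.succ_pos _⟩ * xS 2) :=
  two_mul_eq_of_oneTwoOne (R := S 2) zAlgToS (fun _ hz => zAlgToS_eq_zero hz) hab (zetaS_two_eq _)

theorem zetaS_oneTwoOne {a b : ℕ} (hab : Even (a + b)) :
    zetaS 2 (oneTwoOne a b) =
      ((1 / 2 : ℚ) * (1 + (-1) ^ a * ((a + b + 3).choose (b + 2) : ℚ))) •
        (frakZS 2 ⟨a + b + 3, Nat.succ_pos _⟩ * xS 2) := by
  rw [half_smul_of_two_mul (two_mul_zetaS hab)]
  push_cast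
  rfl

theorem zetaS_nil : zetaS 2 [] = 1 := eq_one_of_nil (R := S 2) zAlgToS (zetaS_two_eq _)

theorem zetaS_replicate_one {m : ℕ} (hm : 1 ≤ m) :
    zetaS 2 (List.replicate m 1) = xS 2 * -zAlgToS (zeta [m.succPNat]) :=
  eq_neg_mul_of_replicate_one (R := S 2) zAlgToS hm (zetaS_two_eq _)

/-- An instance of `coarseSum_oneTwoOne` with x = t. In contrast to the case 𝒜, it is the non-star
values that are already known to be divisible by x. -/
theorem zetaStarS_oneTwoOne_eq_zetaS {a b : ℕ} (hab : Even (a + b)) :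
    zetaStarS 2 (oneTwoOne a b) = zetaS 2 (oneTwoOne b a) := by
  rw [zetaStarS_eq_coarseSum]
  refine coarseSum_oneTwoOne xS_sq conv_zetaS (fun i => ?_) zetaS_nil (fun i hi => ?_)
    (fun a b h => Or.inl ?_) a b hab
  · exact ⟨_, zetaS_replicate_one (by omega)⟩
  · rw [zetaS_replicate_one hi.pos, zAlgToS_eq_zero (zeta_even_mem (by
      rw [Nat.succPNat_coe]
      exact hi.add_one)), neg_zero]
    exact mul_zero (M₀ := S 2) _
  · rw [zetaS_oneTwoOne h, ← smul_mul_assoc]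
    exact ⟨_, mul_comm (G := S 2) _ _⟩

theorem zetaStarS_oneTwoOne {a b : ℕ} (hab : Even (a + b)) :
    zetaStarS 2 (oneTwoOne a b) =
      ((1 / 2 : ℚ) * (1 + (-1) ^ a * ((a + b + 3).choose (a + 2) : ℚ))) •
        (frakZS 2 ⟨a + b + 3, Nat.succ_pos _⟩ * xS 2) := by
  have hsign : (-1 : ℚ) ^ b = (-1) ^ a := by
    rw [Nat.even_add] at hab
    rcases Nat.even_or_odd a with h | h
    · rw [h.neg_one_pow, (hab.1 h).neg_one_pow]
    · rw [h.neg_one_pow, (Nat.not_even_iff_odd.1 fun hb =>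
        Nat.not_even_iff_odd.2 h (hab.2 hb)).neg_one_pow]
  rw [zetaStarS_oneTwoOne_eq_zetaS hab, zetaS_oneTwoOne (add_comm a b ▸ hab), hsign]
  simp only [add_comm b a]

end

end FMZV

theorem mainTheorem4 (a b : ℕ) (hab : Even (a + b)) :
    (FMZV.zetaA 2 (FMZV.oneTwoOne a b) =
        ((1 / 2 : ℚ) * (1 + (-1) ^ a * ((a + b + 3).choose (b + 2) : ℚ))) •
          (FMZV.frakZA 2 ⟨a + b + 3, Nat.succ_pos _⟩ * FMZV.xA 2) ∧
      FMZV.zetaStarA 2 (FMZV.oneTwoOne a b) =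
        ((1 / 2 : ℚ) * (1 + (-1) ^ a * ((a + b + 3).choose (a + 2) : ℚ))) •
          (FMZV.frakZA 2 ⟨a + b + 3, Nat.succ_pos _⟩ * FMZV.xA 2)) ∧
    (FMZV.zetaS 2 (FMZV.oneTwoOne a b) =
        ((1 / 2 : ℚ) * (1 + (-1) ^ a * ((a + b + 3).choose (b + 2) : ℚ))) •
          (FMZV.frakZS 2 ⟨a + b + 3, Nat.succ_pos _⟩ * FMZV.xS 2) ∧
      FMZV.zetaStarS 2 (FMZV.oneTwoOne a b) =
        ((1 / 2 : ℚ) * (1 + (-1) ^ a * ((a + b + 3).choose (a + 2) : ℚ))) •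
          (FMZV.frakZS 2 ⟨a + b + 3, Nat.succ_pos _⟩ * FMZV.xS 2)) :=
  ⟨⟨FMZV.zetaA_oneTwoOne hab, FMZV.zetaStarA_oneTwoOne hab⟩,
    ⟨FMZV.zetaS_oneTwoOne hab, FMZV.zetaStarS_oneTwoOne hab⟩⟩
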